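/- **Setting.** Algorithm P samples $n$ of the $N$ elements $1..N$ without replacement on $p$ processors ($0\le n\le N$, $p\ge 1$). The range is cut by numbers $0=N_0\le N_1\le\dots\le N_p=N$; processor $i\in 1..p$ has to generate the sample elements that lie in $N_{i-1}+1..N_i$. All processors have a hash function $h$, which is idealized: its values are independent and uniformly distributed on $[0,1]$. Processor $i$ starts with the subproblem "sample $n'=n$ elements on the processors $j..k=1..p$". As long as $j<k$, it puts $m=\lfloor (j+k)/2\rfloor$ and generates a hypergeometric deviate $x$ with parameters $n'$ (experiments), $N_m-N_{j-1}$ (success states), $N_k-N_{j-1}$ (universe size), using $h(j,k,0),h(j,k,1),\dots$ as uniform deviates; it continues with ($x$ elements on $j..m$) if $i\le m$ and with ($n'-x$ elements on $m+1..k$) otherwise. When $j=k=i$, it samples $n'$ of the elements $N_{i-1}+1..N_i$ with a sequential local algorithm, whose random source (independent uniform deviates) is determined by $h$ and $i$. Time is counted in steps of a real RAM: arithmetic operations, comparisons, rounding, $\exp$, $\log$, powers, $\ln k!$, memory accesses, and uniform deviates cost $O(1)$ each. The running time of Algorithm P is the maximum of the running times of the $p$ processors. The hypergeometric generator is any generator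 $G$ of the rejection type: it makes independent trials until one succeeds; a trial uses a constant number of uniform deviates and takes at most a constant number of steps, it succeeds with at least a constant positive probability (these constants do not depend on the parameters of the distribution), and the number returned by a successful trial has the hypergeometric distribution. The local algorithm is one of: Algorithm H (draw uniform keys, reject those already in the hash table; if more than half of the elements are wanted, generate the complement), with one table cell for each element of the local universe; Vitter's Algorithm D (with change to sequential search, Vitter's Method A, as soon as at least a fraction $1/r$ of the remaining elements is to be sampled, $r\ge2$); Algorithm R (recursive halving of the universe with hypergeometric splits generated by $G$) with constant threshold $n_0\ge 2$ and base case H (hash table with chaining and any constant number of cells) or D. **Theorem.** (a) Generators as described exist: Devroye's rejection method for discrete log-concave distributions, applied to the hypergeometric distribution, is one. (b) Let the generator $G$, the local algorithm with its tuning parameters, and real constants $C$ and $c>0$ be given. There is a constant $A>0$, which depends only on these, such that for all $p\ge1$, all $0\le n\le N$ and all $0=N_0\le\dots\le N_p=N$ with $\max_i (N_i-N_{i-1})\le C\,N/p$: 1. Algorithm P runs in time at most $A\,(n/p+\log_2 p)$ with probability at least $1-p^{-c}$; 2. almost surely, all processors terminate, and processor $i$ outputs pairwise distinct elements of $N_{i-1}+1..N_i$;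 3. the union of the outputs of the processors is a uniformly random sample without replacement, i.e. each $n$-element subset of $1..N$ is obtained with probability $1/\binom Nn$. -/

import Mathlib

open MeasureTheory
open scoped ENNReal unitInterval

namespace Sampling

noncomputable section

/-! ## Timed computations

Real-RAM model of random variate generation: arithmetic on integers and reals, comparisons,
rounding, `exp`, `log`, powers, the logarithm of the factorial, a memory access, an output
operation and the access to one uniform deviate of `[0,1]` cost one step each. -/

/-- The result of a computation and its number of steps. `time = ⊤` means that the computation
does not terminate; then `val` has no meaning. -/
structure Run (α : Type) where
  val : α
  time : ℕ∞

instance : Monad Run where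
  pure a := ⟨a, 0⟩
  bind x f := ⟨(f x.val).val, x.time + (f x.val).time⟩

/-- A block of `k` elementary operations with result `a`. -/
def ops {α : Type} (k : ℕ) (a : α) : Run α := ⟨a, k⟩

/-- The rejection method: trials `0, 1, 2, …` are made until one of them accepts. -/
def retry {α : Type} [Inhabited α] (trial : ℕ → Run (Option α)) : Run α :=
  open Classical in
  if h : ∃ t, (trial t).val.isSome = true then
    ⟨(trial (Nat.find h)).val.get (Nat.find_spec h),
      ∑ t ∈ Finset.range (Nat.find h + 1), (trial t).time⟩
  else ⟨default, ⊤⟩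

/-- `ln (k!)`. -/
def lnFact (k : ℕ) : Run ℝ := ops 1 (Real.log (k.factorial : ℝ))

/-- `ln (a choose b)`, for `b ≤ a`. -/
def lnChoose (a b : ℕ) : Run ℝ := do
  let x ← lnFact a
  let y ← lnFact b
  let z ← lnFact (a - b)
  ops 3 (x - y - z)

/-! ## Hypergeometric deviates -/

/-- Probability that a sample of `n` out of `N` elements without replacement contains exactly `x`
of `l` distinguished elements. -/
def hyperPMF (n l N x : ℕ) : ℝ :=
  (l.choose x : ℝ) * ((N - l).choose (n - x) : ℝ) / (N.choose n : ℝ) * (if x ≤ n then 1 else 0)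

/-- A generator of the rejection type: one trial reads `d` uniform deviates and either rejects
(`none`) or returns a number. The arguments of `trial` are the number `n` of experiments, the
number `l` of success states, the size `N` of the universe, and the deviates. -/
structure Generator where
  d : ℕ
  trial : ℕ → ℕ → ℕ → (Fin d → I) → Run (Option ℕ)

/-- Independent trials, on consecutive blocks of `d` deviates, until the first success. -/
def Generator.run (G : Generator) (n l N : ℕ) (stream : ℕ → I) : Run ℕ :=
  retry fun t => G.trial n l N fun r => stream (G.d * t + r)

/-- `G` generates hypergeometric deviates by the rejection method: a trial takes a constant number
of steps, it succeeds with at least a constant probability, and a number returned by a successful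
trial is hypergeometrically distributed. -/
def Generator.IsHypergeometric (G : Generator) : Prop :=
  ∃ a : ℕ, ∃ q : ℝ, 0 < q ∧ ∀ n l N : ℕ, n ≤ N → l ≤ N →
    (∀ u, (G.trial n l N u).time ≤ a) ∧
    (∀ x, MeasurableSet {u | (G.trial n l N u).val = some x}) ∧
    q ≤ volume.real {u | (G.trial n l N u).val.isSome = true} ∧
    ∀ x, volume.real {u | (G.trial n l N u).val = some x} =
      hyperPMF n l N x * volume.real {u | (G.trial n l N u).val.isSome = true}

/-- Logarithm of the hypergeometric probability of a point `x` of the support. -/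
def lnHyper (n l N x : ℕ) : Run ℝ := do
  let a ← lnChoose l x
  let b ← lnChoose (N - l) (n - x)
  let c ← lnChoose N n
  ops 4 (a + b - c)

/-- One trial of Devroye's rejection method for discrete log-concave distributions, applied to the
hypergeometric distribution. With `m` the mode, `p` its probability and `w = 1 + p/2`, the trial
draws `y ≥ 0` with density proportional to `min 1 (exp (w - p y))`, rounds it, and gives it a
random sign. -/
def devroyeTrial (n l N : ℕ) (u : Fin 4 → I) : Run (Option ℕ) := do
  let m ← ops 6 ((n + 1) * (l + 1) / (N + 2))
  let lp ← lnHyper n l N m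
  let p ← ops 1 (Real.exp lp)
  let w ← ops 2 (1 + p / 2)
  let y ← ops 8 (if (u 0 : ℝ) ≤ w / (1 + w) then (u 1 : ℝ) * w / p
    else (w - Real.log (u 1 : ℝ)) / p)
  let k ← ops 2 ⌊y + 1 / 2⌋
  let x : ℤ ← ops 3 (if (u 2 : ℝ) < 1 / 2 then (m : ℤ) - k else (m : ℤ) + k)
  let inside ← ops 8 (decide (max 0 ((n : ℤ) + l - N) ≤ x ∧ x ≤ min (n : ℤ) l))
  if inside then do
    let lf ← lnHyper n l N x.toNat
    let accept ← ops 9 (decide ((u 3 : ℝ) * min 1 (Real.exp (w - p * y)) < Real.exp (lf - lp)))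
    ops 1 (if accept then some x.toNat else none)
  else ops 1 none

/-- Devroye's generator for the hypergeometric distribution. -/
def devroye : Generator := ⟨4, devroyeTrial⟩

/-! ## Sequential sampling algorithms

Each of them samples `m` of the `M` elements `off + 1, …, off + M` and lists the sample. -/

/-- A local source of uniform deviates: a stream, and independent subsources. -/
abbrev Source := List ℕ → I

/-- The stream of deviates of a source. -/
def Source.stream (s : Source) (t : ℕ) : I := s [t]

/-- The subsource with index `a`. -/
def Source.sub (s : Source) (a : ℕ) : Source := fun path => s (a :: path)

/-- The cell of the key `x` of `1..M` in a hash table with the given number of cells (the most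
significant digits of the key). -/
def cell (cells M x : ℕ) : ℕ := (x - 1) * cells / M

/-- Membership of `x` in the hash table that holds the keys `T` (collisions are resolved by
chaining): all the keys in the cell of `x` are inspected. -/
def lookup (cells M : ℕ) (T : List ℕ) (x : ℕ) : Run Bool :=
  ops (3 + 2 * (T.filter fun y => cell cells M y = cell cells M x).length) (decide (x ∈ T))

/-- One attempt of Algorithm H: a uniform deviate from `1..M`, rejected if it is in the table. -/
def hashTrial (cells M : ℕ) (T : List ℕ) (u : I) : Run (Option ℕ) := do
  let x ← ops 5 (min M (⌊(M : ℝ) * (u : ℝ)⌋₊ + 1))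
  let found ← lookup cells M T x
  ops 1 (if found then none else some x)

/-- Algorithm H: insert `m` further keys of `1..M` into the table `T`. -/
def hashInsert (cells M : ℕ) : ℕ → List ℕ → Source → Run (List ℕ)
  | 0, T, _ => ops 1 T
  | m + 1, T, s => do
    let x ← retry fun t => hashTrial cells M T (s.stream t)
    let T' ← ops 4 (x :: T)
    hashInsert cells M m T' (s.sub 1)

/-- The keys of `1..k` that are not in the table `T`, by scanning. -/
def hashComplement (cells M : ℕ) (T : List ℕ) : ℕ → Run (List ℕ)
  | 0 => ops 1 []
  | k + 1 => do
    let found ← lookup cells M T (k + 1)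
    let rest ← hashComplement cells M T k
    ops 3 (if found then rest else (k + 1) :: rest)

/-- Algorithm H; if more than half of the elements are wanted, it generates the elements that are
not in the sample. -/
def algH (cells m M off : ℕ) (s : Source) : Run (List ℕ) := do
  let T ← (if 2 * m ≤ M then hashInsert cells M m [] s
    else do
      let T ← hashInsert cells M (M - m) [] s
      hashComplement cells M T M)
  ops (4 + 2 * T.length) (T.map fun x => off + x)

/-- The inner loop of Vitter's Method A: the number of elements to skip before the next sample
element, by sequential search; `top` is the number of remaining elements outside the sample, `M`
the number of remaining elements. -/
def skipScan (v : ℝ) : (top : ℕ) → (M : ℕ) → (quot : ℝ) → Run ℕ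
  | 0, _, _ => ops 1 0
  | top + 1, M, quot =>
    if v < quot then do
      let s ← skipScan v top (M - 1) (quot * top / ((M - 1 : ℕ) : ℝ))
      ops 7 (s + 1)
    else ops 1 0

/-- Vitter's Method A. -/
def methodA : (m : ℕ) → (M off : ℕ) → Source → Run (List ℕ)
  | 0, _, _, _ => ops 1 []
  | m + 1, M, off, s => do
    let quot ← ops 3 (((M - (m + 1) : ℕ) : ℝ) / (M : ℝ))
    let k ← skipScan (s.stream 0 : ℝ) (M - (m + 1)) M quot
    let rest ← methodA m (M - (k + 1)) (off + (k + 1)) (s.sub 1)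
    ops 8 ((off + (k + 1)) :: rest)

/-- One trial of the rejection method of Vitter's Algorithm D for the number of elements to skip
before the next sample element, when `m` of `M` elements are still to be sampled: proposal density
`g x = m/M (1 - x/M)^(m-1)` on `[0, M]`, majorant `M/(M-m+1) * g`, quick acceptance through the
minorant `m/M (1 - k/(M-m+1))^(m-1)`. -/
def skipTrial (m M : ℕ) (u v : I) : Run (Option ℕ) := do
  let x ← ops 6 ((M : ℝ) * (1 - (v : ℝ) ^ (1 / (m : ℝ))))
  let k ← ops 1 ⌊x⌋₊
  if M - m < k then ops 2 none
  else do
    let hat ← ops 9 ((m : ℝ) / ((M - m + 1 : ℕ) : ℝ) * (1 - x / M) ^ (m - 1))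
    let low ← ops 8 ((m : ℝ) / M * (1 - (k : ℝ) / ((M - m + 1 : ℕ) : ℝ)) ^ (m - 1))
    let quick ← ops 3 (decide ((u : ℝ) * hat ≤ low))
    if quick then ops 1 (some k)
    else do
      let a ← lnChoose (M - k - 1) (m - 1)
      let b ← lnChoose M m
      ops 9 (if (u : ℝ) * hat ≤ Real.exp (a - b) then some k else none)

/-- Vitter's Algorithm D, which changes to Method A as soon as at least the fraction `1/r` of the
remaining elements is to be sampled. -/
def algD (r : ℕ) : (m : ℕ) → (M off : ℕ) → Source → Run (List ℕ)
  | 0, _, _, _ => ops 1 []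
  | m + 1, M, off, s =>
    if M ≤ r * (m + 1) then do
      let T ← methodA (m + 1) M off s
      ops 3 T
    else do
      let k ← retry fun t => skipTrial (m + 1) M (s.stream (2 * t)) (s.stream (2 * t + 1))
      let rest ← algD r m (M - (k + 1)) (off + (k + 1)) (s.sub 1)
      ops 10 ((off + (k + 1)) :: rest)

/-- Algorithm R (sequential divide and conquer) with threshold `n₀` and the given algorithm for the
base case. For `2 ≤ n₀` and `m ≤ M` the test `M < 2` is redundant. -/
def algR (G : Generator) (n₀ : ℕ) (base : ℕ → ℕ → ℕ → Source → Run (List ℕ))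
    (m M off : ℕ) (s : Source) : Run (List ℕ) :=
  if _h : m < n₀ ∨ M < 2 then do
    let T ← base m M off s
    ops 2 T
  else do
    let x ← G.run m (M / 2) M s.stream
    let A ← algR G n₀ base x (M / 2) off (s.sub 1)
    let B ← algR G n₀ base (m - x) (M - M / 2) (off + M / 2) (s.sub 2)
    ops 8 (A ++ B)
termination_by M
decreasing_by all_goals omega

/-- The choices of the local sampling algorithm:
`H`, with one table cell for each element of the universe; `D r`, with density threshold `1/r`;
`RH n₀ cells` and `RD n₀ r`: Algorithm R with threshold `n₀` and base case H (a table with the given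
number of cells) or D. -/
inductive LocalSampler where
  | H
  | D (r : ℕ)
  | RH (n₀ cells : ℕ)
  | RD (n₀ r : ℕ)

/-- The local sampling algorithm; `G` is the generator used by Algorithm R. -/
def LocalSampler.run (G : Generator) : LocalSampler → ℕ → ℕ → ℕ → Source → Run (List ℕ)
  | .H => fun m M => algH M m M
  | .D r => algD r
  | .RH n₀ cells => algR G n₀ (algH cells)
  | .RD n₀ r => algR G n₀ (algD r)

/-- Proper values of the tuning parameters. -/
def LocalSampler.Proper : LocalSampler → Prop
  | .H => True
  | .D r => 2 ≤ r
  | .RH n₀ _ => 2 ≤ n₀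
  | .RD n₀ r => 2 ≤ n₀ ∧ 2 ≤ r

/-! ## Algorithm P -/

/-- The arguments of the hash function: `node j k t` yields the `t`-th deviate for the subproblem
of the processors `j..k`, and the values at `seed i path` form the local source of processor `i`. -/
inductive Key where
  | node (j k t : ℕ)
  | seed (i : ℕ) (path : List ℕ)

/-- An ideal hash function: its values are independent and uniformly distributed on `[0,1]`. -/
def hashLaw : Measure (Key → I) := Measure.infinitePi fun _ => volume

/-- Algorithm P on processor `i`, with hash function `h`: it takes part in sampling `n` elements on
the processors `j..k`, where processor `i` is responsible for the elements `B (i-1) + 1, …, B i`.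
The list returned is the part of the sample that processor `i` generates. -/
def sampleP (G : Generator) (L : LocalSampler) (B : ℕ → ℕ) (i : ℕ) (h : Key → I)
    (n j k : ℕ) : Run (List ℕ) :=
  if _hjk : j < k then do
    let x ← G.run n (B ((j + k) / 2) - B (j - 1)) (B k - B (j - 1)) fun t => h (.node j k t)
    let _ ← ops 12 ()
    if i ≤ (j + k) / 2 then sampleP G L B i h x j ((j + k) / 2)
    else sampleP G L B i h (n - x) ((j + k) / 2 + 1) k
  else do
    let _ ← ops 5 ()
    L.run G n (B i - B (i - 1)) (B (i - 1)) fun path => h (.seed i path)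
termination_by k - j
decreasing_by all_goals omega

/-- What processor `i` of `p` processors does to sample `n` elements. -/
def processor (G : Generator) (L : LocalSampler) (B : ℕ → ℕ) (n p : ℕ) (h : Key → I) (i : ℕ) :
    Run (List ℕ) :=
  sampleP G L B i h n 1 p

/-- The running time of Algorithm P on `p` processors: the time of the slowest processor. -/
def parallelTime (G : Generator) (L : LocalSampler) (B : ℕ → ℕ) (n p : ℕ) (h : Key → I) : ℕ∞ :=
  (Finset.Icc 1 p).sup fun i => (processor G L B n p h i).time

/-- The sample that the `p` processors generate together. -/
def sample (G : Generator) (L : LocalSampler) (B : ℕ → ℕ) (n p : ℕ) (h : Key → I) : Finset ℕ :=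
  (Finset.Icc 1 p).biUnion fun i => (processor G L B n p h i).val.toFinset

end

end Sampling

/-! Uniformity and running time both rest on one principle: computations that read disjoint sets of
hash keys are independent (`keyAlgebra_indep`). Each algorithm draws a random number from its own
keys and hands fresh keys to the recursive calls, so both claims follow by recursion.

Uniformity. `Samples` gives every `m`-element set the probability `1 / (M choose m)`. Two
decompositions preserve it because binomial coefficients cancel: the gap before the first element
(`Samples.cons`; Method A and Algorithm D) and the hypergeometric split of the range
(`Samples.append`; Algorithm R and the processor tree). Processors that work on the same interval
`j..k` read the same keys `node j k t`; hence they agree on the split, and the concatenation of all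
outputs obeys the second recursion (`treeList_split`, `treeList_samples`).

Running time. For a fixed `w` slightly above 1, `Cost` bounds the mean of `w ^ time`. Such weights
multiply under sequential composition (`Cost.bind`). The number of trials of a rejection method is
geometric and independent of the number returned, so its weight is finite and tends to 1 as `w` does
(`retry_jointCost`, `tendsto_retryFactor`). Thus `w` can be chosen so that one level of the
processor tree costs a factor of at most 2, and a local sample of `m` elements costs at most `4 ^ (m
+ 1)`, whatever the size of its universe (`LocalSampler.eventually_cost`). For Algorithm R the
latter needs a potential function, since a split that puts everything on one side makes no progress;
its probability is at most 1/2.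

What remains random is the number of elements that reach processor `i`. A hypergeometric variable
satisfies `E (1 + y)^X ≤ (1 + y l/N)^n` (`hyperLaw_moment`). The leaf weight is `4 (1 + 3)^m`; going
up the tree, the 3 is multiplied by ratios of universe sizes, which telescope to `3 (B i - B (i-1))
/ N ≤ 3 D/p`, with `D = max C 0`. At the root the mean of `w ^ time` is at most `16 p exp (3 D
n/p)`; Markov's inequality and a union bound over the processors give the tail. Almost sure
termination follows from the same finite mean, because `w ^ ⊤ = ⊤`. `Cost` works with a measurable
majorant of the weight, since the running time of a trial is not assumed to be measurable.

Devroye's generator. If `p` is the probability of the mode, log-concavity bounds the probability of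
a point at distance `k` by `p min(1, exp (1 - p k))` (`logConcave_le`). With `w = 1 + p/2` the
continuous majorant `p min(1, exp (w - p y))` stays above this bound on all of `[k - 1/2, k + 1/2)`.
Hence each point is returned with probability exactly proportional to its own, and a trial succeeds
with probability `1/(4 + p) ≥ 1/5`. -/

namespace Sampling

/-! ## Independence of disjoint sets of keys -/

/-- The events that depend only on the hash values at the keys in `S`. -/
@[reducible] def keyAlgebra (S : Set Key) : MeasurableSpace (Key → I) :=
  ⨆ k ∈ S, MeasurableSpace.comap (fun h : Key → I => h k) inferInstance

instance : IsProbabilityMeasure hashLaw := by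
  unfold hashLaw; infer_instance

lemma keyAlgebra_le (S : Set Key) : keyAlgebra S ≤ MeasurableSpace.pi :=
  iSup₂_le fun k _ => (measurable_pi_apply k).comap_le

lemma keyAlgebra_mono {S T : Set Key} (h : S ⊆ T) : keyAlgebra S ≤ keyAlgebra T :=
  biSup_mono fun _ hk => h hk

lemma iIndepFun_hashLaw :
    ProbabilityTheory.iIndepFun (fun (k : Key) (h : Key → I) => h k) hashLaw :=
  ProbabilityTheory.iIndepFun_infinitePi (X := fun _ ω => ω) (fun _ => measurable_id)

lemma keyAlgebra_indep {S T : Set Key} (hST : Disjoint S T) :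
    ProbabilityTheory.Indep (keyAlgebra S) (keyAlgebra T) hashLaw :=
  ProbabilityTheory.indep_iSup_of_disjoint (fun k => (measurable_pi_apply k).comap_le)
    iIndepFun_hashLaw hST

lemma measurable_eval {S : Set Key} {k : Key} (hk : k ∈ S) :
    Measurable[keyAlgebra S] (fun h : Key → I => h k) :=
  Measurable.mono (comap_measurable _) (le_iSup₂_of_le k hk le_rfl) le_rfl

lemma measurable_block {S : Set Key} {d : ℕ} {e : Fin d → Key} (he : ∀ r, e r ∈ S) :
    Measurable[keyAlgebra S] (fun (h : Key → I) r => h (e r)) :=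
  @measurable_pi_lambda _ _ _ (keyAlgebra S) _ _ fun r => measurable_eval (he r)

lemma map_block {d : ℕ} {e : Fin d → Key} (he : Function.Injective e) :
    hashLaw.map (fun (h : Key → I) r => h (e r)) = volume := by
  have h1 := (iIndepFun_hashLaw.precomp he)
  rw [ProbabilityTheory.iIndepFun_iff_map_fun_eq_pi_map
    (fun r => (measurable_pi_apply (e r)).aemeasurable)] at h1
  rw [h1, volume_pi]
  congr 1
  funext r
  exact Measure.infinitePi_map_eval _ _

/-! ## Observable quantities -/

/-- Up to a null set, `V` depends only on the hash values at the keys in `S`. -/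
def Observable {β : Type} (S : Set Key) (V : (Key → I) → β) : Prop :=
  ∃ V', Measurable[keyAlgebra S, ⊤] V' ∧ V =ᵐ[hashLaw] V'

section Observable

variable {α β γ : Type} {S T : Set Key}

lemma Observable.mono {V : (Key → I) → β} (hV : Observable S V) (h : S ⊆ T) : Observable T V := by
  obtain ⟨V', h1, h2⟩ := hV
  exact ⟨V', h1.mono (keyAlgebra_mono h) le_rfl, h2⟩

lemma observable_const (b : β) : Observable S fun _ => b :=
  ⟨_, @measurable_const _ _ ⊤ (keyAlgebra S) b, Filter.EventuallyEq.rfl⟩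

lemma Observable.comp {V : (Key → I) → β} (hV : Observable S V) (f : β → γ) :
    Observable S fun h => f (V h) := by
  obtain ⟨V', h1, h2⟩ := hV
  exact ⟨fun h => f (V' h), fun s _ => h1 (t := f ⁻¹' s) (by trivial), h2.fun_comp f⟩

lemma Observable.nullMeasurableSet {V : (Key → I) → β} (hV : Observable S V) (Q : β → Prop) :
    NullMeasurableSet {h | Q (V h)} hashLaw := by
  obtain ⟨V', h1, h2⟩ := hV
  have hm : MeasurableSet {h | Q (V' h)} :=
    keyAlgebra_le S _ (h1 (t := {b | Q b}) (by trivial))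
  refine hm.nullMeasurableSet.congr ?_
  filter_upwards [h2] with h hh
  exact congrArg Q hh.symm

/-- Since `X` has countably many values, the exceptional null set may depend on the value. Values of
probability zero need no hypothesis; this is essential, as a computation is under control only for
parameters that can actually occur. -/
lemma ae_of_countable [Countable α] {X : (Key → I) → α} {Q : α → (Key → I) → Prop}
    (h : ∀ a, hashLaw {h | X h = a} ≠ 0 → ∀ᵐ x ∂hashLaw, Q a x) :
    ∀ᵐ x ∂hashLaw, Q (X x) x := by
  have h1 : ∀ a, ∀ᵐ x ∂hashLaw, X x = a → Q a x := by
    intro a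
    by_cases ha : hashLaw {h | X h = a} = 0
    · have : ∀ᵐ x ∂hashLaw, ¬ X x = a := by
        rw [ae_iff]; simpa using ha
      filter_upwards [this] with x hx hx'
      exact absurd hx' hx
    · filter_upwards [h a ha] with x hx _
      exact hx
  filter_upwards [ae_all_iff.2 h1] with x hx
  exact hx _ rfl

lemma Observable.bind [Countable α] [Nonempty β] {X : (Key → I) → α} {V : α → (Key → I) → β}
    (hX : Observable S X) (hV : ∀ a, hashLaw {h | X h = a} ≠ 0 → Observable S (V a)) :
    Observable S fun h => V (X h) h := by
  obtain ⟨X', hX1, hX2⟩ := hX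
  have key : ∀ a, ∃ V', Measurable[keyAlgebra S, ⊤] V' ∧
      (hashLaw {h | X h = a} ≠ 0 → V a =ᵐ[hashLaw] V') := by
    intro a
    by_cases ha : hashLaw {h | X h = a} = 0
    -- For a value of probability zero nothing is known about `V a`; any constant may replace it.
    · exact ⟨fun _ => Classical.arbitrary β, @measurable_const _ _ ⊤ (keyAlgebra S) _,
        fun h => absurd ha h⟩
    · obtain ⟨V', h1, h2⟩ := hV a ha
      exact ⟨V', h1, fun _ => h2⟩
  choose V' hV1 hV2 using key
  refine ⟨fun h => V' (X' h) h, ?_, ?_⟩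
  · intro s _
    have : (fun h => V' (X' h) h) ⁻¹' s = ⋃ a, X' ⁻¹' {a} ∩ V' a ⁻¹' s := by
      ext h; simp
    rw [this]
    exact @MeasurableSet.iUnion _ _ (keyAlgebra S) _ _ fun a =>
      @MeasurableSet.inter _ (keyAlgebra S) _ _ (hX1 (by trivial)) (hV1 a (by trivial))
  · have h3 := ae_of_countable (X := X) (Q := fun a x => V a x = V' a x) hV2
    filter_upwards [h3, hX2] with x h4 h5
    rw [h4, h5]

lemma Observable.indep {X : (Key → I) → α} {V : (Key → I) → β} (hST : Disjoint S T)
    (hX : Observable S X) (hV : Observable T V) (Q : α → Prop) (R : β → Prop) :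
    hashLaw {h | Q (X h) ∧ R (V h)} = hashLaw {h | Q (X h)} * hashLaw {h | R (V h)} := by
  obtain ⟨X', hX1, hX2⟩ := hX
  obtain ⟨V', hV1, hV2⟩ := hV
  have e1 : hashLaw {h | Q (X h)} = hashLaw {h | Q (X' h)} := measure_congr (by
    filter_upwards [hX2] with x hx; exact congrArg Q hx)
  have e2 : hashLaw {h | R (V h)} = hashLaw {h | R (V' h)} := measure_congr (by
    filter_upwards [hV2] with x hx; exact congrArg R hx)
  have e3 : hashLaw {h | Q (X h) ∧ R (V h)} = hashLaw ({h | Q (X' h)} ∩ {h | R (V' h)}) :=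
    measure_congr (by
      filter_upwards [hX2, hV2] with x hx hy; exact congrArg₂ And (congrArg Q hx) (congrArg R hy))
  rw [e1, e2, e3]
  exact (ProbabilityTheory.Indep_iff _ _ _).1 (keyAlgebra_indep hST) _ _
    (hX1 (t := {a | Q a}) (by trivial)) (hV1 (t := {b | R b}) (by trivial))

/-- The law of total probability over the values of `X`; each term factors because `V a` reads other
keys than `X`. -/
lemma law_bind [Countable α] {X : (Key → I) → α} {V : α → (Key → I) → β} (hST : Disjoint S T)
    (hX : Observable S X) (hV : ∀ a, hashLaw {h | X h = a} ≠ 0 → Observable T (V a))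
    (Q : β → Prop) :
    hashLaw {h | Q (V (X h) h)} =
      ∑' a, hashLaw {h | X h = a} * hashLaw {h | Q (V a h)} := by
  have e : {h | Q (V (X h) h)} = ⋃ a, {h | X h = a ∧ Q (V a h)} := by
    ext h; simp
  rw [e, measure_iUnion₀]
  · refine tsum_congr fun a => ?_
    by_cases ha : hashLaw {h | X h = a} = 0
    · rw [ha, zero_mul]
      exact measure_mono_null (fun h hh => hh.1) ha
    · exact Observable.indep hST hX (hV a ha) (· = a) Q
  · intro a b hab
    refine Disjoint.aedisjoint ?_
    rw [Set.disjoint_left]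
    rintro h ⟨h1, _⟩ ⟨h2, _⟩
    exact hab (h1.symm.trans h2)
  · intro a
    by_cases ha : hashLaw {h | X h = a} = 0
    · exact NullMeasurableSet.of_null (measure_mono_null (fun h hh => hh.1) ha)
    · exact (hX.nullMeasurableSet (· = a)).inter ((hV a ha).nullMeasurableSet Q)

lemma Observable.tsum [Countable α] {X : (Key → I) → α} (hX : Observable S X) (Q : α → Prop)
    [DecidablePred Q] :
    hashLaw {h | Q (X h)} = ∑' a, hashLaw {h | X h = a} * if Q a then 1 else 0 := by
  have := law_bind (V := fun a _ => a) (T := ∅) (Set.disjoint_empty S) hX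
    (fun a _ => observable_const a) Q
  rw [this]
  refine tsum_congr fun a => ?_
  by_cases h : Q a <;> simp [h]

lemma Observable.tsum_law [Countable α] {X : (Key → I) → α} (hX : Observable S X) :
    ∑' a, hashLaw {h | X h = a} = 1 := by
  have := hX.tsum (fun _ => True)
  simpa using this.symm

end Observable

/-! ## Exponential weights of running times -/

/-- `w ^ t`, where `w ^ ⊤ = ⊤`. -/
noncomputable def weight (w : ℝ≥0∞) : ℕ∞ → ℝ≥0∞
  | ⊤ => ⊤
  | (n : ℕ) => w ^ n

@[simp] lemma weight_coe (w : ℝ≥0∞) (n : ℕ) : weight w n = w ^ n := rfl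

@[simp] lemma weight_top (w : ℝ≥0∞) : weight w ⊤ = ⊤ := rfl

/-- `1 ≤ w` keeps the powers of `w` away from zero, so that an infinite summand on the left is not
cancelled on the right. -/
lemma weight_add {w : ℝ≥0∞} (hw : 1 ≤ w) (s t : ℕ∞) : weight w (s + t) = weight w s * weight w t := by
  have hpos : ∀ n : ℕ, w ^ n ≠ 0 := fun n => (lt_of_lt_of_le one_pos (one_le_pow₀ hw)).ne'
  induction s using ENat.recTopCoe with
  | top =>
    induction t using ENat.recTopCoe with
    | top => simp
    | coe t => simp [ENNReal.top_mul (hpos t)]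
  | coe s =>
    induction t using ENat.recTopCoe with
    | top => simp [ENNReal.mul_top (hpos s)]
    | coe t => rw [← Nat.cast_add]; simp only [weight_coe, pow_add]

lemma weight_mono {w : ℝ≥0∞} (hw : 1 ≤ w) {s t : ℕ∞} (h : s ≤ t) : weight w s ≤ weight w t := by
  obtain ⟨r, rfl⟩ := exists_add_of_le h
  rw [weight_add hw]
  refine le_mul_of_one_le_right' ?_
  induction r using ENat.recTopCoe with
  | top => simp
  | coe r => simpa using one_le_pow₀ hw

/-- `E` bounds the expectation of `w ^ time` for the computation `R`, which reads the keys
in `S`. -/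
def Cost {α : Type} (w : ℝ≥0∞) (S : Set Key) (R : (Key → I) → Run α) (E : ℝ≥0∞) : Prop :=
  ∃ τ, Measurable[keyAlgebra S] τ ∧ (∀ᵐ h ∂hashLaw, weight w (R h).time ≤ τ h) ∧
    ∫⁻ h, τ h ∂hashLaw ≤ E

/-- On each event `X = x`, the factor `g x` bounds the mean of `w ^ time` for the
computation `X`. -/
def JointCost {α : Type} (w : ℝ≥0∞) (S : Set Key) (X : (Key → I) → Run α) (g : ℝ≥0∞) :
    Prop :=
  ∃ τ, Measurable[keyAlgebra S] τ ∧ (∀ᵐ h ∂hashLaw, weight w (X h).time ≤ τ h) ∧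
    ∀ x, ∫⁻ h in {h | (X h).val = x}, τ h ∂hashLaw ≤ hashLaw {h | (X h).val = x} * g

section Cost

variable {α β : Type} {w : ℝ≥0∞} {S T : Set Key}

lemma Cost.mono {R : (Key → I) → Run α} {E E' : ℝ≥0∞} (h : Cost w S R E) (hST : S ⊆ T)
    (hE : E ≤ E') : Cost w T R E' := by
  obtain ⟨τ, h1, h2, h3⟩ := h
  exact ⟨τ, h1.mono (keyAlgebra_mono hST) le_rfl, h2, h3.trans hE⟩

lemma cost_of_time_le (hw : 1 ≤ w) {R : (Key → I) → Run α} {c : ℕ}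
    (h : ∀ᵐ x ∂hashLaw, (R x).time ≤ c) : Cost w S R (w ^ c) := by
  refine ⟨fun _ => w ^ c, @measurable_const _ _ _ (keyAlgebra S) _, ?_, by simp⟩
  filter_upwards [h] with x hx
  simpa using weight_mono hw hx

lemma Cost.time_add (hw : 1 ≤ w) {R : (Key → I) → Run α} {R' : (Key → I) → Run β} {E : ℝ≥0∞}
    (hR : Cost w S R E) {c : ℕ} (h : ∀ᵐ x ∂hashLaw, (R' x).time ≤ (R x).time + c) :
    Cost w S R' (E * w ^ c) := by
  obtain ⟨τ, h1, h2, h3⟩ := hR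
  refine ⟨fun h => τ h * w ^ c, @Measurable.mul_const _ _ _ _ (keyAlgebra S) _ _ h1 _, ?_, ?_⟩
  · filter_upwards [h, h2] with x hx hx2
    refine (weight_mono hw hx).trans ?_
    rw [weight_add hw, weight_coe]
    gcongr
  · rw [lintegral_mul_const _ (h1.mono (keyAlgebra_le S) le_rfl)]
    gcongr

lemma Cost.ae_time_lt_top {R : (Key → I) → Run α} {E : ℝ≥0∞} (hR : Cost w S R E) (hE : E ≠ ⊤) :
    ∀ᵐ h ∂hashLaw, (R h).time < ⊤ := by
  obtain ⟨τ, h1, h2, h3⟩ := hR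
  have := ae_lt_top (h1.mono (keyAlgebra_le S) le_rfl) (ne_top_of_le_ne_top hE h3)
  filter_upwards [h2, this] with x hx hx2
  rw [lt_top_iff_ne_top]
  intro h
  rw [h] at hx
  exact absurd (hx.trans_lt hx2) (by simp)

lemma Cost.add (hw : 1 ≤ w) (hST : Disjoint S T) {R : (Key → I) → Run α} {R' : (Key → I) → Run β}
    {E E' : ℝ≥0∞} (hR : Cost w S R E) (hR' : Cost w T R' E') :
    Cost w (S ∪ T) (fun h => (⟨(), (R h).time + (R' h).time⟩ : Run Unit)) (E * E') := by
  obtain ⟨τ, h1, h2, h3⟩ := hR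
  obtain ⟨τ', h1', h2', h3'⟩ := hR'
  refine ⟨fun h => τ h * τ' h, @Measurable.mul _ _ _ _ (keyAlgebra (S ∪ T)) τ τ' _
    (h1.mono (keyAlgebra_mono Set.subset_union_left) le_rfl)
    (h1'.mono (keyAlgebra_mono Set.subset_union_right) le_rfl), ?_, ?_⟩
  · filter_upwards [h2, h2'] with x hx hx'
    rw [weight_add hw]
    gcongr
  · rw [ProbabilityTheory.lintegral_mul_eq_lintegral_mul_lintegral_of_independent_measurableSpace
      (keyAlgebra_le S) (keyAlgebra_le T) (keyAlgebra_indep hST) h1 h1']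
    gcongr

/-- On the event `X = a` the weight is the product of the weights of `X` and of `R a`, and their
majorants are independent. Since `E a` depends on `a`, a bound on the overall mean for `X` would not
suffice; the bound is needed on each event `X = a`, which is what `JointCost` provides. -/
lemma Cost.bind [Countable α] (hw : 1 ≤ w) (hST : Disjoint S T) {X : (Key → I) → Run α}
    {R : α → (Key → I) → Run β} {g : ℝ≥0∞} {E : α → ℝ≥0∞}
    (hobs : Observable S fun h => (X h).val) (hX : JointCost w S X g)
    (hR : ∀ a, hashLaw {h | (X h).val = a} ≠ 0 → Cost w T (R a) (E a)) :
    Cost w (S ∪ T) (fun h => X h >>= fun a => R a h)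
      (g * ∑' a, hashLaw {h | (X h).val = a} * E a) := by
  obtain ⟨X', hX1, hX2⟩ := hobs
  obtain ⟨τ, h1, h2, h3⟩ := hX
  have key : ∀ a, ∃ ρ : (Key → I) → ℝ≥0∞, Measurable[keyAlgebra T] ρ ∧
      (hashLaw {h | (X h).val = a} ≠ 0 → (∀ᵐ h ∂hashLaw, weight w (R a h).time ≤ ρ h) ∧
        ∫⁻ h, ρ h ∂hashLaw ≤ E a) := by
    intro a
    by_cases ha : hashLaw {h | (X h).val = a} = 0
    · exact ⟨fun _ => 0, @measurable_const _ _ _ (keyAlgebra T) _, fun h => absurd ha h⟩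
    · obtain ⟨ρ, hρ1, hρ2⟩ := hR a ha
      exact ⟨ρ, hρ1, fun _ => hρ2⟩
  choose ρ hρ1 hρ2 using key
  have hS : keyAlgebra S ≤ keyAlgebra (S ∪ T) := keyAlgebra_mono Set.subset_union_left
  have hT : keyAlgebra T ≤ keyAlgebra (S ∪ T) := keyAlgebra_mono Set.subset_union_right
  have hind : ∀ a, Measurable[keyAlgebra S] ((X' ⁻¹' {a}).indicator τ) := fun a =>
    @Measurable.indicator _ _ (X' ⁻¹' {a}) τ (keyAlgebra S) _ _ h1 (hX1 (t := {a}) (by trivial))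
  refine ⟨fun h => ∑' a, (X' ⁻¹' {a}).indicator τ h * ρ a h, ?_, ?_, ?_⟩
  · refine @Measurable.tsum _ _ _ (keyAlgebra (S ∪ T)) _ _ _ _ _ _ _ _ _ _ _ _ fun a => ?_
    exact @Measurable.mul _ _ _ _ (keyAlgebra (S ∪ T)) _ _ _ ((hind a).mono hS le_rfl)
      ((hρ1 a).mono hT le_rfl)
  · have h4 := ae_of_countable (X := fun h => (X h).val)
      (Q := fun a x => weight w (R a x).time ≤ ρ a x) fun a ha => (hρ2 a ha).1
    filter_upwards [h2, hX2, h4] with x hx1 hx2 hx3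
    change weight w ((X x).time + (R (X x).val x).time) ≤ _
    rw [weight_add hw]
    refine le_trans ?_ (ENNReal.le_tsum (X x).val)
    rw [Set.indicator_of_mem (by simp [hx2])]
    gcongr
  · have hm : ∀ a, AEMeasurable (fun h => (X' ⁻¹' {a}).indicator τ h * ρ a h) hashLaw := fun a =>
      (((hind a).mono (keyAlgebra_le S) le_rfl).mul
        ((hρ1 a).mono (keyAlgebra_le T) le_rfl)).aemeasurable
    rw [lintegral_tsum hm, ← ENNReal.tsum_mul_left]
    refine ENNReal.tsum_le_tsum fun a => ?_
    rw [ProbabilityTheory.lintegral_mul_eq_lintegral_mul_lintegral_of_independent_measurableSpace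
      (keyAlgebra_le S) (keyAlgebra_le T) (keyAlgebra_indep hST) (hind a) (hρ1 a),
      lintegral_indicator (keyAlgebra_le S _ (hX1 (t := {a}) (by trivial)))]
    have e : hashLaw.restrict (X' ⁻¹' {a}) = hashLaw.restrict {h | (X h).val = a} := by
      refine Measure.restrict_congr_set ?_
      filter_upwards [hX2] with x hx
      exact congrArg (· = a) hx.symm
    rw [e]
    by_cases ha : hashLaw {h | (X h).val = a} = 0
    · rw [Measure.restrict_eq_zero.2 ha]
      simp
    · calc _ ≤ hashLaw {h | (X h).val = a} * g * E a := by
            gcongr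
            · exact h3 a
            · exact (hρ2 a ha).2
        _ = _ := by ring

end Cost

/-! ## The rejection method -/

lemma retry_eq {α : Type} [Inhabited α] {trial : ℕ → Run (Option α)} {t : ℕ} {x : α}
    (hfail : ∀ u < t, (trial u).val = none) (ht : (trial t).val = some x) :
    retry trial = ⟨x, ∑ u ∈ Finset.range (t + 1), (trial u).time⟩ := by
  classical
  have hex : ∃ t, (trial t).val.isSome = true := ⟨t, by simp [ht]⟩
  have hfind : Nat.find hex = t := by
    rw [Nat.find_eq_iff]
    exact ⟨by simp [ht], fun u hu => by simp [hfail u hu]⟩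
  unfold retry
  rw [dif_pos hex]
  subst hfind
  congr 1
  exact Option.get_of_eq_some _ ht

/-- A trial of the rejection method takes at most `a` steps, succeeds with probability `s`, and a
returned number has the distribution `P`. -/
structure TrialLaw {d : ℕ} (trial : (Fin d → I) → Run (Option ℕ)) (P : ℕ → ℝ≥0∞) (a : ℕ)
    (s : ℝ≥0∞) : Prop where
  time_le : ∀ u, (trial u).time ≤ a
  meas : ∀ x, MeasurableSet {u | (trial u).val = some x}
  law : ∀ x, volume {u | (trial u).val = some x} = P x * s
  accept : volume {u | (trial u).val.isSome = true} = s

lemma TrialLaw.measurable {d : ℕ} {trial : (Fin d → I) → Run (Option ℕ)} {P : ℕ → ℝ≥0∞} {a : ℕ}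
    {s : ℝ≥0∞} (H : TrialLaw trial P a s) : Measurable[_, ⊤] fun u => (trial u).val := by
  intro A _
  have hsome : MeasurableSet {u | (trial u).val.isSome = true} := by
    have : {u | (trial u).val.isSome = true} = ⋃ x, {u | (trial u).val = some x} := by
      ext u; simp [Option.isSome_iff_exists]
    rw [this]; exact MeasurableSet.iUnion H.meas
  have : (fun u => (trial u).val) ⁻¹' A = ⋃ o ∈ A, {u | (trial u).val = o} := by ext u; simp
  rw [this]
  refine MeasurableSet.biUnion (Set.to_countable A) fun o _ => ?_
  cases o with
  | none =>
    convert hsome.compl using 1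
    ext u; simp
  | some x => exact H.meas x

/-- Bound for the mean of `W ^ T`, where `T` is the number of independent trials until the first
success, and a trial succeeds with probability at least `q`. -/
noncomputable def retryFactor (q W : ℝ≥0∞) : ℝ≥0∞ := 1 + (W - 1) * (1 - (1 - q) * W)⁻¹

/-- The geometric series sums to `W s / (1 - (1 - s) W) = 1 + (W - 1) / (1 - (1 - s) W)`. The second
form visibly decreases in `s`, so `s` may be replaced by the lower bound `q`. -/
lemma tsum_le_retryFactor {q s W : ℝ≥0∞} (hq : q ≤ s) (hs : s ≤ 1) (hW : 1 ≤ W)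
    (h : (1 - q) * W < 1) :
    ∑' t : ℕ, W ^ (t + 1) * ((1 - s) ^ t * s) ≤ retryFactor q W := by
  have hr : (1 - s) * W < 1 := lt_of_le_of_lt (by gcongr) h
  have e : ∑' t : ℕ, W ^ (t + 1) * ((1 - s) ^ t * s) = W * s * (1 - (1 - s) * W)⁻¹ := by
    rw [← ENNReal.tsum_geometric, ← ENNReal.tsum_mul_left]
    refine tsum_congr fun t => ?_
    rw [mul_pow, pow_succ]; ring
  have hWs : W * s = (1 - (1 - s) * W) + (W - 1) := by
    have h1 : (1 - s) * W ≠ ⊤ := (hr.trans ENNReal.one_lt_top).ne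
    have h2 : W * s + (1 - s) * W = W := by
      rw [mul_comm W s, ← add_mul, add_tsub_cancel_of_le hs, one_mul]
    refine (ENNReal.add_left_inj h1).1 ?_
    rw [h2, add_right_comm, tsub_add_cancel_of_le hr.le, add_tsub_cancel_of_le hW]
  rw [e, hWs, add_mul, ENNReal.mul_inv_cancel (tsub_pos_of_lt hr).ne'
    (ne_top_of_le_ne_top ENNReal.one_ne_top tsub_le_self)]
  unfold retryFactor
  gcongr

/-- The denominator tends to `q > 0` and the numerator to 0: the overhead of rejection becomes
negligible for `w` near 1. -/
lemma tendsto_retryFactor {q : ℝ≥0∞} (hq : 0 < q) (hq1 : q ≤ 1) (a : ℕ) :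
    Filter.Tendsto (fun w : ℝ≥0∞ => retryFactor q (w ^ a)) (nhds 1) (nhds 1) := by
  have hqt : q ≠ ⊤ := ne_top_of_le_ne_top ENNReal.one_ne_top hq1
  have h1 : Filter.Tendsto (fun w : ℝ≥0∞ => w ^ a) (nhds 1) (nhds 1) := by
    have := (ENNReal.continuous_pow a).tendsto 1
    simpa using this
  have h2 : Filter.Tendsto (fun w : ℝ≥0∞ => (1 - q) * w ^ a) (nhds 1) (nhds ((1 - q) * 1)) :=
    ENNReal.Tendsto.const_mul h1 (Or.inl one_ne_zero)
  have h3 : Filter.Tendsto (fun w : ℝ≥0∞ => 1 - (1 - q) * w ^ a) (nhds 1)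
      (nhds (1 - (1 - q) * 1)) := ENNReal.Tendsto.sub tendsto_const_nhds h2 (Or.inl ENNReal.one_ne_top)
  rw [mul_one, ENNReal.sub_sub_cancel ENNReal.one_ne_top hq1] at h3
  have h4 := tendsto_inv_iff.2 h3
  have h5 : Filter.Tendsto (fun w : ℝ≥0∞ => w ^ a - 1) (nhds 1) (nhds (1 - 1)) :=
    ENNReal.Tendsto.sub h1 tendsto_const_nhds (Or.inl ENNReal.one_ne_top)
  have h6 := ENNReal.Tendsto.mul h5 (Or.inr (ENNReal.inv_ne_top.2 hq.ne')) h4 (Or.inr (by simp))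
  have h7 := (tendsto_const_nhds (x := (1 : ℝ≥0∞)) (f := nhds (1 : ℝ≥0∞))).add h6
  simpa [retryFactor] using h7

section Retry

variable {d : ℕ} {trial : (Fin d → I) → Run (Option ℕ)} {P : ℕ → ℝ≥0∞} {a : ℕ} {s : ℝ≥0∞}
  {e : ℕ → Key}

/-- The first `t` trials fail. -/
def fails (trial : (Fin d → I) → Run (Option ℕ)) (e : ℕ → Key) (t : ℕ) : Set (Key → I) :=
  {h | ∀ u < t, (trial fun r : Fin d => h (e (d * u + r))).val = none}

lemma measurable_trial (H : TrialLaw trial P a s) (j : ℕ) {S : Set Key}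
    (hS : ∀ r : Fin d, e (d * j + r) ∈ S) :
    Measurable[keyAlgebra S, ⊤] fun h : Key → I => (trial fun r => h (e (d * j + r))).val :=
  @Measurable.comp _ _ _ (keyAlgebra S) _ ⊤ (fun u => (trial u).val) _ H.measurable
    (measurable_block (e := fun r : Fin d => e (d * j + r)) hS)

lemma map_trial (H : TrialLaw trial P a s) (he : Function.Injective e) (t : ℕ)
    (A : Set (Option ℕ)) :
    hashLaw {h | (trial fun r : Fin d => h (e (d * t + r))).val ∈ A} =
      volume {u | (trial u).val ∈ A} := by
  have hinj : Function.Injective fun r : Fin d => e (d * t + r) := fun r r' h => by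
    have := he h
    exact Fin.ext (by omega)
  rw [← map_block hinj, Measure.map_apply]
  · rfl
  · exact (measurable_block (S := Set.univ) (fun _ => Set.mem_univ _)).mono (keyAlgebra_le _) le_rfl
  · exact H.measurable (t := A) (by trivial)

lemma TrialLaw.reject (H : TrialLaw trial P a s) : volume {u | (trial u).val = none} = 1 - s := by
  have : {u | (trial u).val = none} = {u | (trial u).val.isSome = true}ᶜ := by ext u; simp
  have hm : MeasurableSet {u | (trial u).val.isSome = true} :=
    H.measurable (t := {o | o.isSome = true}) (by trivial)
  rw [this, prob_compl_eq_one_sub hm, H.accept]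

lemma measurableSet_fails (H : TrialLaw trial P a s) (t : ℕ) {S : Set Key}
    (hS : ∀ i < d * t, e i ∈ S) : MeasurableSet[keyAlgebra S] (fails trial e t) := by
  have : fails trial e t = ⋂ u : Fin t,
      (fun h : Key → I => (trial fun r : Fin d => h (e (d * u + r))).val) ⁻¹' {none} := by
    ext h
    simp only [fails, Set.mem_ofPred_eq, Set.mem_iInter, Set.mem_preimage, Set.mem_singleton_iff]
    exact ⟨fun hh u => hh u u.2, fun hh u hu => hh ⟨u, hu⟩⟩
  rw [this]
  refine @MeasurableSet.iInter _ _ (keyAlgebra S) _ _ fun u => ?_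
  refine measurable_trial H u (fun r => hS _ ?_) (by trivial)
  have h1 := u.2
  have h2 := r.2
  calc d * (u : ℕ) + r < d * u + d := by omega
    _ = d * (u + 1) := by ring
    _ ≤ d * t := Nat.mul_le_mul_left d h1

/-- The first `t` trials read the deviates below `d * t`, trial `t` those from `d * t` on. -/
lemma fails_indep (H : TrialLaw trial P a s) (he : Function.Injective e) (t : ℕ)
    (A : Set (Option ℕ)) :
    hashLaw (fails trial e t ∩ {h | (trial fun r : Fin d => h (e (d * t + r))).val ∈ A}) =
      hashLaw (fails trial e t) * volume {u | (trial u).val ∈ A} := by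
  rw [← map_trial H he t A]
  have hdisj : Disjoint (e '' Set.Iio (d * t)) (e '' Set.Ici (d * t)) := by
    rw [Set.disjoint_image_iff he]
    exact Set.disjoint_left.2 fun x hx hx' => absurd (Set.mem_Iio.1 hx) (not_lt.2 hx')
  refine (ProbabilityTheory.Indep_iff _ _ _).1 (keyAlgebra_indep hdisj) _ _ ?_ ?_
  · exact measurableSet_fails H t fun i hi => Set.mem_image_of_mem _ hi
  · exact measurable_trial H t (fun r => Set.mem_image_of_mem _ (by simp)) (t := A) (by trivial)

lemma hashLaw_fails (H : TrialLaw trial P a s) (he : Function.Injective e) (t : ℕ) :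
    hashLaw (fails trial e t) = (1 - s) ^ t := by
  induction t with
  | zero => simp [fails]
  | succ t ih =>
    have : fails trial e (t + 1) = fails trial e t ∩
        {h | (trial fun r : Fin d => h (e (d * t + r))).val ∈ ({none} : Set (Option ℕ))} := by
      ext h
      simp only [fails, Set.mem_ofPred_eq, Set.mem_inter_iff, Set.mem_singleton_iff]
      constructor
      · exact fun hh => ⟨fun u hu => hh u (by omega), hh t (by omega)⟩
      · rintro ⟨h1, h2⟩ u hu
        rcases Nat.lt_succ_iff_lt_or_eq.1 hu with h | rfl
        exacts [h1 u h, h2]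
    rw [this, fails_indep H he, ih, pow_succ]
    congr 1
    exact H.reject

lemma ae_exists_success (H : TrialLaw trial P a s) (he : Function.Injective e) (hs : 0 < s) :
    ∀ᵐ h ∂hashLaw, ∃ t x, h ∈ fails trial e t ∧
      (trial fun r : Fin d => h (e (d * t + r))).val = some x := by
  have hnull : hashLaw (⋂ t, fails trial e t) = 0 := by
    have hlt : 1 - s < 1 := ENNReal.sub_lt_self ENNReal.one_ne_top one_ne_zero hs.ne'
    have h1 : Filter.Tendsto (fun t : ℕ => (1 - s) ^ t) Filter.atTop (nhds 0) :=
      ENNReal.tendsto_pow_atTop_nhds_zero_iff.2 hlt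
    refine le_antisymm (ge_of_tendsto' h1 fun t => ?_) zero_le
    rw [← hashLaw_fails H he t]
    exact measure_mono (Set.iInter_subset _ t)
  have : ∀ᵐ h ∂hashLaw, h ∉ ⋂ t, fails trial e t := measure_eq_zero_iff_ae_notMem.1 hnull
  filter_upwards [this] with h hh
  classical
  have hex : ∃ t, (trial fun r : Fin d => h (e (d * t + r))).val ≠ none := by
    by_contra hcon
    push Not at hcon
    exact hh (Set.mem_iInter.2 fun t u _ => hcon u)
  obtain ⟨x, hx⟩ := Option.ne_none_iff_exists'.1 (Nat.find_spec hex)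
  refine ⟨Nat.find hex, x, fun u hu => ?_, hx⟩
  have := Nat.find_min hex hu
  simpa using this

/-- A computation that returns a random number with distribution `P`. -/
structure Deviate (S : Set Key) (X : (Key → I) → Run ℕ) (P : ℕ → ℝ≥0∞) : Prop where
  obs : Observable S fun h => (X h).val
  law : ∀ x, hashLaw {h | (X h).val = x} = P x

lemma retry_val_eq_iff {h : Key → I} {t x : ℕ} (hf : h ∈ fails trial e t) (y : ℕ)
    (hx : (trial fun r : Fin d => h (e (d * t + r))).val = some x) :
    (retry fun t => trial fun r : Fin d => h (e (d * t + r))).val = y ↔ x = y := by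
  rw [retry_eq (fun u hu => hf u hu) hx]

/-- The first success occurs in trial `t` and returns `x` with probability `(1 - s)^t * s * P x`;
the sum over `t` is `P x`. -/
theorem retry_deviate (H : TrialLaw trial P a s) (he : Function.Injective e) (hs : 0 < s)
    {S : Set Key} (hS : ∀ i, e i ∈ S) :
    Deviate S (fun h => retry fun t => trial fun r : Fin d => h (e (d * t + r))) P := by
  have hs1 : s ≤ 1 := H.accept ▸ prob_le_one
  set F : ℕ → ℕ → Set (Key → I) := fun t x =>
    fails trial e t ∩ {h | (trial fun r : Fin d => h (e (d * t + r))).val ∈ ({some x} : Set _)}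
  have hF : ∀ t x, MeasurableSet[keyAlgebra S] (F t x) := fun t x =>
    @MeasurableSet.inter _ (keyAlgebra S) _ _ (measurableSet_fails H t fun i _ => hS i)
      (measurable_trial H t (fun r => hS _) (t := {some x}) (by trivial))
  have hae : ∀ x, {h | (retry fun t => trial fun r : Fin d => h (e (d * t + r))).val = x}
      =ᵐ[hashLaw] ⋃ t, F t x := by
    intro x
    filter_upwards [ae_exists_success H he hs] with h hh
    obtain ⟨t, y, hf, hy⟩ := hh
    refine propext ?_
    change (retry fun t => trial fun r : Fin d => h (e (d * t + r))).val = x ↔ h ∈ ⋃ t, F t x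
    rw [retry_val_eq_iff hf x hy, Set.mem_iUnion]
    constructor
    · rintro rfl
      exact ⟨t, hf, hy⟩
    · rintro ⟨t', hf', hy'⟩
      have h1 := (retry_val_eq_iff hf y hy).2 rfl
      exact ((retry_val_eq_iff hf' y hy').1 h1).symm
  refine ⟨⟨fun h => (retry fun t => trial fun r : Fin d => h (e (d * t + r))).val, ?_,
    Filter.EventuallyEq.rfl⟩, fun x => ?_⟩
  · intro A _
    -- Measurability is proved for the value itself, so the null event that all trials fail, where
    -- the value is `default`, has to appear.
    have : (fun h : Key → I => (retry fun t => trial fun r : Fin d => h (e (d * t + r))).val) ⁻¹' A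
        = (⋃ t, ⋃ x ∈ A, F t x) ∪ ((⋂ t, fails trial e t) ∩ {_h | default ∈ A}) := by
      ext h
      simp only [Set.mem_preimage, Set.mem_union, Set.mem_iUnion, Set.mem_inter_iff,
        Set.mem_ofPred_eq]
      classical
      by_cases hex : ∃ t, (trial fun r : Fin d => h (e (d * t + r))).val ≠ none
      · obtain ⟨y, hy⟩ := Option.ne_none_iff_exists'.1 (Nat.find_spec hex)
        have hf : h ∈ fails trial e (Nat.find hex) := fun u hu => by
          simpa using Nat.find_min hex hu
        rw [retry_eq (fun u hu => hf u hu) hy]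
        constructor
        · exact fun hA => Or.inl ⟨_, y, hA, hf, hy⟩
        · rintro (⟨t, x, hA, hf', hx⟩ | ⟨hn, _⟩)
          · have h1 := (retry_val_eq_iff hf y hy).2 rfl
            rwa [← (retry_val_eq_iff hf' y hx).1 h1]
          · have := Set.mem_iInter.1 hn (Nat.find hex + 1) _ (Nat.lt_succ_self _)
            exact absurd this (Nat.find_spec hex)
      · have h0 : (retry fun t => trial fun r : Fin d => h (e (d * t + r))).val = default := by
          unfold retry
          rw [dif_neg]
          rintro ⟨t, ht⟩
          exact hex ⟨t, Option.isSome_iff_ne_none.1 ht⟩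
        rw [h0]
        push Not at hex
        constructor
        · exact fun hA => Or.inr ⟨Set.mem_iInter.2 fun t u _ => hex u, hA⟩
        · rintro (⟨t, x, _, _, hx⟩ | ⟨_, hA⟩)
          · have hx' : (trial fun r : Fin d => h (e (d * t + r))).val = some x := hx
            rw [hex t] at hx'
            exact absurd hx' (by simp)
          · exact hA
    rw [this]
    refine @MeasurableSet.union _ (keyAlgebra S) _ _ ?_ ?_
    · exact @MeasurableSet.iUnion _ _ (keyAlgebra S) _ _ fun t =>
        @MeasurableSet.biUnion _ _ (keyAlgebra S) _ _ (Set.to_countable A) fun x _ => hF t x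
    · refine @MeasurableSet.inter _ (keyAlgebra S) _ _ ?_ (@MeasurableSet.const _ (keyAlgebra S) _)
      exact @MeasurableSet.iInter _ _ (keyAlgebra S) _ _ fun t =>
        measurableSet_fails H t fun i _ => hS i
  · rw [measure_congr (hae x), measure_iUnion]
    · have h1 : ∀ t, hashLaw (F t x) = P x * ((1 - s) ^ t * s) := by
        intro t
        rw [fails_indep H he, hashLaw_fails H he]
        have := H.law x
        simp only [Set.mem_singleton_iff]
        rw [this]
        ring
      simp_rw [h1]
      rw [ENNReal.tsum_mul_left, ENNReal.tsum_mul_right, ENNReal.tsum_geometric,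
        ENNReal.sub_sub_cancel ENNReal.one_ne_top hs1,
        ENNReal.inv_mul_cancel hs.ne' (ne_top_of_le_ne_top ENNReal.one_ne_top hs1), mul_one]
    · intro t t' htt
      rw [Function.onFun, Set.disjoint_left]
      rintro h ⟨h1, h2⟩ ⟨h3, h4⟩
      rcases lt_or_gt_of_ne htt with hlt | hlt
      · have := h3 t hlt
        rw [show _ = some x from h2] at this
        exact absurd this (by simp)
      · have := h1 t' hlt
        rw [show _ = some x from h4] at this
        exact absurd this (by simp)
    · exact fun t => keyAlgebra_le S _ (hF t x)

/-- The trial number of the first success is independent of the number returned. Hence the integral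
over the event that `x` is returned is `P x` times the series of `tsum_le_retryFactor`. The majorant
charges the full `a` steps to each trial. -/
theorem retry_jointCost (H : TrialLaw trial P a s) (he : Function.Injective e) {q w : ℝ≥0∞}
    (hq : 0 < q) (hqs : q ≤ s) (hw : 1 ≤ w) (hqw : (1 - q) * w ^ a < 1)
    {S : Set Key} (hS : ∀ i, e i ∈ S) :
    JointCost w S (fun h => retry fun t => trial fun r : Fin d => h (e (d * t + r)))
      (retryFactor q (w ^ a)) := by
  have hs : 0 < s := hq.trans_le hqs
  have hs1 : s ≤ 1 := H.accept ▸ prob_le_one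
  have hD := retry_deviate H he hs hS
  set G : ℕ → Set (Key → I) := fun t => fails trial e t ∩
    {h | (trial fun r : Fin d => h (e (d * t + r))).val ∈ ({none}ᶜ : Set _)}
  have hG : ∀ t, MeasurableSet[keyAlgebra S] (G t) := fun t =>
    @MeasurableSet.inter _ (keyAlgebra S) _ _ (measurableSet_fails H t fun i _ => hS i)
      (measurable_trial H t (fun r => hS _) (t := {none}ᶜ) (by trivial))
  have hGm : ∀ t, Measurable[keyAlgebra S]
      ((G t).indicator fun _ : Key → I => (w ^ a) ^ (t + 1)) := fun t =>
    @Measurable.indicator _ _ (G t) _ (keyAlgebra S) _ _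
      (@measurable_const _ _ _ (keyAlgebra S) _) (hG t)
  refine ⟨fun h => ∑' t, (G t).indicator (fun _ => (w ^ a) ^ (t + 1)) h, ?_, ?_, fun x => ?_⟩
  · exact @Measurable.tsum _ _ _ (keyAlgebra S) _ _ _ _ _ _ _ _ _ _ _ _ hGm
  · filter_upwards [ae_exists_success H he hs] with h hh
    obtain ⟨t, y, hf, hy⟩ := hh
    rw [retry_eq (fun u hu => hf u hu) hy]
    refine le_trans ?_ (ENNReal.le_tsum t)
    have hmem : h ∈ G t := ⟨hf, by simp [hy]⟩
    rw [Set.indicator_of_mem hmem, ← pow_mul, ← weight_coe]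
    refine weight_mono hw ?_
    change ∑ u ∈ Finset.range (t + 1), (trial fun r : Fin d => h (e (d * u + r))).time ≤ _
    calc _ ≤ ∑ _u ∈ Finset.range (t + 1), (a : ℕ∞) := Finset.sum_le_sum fun u _ => H.time_le _
      _ = _ := by simp [mul_comm]
  · have hmeas : ∀ t, AEMeasurable ((G t).indicator fun _ : Key → I => (w ^ a) ^ (t + 1))
        (hashLaw.restrict
          {h | (retry fun t => trial fun r : Fin d => h (e (d * t + r))).val = x}) :=
      fun t => ((hGm t).mono (keyAlgebra_le S) le_rfl).aemeasurable
    rw [lintegral_tsum hmeas, hD.law x]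
    calc _ ≤ ∑' t, P x * ((w ^ a) ^ (t + 1) * ((1 - s) ^ t * s)) := by
          refine ENNReal.tsum_le_tsum fun t => ?_
          rw [lintegral_indicator (keyAlgebra_le S _ (hG t)), lintegral_const,
            Measure.restrict_restrict (keyAlgebra_le S _ (hG t)), Measure.restrict_apply_univ]
          have hsub : G t ∩ {h | (retry fun t => trial fun r : Fin d => h (e (d * t + r))).val = x}
              ⊆ fails trial e t ∩
                {h | (trial fun r : Fin d => h (e (d * t + r))).val ∈ ({some x} : Set _)} := by
            rintro h ⟨⟨hf, hn⟩, hx⟩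
            obtain ⟨y, hy⟩ := Option.ne_none_iff_exists'.1 hn
            refine ⟨hf, ?_⟩
            rw [← (retry_val_eq_iff hf x hy).1 hx]
            exact hy
          have h2 := measure_mono (μ := hashLaw) hsub
          rw [fails_indep H he, hashLaw_fails H he] at h2
          have h3 := H.law x
          simp only [Set.mem_singleton_iff] at h2
          rw [h3] at h2
          calc _ ≤ (w ^ a) ^ (t + 1) * ((1 - s) ^ t * (P x * s)) := by gcongr
            _ = _ := by ring
      _ ≤ P x * retryFactor q (w ^ a) := by
          rw [ENNReal.tsum_mul_left]
          gcongr
          exact tsum_le_retryFactor hqs hs1 (one_le_pow₀ hw) hqw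

end Retry

/-! ## Uniformly random samples -/

/-- The list `V`, which is computed from the keys in `S`, enumerates without repetitions a uniformly
random subset of `off + 1, …, off + M` with `m` elements. -/
structure Samples (S : Set Key) (V : (Key → I) → List ℕ) (off M m : ℕ) : Prop where
  obs : Observable S V
  law : ∀ A : Finset ℕ, hashLaw {h | (V h).Nodup ∧ (V h).toFinset = A} =
    if A ∈ (Finset.Ioc off (off + M)).powersetCard m then ((M.choose m : ℕ) : ℝ≥0∞)⁻¹ else 0

lemma choose_inv_ne {M m : ℕ} (h : m ≤ M) : ((M.choose m : ℕ) : ℝ≥0∞) ≠ 0 := by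
  exact_mod_cast (Nat.choose_pos h).ne'

lemma Samples.mono {S T : Set Key} {V : (Key → I) → List ℕ} {off M m : ℕ} (H : Samples S V off M m)
    (h : S ⊆ T) : Samples T V off M m := ⟨H.obs.mono h, H.law⟩

/-- The `M choose m` admissible sets together already have probability 1; this rules out repetitions
and wrong sizes almost surely. -/
lemma Samples.ae {S : Set Key} {V : (Key → I) → List ℕ} {off M m : ℕ} (H : Samples S V off M m)
    (hm : m ≤ M) :
    ∀ᵐ h ∂hashLaw, (V h).Nodup ∧ (V h).toFinset ∈ (Finset.Ioc off (off + M)).powersetCard m := by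
  set Q : Finset ℕ → Set (Key → I) := fun A => {h | (V h).Nodup ∧ (V h).toFinset = A}
  set F := (Finset.Ioc off (off + M)).powersetCard m
  have hQ : ∀ A, NullMeasurableSet (Q A) hashLaw := fun A =>
    H.obs.nullMeasurableSet fun l => l.Nodup ∧ l.toFinset = A
  have h1 : hashLaw (⋃ A ∈ F, Q A) = 1 := by
    rw [measure_biUnion_finset₀ _ fun A _ => hQ A]
    · rw [Finset.sum_congr rfl fun A hA => by rw [H.law A, if_pos hA]]
      have hc : F.card = M.choose m := by simp [F]
      rw [Finset.sum_const, hc, nsmul_eq_mul,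
        ENNReal.mul_inv_cancel (choose_inv_ne hm) (ENNReal.natCast_ne_top _)]
    · intro A _ A' _ hAA
      refine Disjoint.aedisjoint (Set.disjoint_left.2 ?_)
      rintro h ⟨_, h2⟩ ⟨_, h3⟩
      exact hAA (h2.symm.trans h3)
  have h2 : NullMeasurableSet (⋃ A ∈ F, Q A) hashLaw :=
    NullMeasurableSet.biUnion (Finset.countable_toSet F) fun A _ => hQ A
  have h3 := (prob_compl_eq_zero_iff₀ h2).2 h1
  filter_upwards [measure_eq_zero_iff_ae_notMem.1 h3] with h hh
  simp only [Set.mem_compl_iff, not_not, Set.mem_iUnion] at hh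
  obtain ⟨A, hA, hn, rfl⟩ := hh
  exact ⟨hn, hA⟩

lemma samples_nil (S : Set Key) (off M : ℕ) : Samples S (fun _ => []) off M 0 := by
  refine ⟨observable_const _, fun A => ?_⟩
  by_cases hA : A = ∅
  · subst hA; simp
  · have : ¬ ∅ = A := fun h => hA h.symm
    simp [hA, this]

lemma Samples.map_add {S : Set Key} {V : (Key → I) → List ℕ} {M m : ℕ} (H : Samples S V 0 M m)
    (hm : m ≤ M) (off : ℕ) : Samples S (fun h => (V h).map fun x => off + x) off M m := by
  refine ⟨H.obs.comp (List.map fun x => off + x), fun A => ?_⟩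
  have hinj : Function.Injective fun x => off + x := add_right_injective off
  have himg : ∀ l : List ℕ, (l.map fun x => off + x).toFinset = l.toFinset.image fun x => off + x :=
    fun l => by ext; simp
  have hI : (Finset.Ioc 0 (0 + M)).image (fun x => off + x) = Finset.Ioc off (off + M) := by
    simp
  by_cases hA : A ∈ (Finset.Ioc off (off + M)).powersetCard m
  · rw [if_pos hA]
    obtain ⟨hA1, hA2⟩ := Finset.mem_powersetCard.1 hA
    rw [← hI] at hA1
    obtain ⟨A', hA', rfl⟩ := Finset.subset_image_iff.1 hA1
    have := H.law A'
    rw [if_pos (Finset.mem_powersetCard.2 ⟨hA', by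
      rwa [Finset.card_image_of_injective _ hinj] at hA2⟩)] at this
    rw [← this]
    congr 1
    ext h
    rw [Set.mem_ofPred_eq, Set.mem_ofPred_eq, List.nodup_map_iff hinj, himg,
      (Finset.image_injective hinj).eq_iff]
  · rw [if_neg hA]
    refine measure_mono_null (t := {h | ¬ ((V h).Nodup ∧
      (V h).toFinset ∈ (Finset.Ioc 0 (0 + M)).powersetCard m)}) ?_ (ae_iff.1 (H.ae hm))
    rintro h ⟨h1, h2⟩ ⟨h3, h4⟩
    obtain ⟨h5, h6⟩ := Finset.mem_powersetCard.1 h4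
    refine hA (h2 ▸ Finset.mem_powersetCard.2 ⟨?_, ?_⟩)
    · rw [himg, ← hI]
      exact Finset.image_subset_image h5
    · rw [himg, Finset.card_image_of_injective _ hinj, h6]

/-! ## First element decomposition -/

/-- Distribution of the number of elements before the first element of a random sample of `m + 1`
out of `M` elements. -/
noncomputable def skipPMF (m M k : ℕ) : ℝ≥0∞ :=
  if k < M then ((M - (k + 1)).choose m : ℝ≥0∞) / (M.choose (m + 1) : ℝ≥0∞) else 0

lemma skipPMF_ne_zero {m M k : ℕ} (h : skipPMF m M k ≠ 0) : m ≤ M - (k + 1) ∧ k < M := by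
  unfold skipPMF at h
  split_ifs at h with hk
  · refine ⟨?_, hk⟩
    by_contra hcon
    rw [Nat.choose_eq_zero_of_lt (by omega)] at h
    simp at h
  · exact absurd rfl h

/-- For a given `A` only the gap before its minimum contributes. Its probability is `(M - k - 1
choose m) / (M choose m + 1)`, the rest is right with probability `1 / (M - k - 1 choose m)`, and
the first binomial cancels. -/
theorem Samples.cons {S T U : Set Key} (hST : Disjoint S T) (hS : S ⊆ U) (hT : T ⊆ U)
    {X : (Key → I) → ℕ} {V : ℕ → (Key → I) → List ℕ} {off M m : ℕ}
    (hX : Observable S X) (hlaw : ∀ k, hashLaw {h | X h = k} = skipPMF m M k)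
    (hV : ∀ k < M, m ≤ M - (k + 1) → Samples T (V k) (off + (k + 1)) (M - (k + 1)) m) :
    Samples U (fun h => (off + (X h + 1)) :: V (X h) h) off M (m + 1) := by
  have hV' : ∀ k, hashLaw {h | X h = k} ≠ 0 →
      Samples T (V k) (off + (k + 1)) (M - (k + 1)) m := fun k hk => by
    rw [hlaw] at hk
    obtain ⟨h1, h2⟩ := skipPMF_ne_zero hk
    exact hV k h2 h1
  refine ⟨?_, fun A => ?_⟩
  · exact Observable.bind (V := fun k h => (off + (k + 1)) :: V k h) (hX.mono hS)
      fun k hk => ((hV' k hk).obs.mono hT).comp (List.cons (off + (k + 1)))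
  set cond : ℕ → Prop := fun k => k < M ∧ off + (k + 1) ∈ A ∧
    A.erase (off + (k + 1)) ∈ (Finset.Ioc (off + (k + 1)) (off + M)).powersetCard m with hcond
  have hterm : ∀ k, hashLaw {h | X h = k} *
      hashLaw {h | ((off + (k + 1)) :: V k h).Nodup ∧ ((off + (k + 1)) :: V k h).toFinset = A} =
      if cond k then ((M.choose (m + 1) : ℕ) : ℝ≥0∞)⁻¹ else 0 := by
    intro k
    by_cases hk : hashLaw {h | X h = k} = 0
    · rw [hk, zero_mul, if_neg]
      rintro ⟨h1, h2, h3⟩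
      have h4 := Finset.card_le_card (Finset.mem_powersetCard.1 h3).1
      rw [(Finset.mem_powersetCard.1 h3).2, Nat.card_Ioc] at h4
      rw [hlaw, skipPMF, if_pos h1, ENNReal.div_eq_zero_iff] at hk
      rcases hk with hk | hk
      · exact choose_inv_ne (M := M - (k + 1)) (m := m) (by omega) hk
      · exact ENNReal.natCast_ne_top _ hk
    · have hS' := hV' k hk
      rw [hlaw] at hk
      obtain ⟨h1, h2⟩ := skipPMF_ne_zero hk
      by_cases ha : off + (k + 1) ∈ A
      · have he : {h | ((off + (k + 1)) :: V k h).Nodup ∧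
            ((off + (k + 1)) :: V k h).toFinset = A} =
            {h | (V k h).Nodup ∧ (V k h).toFinset = A.erase (off + (k + 1))} := by
          ext h
          simp only [Set.mem_ofPred_eq, List.nodup_cons, List.toFinset_cons]
          constructor
          · rintro ⟨⟨h3, h4⟩, h5⟩
            refine ⟨h4, ?_⟩
            rw [← h5, Finset.erase_insert (by simpa using h3)]
          · rintro ⟨h3, h4⟩
            refine ⟨⟨?_, h3⟩, by rw [h4, Finset.insert_erase ha]⟩
            rw [← List.mem_toFinset, h4]
            simp
        rw [he, hS'.law, hlaw, skipPMF, if_pos h2]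
        have e1 : off + (k + 1) + (M - (k + 1)) = off + M := by omega
        rw [e1]
        by_cases hp : A.erase (off + (k + 1)) ∈
            (Finset.Ioc (off + (k + 1)) (off + M)).powersetCard m
        · rw [if_pos hp, if_pos ⟨h2, ha, hp⟩, ENNReal.div_eq_inv_mul, mul_assoc,
            ENNReal.mul_inv_cancel (choose_inv_ne h1) (ENNReal.natCast_ne_top _), mul_one]
        · rw [if_neg hp, if_neg fun hc => hp hc.2.2, mul_zero]
      · rw [if_neg fun hc => ha hc.2.1]
        have he : {h | ((off + (k + 1)) :: V k h).Nodup ∧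
            ((off + (k + 1)) :: V k h).toFinset = A} = ∅ := by
          ext h
          simp only [Set.mem_ofPred_eq, Set.mem_empty_iff_false, iff_false, not_and]
          rintro _ rfl
          simp at ha
        rw [he, measure_empty, mul_zero]
  have hbind := law_bind (V := fun k h => (off + (k + 1)) :: V k h) hST hX
    (fun k hk => (hV' k hk).obs.comp (List.cons (off + (k + 1))))
    fun l => l.Nodup ∧ l.toFinset = A
  rw [hbind, tsum_congr hterm]
  by_cases hA : A ∈ (Finset.Ioc off (off + M)).powersetCard (m + 1)
  · rw [if_pos hA]
    obtain ⟨hA1, hA2⟩ := Finset.mem_powersetCard.1 hA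
    have hne : A.Nonempty := Finset.card_pos.1 (by omega)
    have hmin := Finset.min'_mem A hne
    have hb := Finset.mem_Ioc.1 (hA1 hmin)
    obtain ⟨k, hk⟩ : ∃ k, A.min' hne = off + (k + 1) :=
      ⟨A.min' hne - off - 1, by omega⟩
    have hck : cond k := by
      refine ⟨by omega, hk ▸ hmin, Finset.mem_powersetCard.2 ⟨fun x hx => ?_, ?_⟩⟩
      · have hxA := Finset.mem_of_mem_erase hx
        have h1 := Finset.min'_le A x hxA
        have h2 := Finset.ne_of_mem_erase hx
        have h3 := Finset.mem_Ioc.1 (hA1 hxA)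
        exact Finset.mem_Ioc.2 ⟨by omega, h3.2⟩
      · rw [Finset.card_erase_of_mem (hk ▸ hmin), hA2]
        rfl
    rw [tsum_eq_single k, if_pos hck]
    intro k' hk'
    refine if_neg fun hc => ?_
    rcases lt_or_gt_of_ne hk' with hlt | hlt
    · have := Finset.min'_le A _ hc.2.1
      omega
    · have hmem : off + (k + 1) ∈ A.erase (off + (k' + 1)) :=
        Finset.mem_erase.2 ⟨by omega, hck.2.1⟩
      have := Finset.mem_Ioc.1 ((Finset.mem_powersetCard.1 hc.2.2).1 hmem)
      omega
  · rw [if_neg hA]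
    refine ENNReal.tsum_eq_zero.2 fun k => if_neg fun hc => hA ?_
    obtain ⟨h1, h2, h3⟩ := hc
    obtain ⟨h4, h5⟩ := Finset.mem_powersetCard.1 h3
    refine Finset.mem_powersetCard.2 ⟨fun x hx => ?_, ?_⟩
    · by_cases hxa : x = off + (k + 1)
      · exact Finset.mem_Ioc.2 ⟨by omega, by omega⟩
      · have := Finset.mem_Ioc.1 (h4 (Finset.mem_erase.2 ⟨hxa, hx⟩))
        exact Finset.mem_Ioc.2 ⟨by omega, this.2⟩
    · rw [Finset.card_erase_of_mem h2] at h5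
      have := Finset.card_pos.2 ⟨_, h2⟩
      omega

/-! ## Splitting by a hypergeometric deviate -/

/-- The hypergeometric distribution with values in `ℝ≥0∞`. -/
noncomputable def hyperLaw (n l N x : ℕ) : ℝ≥0∞ := ENNReal.ofReal (hyperPMF n l N x)

lemma hyperPMF_nonneg (n l N x : ℕ) : 0 ≤ hyperPMF n l N x := by
  unfold hyperPMF
  split_ifs <;> positivity

lemma hyperLaw_eq {n l N : ℕ} (hn : n ≤ N) (x : ℕ) : hyperLaw n l N x =
    if x ≤ n then (l.choose x : ℝ≥0∞) * ((N - l).choose (n - x) : ℝ≥0∞) / (N.choose n : ℝ≥0∞)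
    else 0 := by
  unfold hyperLaw hyperPMF
  have : (0 : ℝ) < (N.choose n : ℝ) := by exact_mod_cast Nat.choose_pos hn
  split_ifs with h
  · rw [mul_one, ENNReal.ofReal_div_of_pos this, ENNReal.ofReal_mul (by positivity),
      ENNReal.ofReal_natCast, ENNReal.ofReal_natCast, ENNReal.ofReal_natCast]
  · simp

lemma hyperLaw_ne_zero {n l N x : ℕ} (h : hyperLaw n l N x ≠ 0) :
    x ≤ n ∧ x ≤ l ∧ n - x ≤ N - l := by
  unfold hyperLaw hyperPMF at h
  refine ⟨?_, ?_, ?_⟩ <;> by_contra hcon <;> refine h ?_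
  · simp [hcon]
  · simp [Nat.choose_eq_zero_of_lt (not_le.1 hcon)]
  · simp [Nat.choose_eq_zero_of_lt (not_le.1 hcon)]

lemma append_eq_iff {off l N : ℕ} {L R : List ℕ} {A : Finset ℕ}
    (hL : L.toFinset ⊆ Finset.Ioc off (off + l))
    (hR : R.toFinset ⊆ Finset.Ioc (off + l) (off + N)) :
    ((L ++ R).Nodup ∧ (L ++ R).toFinset = A) ↔
      (L.Nodup ∧ L.toFinset = A.filter (· ≤ off + l)) ∧
      (R.Nodup ∧ R.toFinset = A.filter (off + l < ·)) := by
  have hL' : ∀ x ∈ L, x ≤ off + l := fun x hx =>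
    (Finset.mem_Ioc.1 (hL (List.mem_toFinset.2 hx))).2
  have hR' : ∀ x ∈ R, off + l < x := fun x hx =>
    (Finset.mem_Ioc.1 (hR (List.mem_toFinset.2 hx))).1
  rw [List.nodup_append', List.toFinset_append]
  constructor
  · rintro ⟨⟨h1, h2, _⟩, rfl⟩
    refine ⟨⟨h1, ?_⟩, ⟨h2, ?_⟩⟩
    · ext x
      simp only [Finset.mem_filter, Finset.mem_union, List.mem_toFinset]
      exact ⟨fun hx => ⟨Or.inl hx, hL' x hx⟩, fun ⟨hx, hle⟩ => hx.resolve_right fun hx =>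
        absurd (hR' x hx) (not_lt.2 hle)⟩
    · ext x
      simp only [Finset.mem_filter, Finset.mem_union, List.mem_toFinset]
      exact ⟨fun hx => ⟨Or.inr hx, hR' x hx⟩, fun ⟨hx, hle⟩ => hx.resolve_left fun hx =>
        absurd (hL' x hx) (not_le.2 hle)⟩
  · rintro ⟨⟨h1, h2⟩, ⟨h3, h4⟩⟩
    refine ⟨⟨h1, h3, fun x hx hx' => absurd (hL' x hx) (not_le.2 (hR' x hx'))⟩, ?_⟩
    rw [h2, h4]
    ext x
    simp only [Finset.mem_filter, Finset.mem_union]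
    have := le_or_gt x (off + l)
    tauto

/-- For a given `A` only one `x` contributes, the number of elements of `A` in the left part; there
both numerators of the hypergeometric probability cancel against the two uniform laws. -/
theorem Samples.append {S T₁ T₂ U : Set Key} (hST₁ : Disjoint S T₁) (hST₂ : Disjoint S T₂)
    (hT : Disjoint T₁ T₂) (hS : S ⊆ U) (hT₁ : T₁ ⊆ U) (hT₂ : T₂ ⊆ U)
    {X : (Key → I) → ℕ} {L R : ℕ → (Key → I) → List ℕ} {off l n N : ℕ} (hn : n ≤ N) (hl : l ≤ N)
    (hX : Observable S X) (hlaw : ∀ x, hashLaw {h | X h = x} = hyperLaw n l N x)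
    (hL : ∀ x ≤ l, Samples T₁ (L x) off l x)
    (hR : ∀ x, n - x ≤ N - l → Samples T₂ (R x) (off + l) (N - l) (n - x)) :
    Samples U (fun h => L (X h) h ++ R (X h) h) off N n := by
  have hobs : ∀ x, hashLaw {h | X h = x} ≠ 0 →
      Observable (T₁ ∪ T₂) fun h => L x h ++ R x h := fun x hx => by
    rw [hlaw] at hx
    obtain ⟨_, h2, h3⟩ := hyperLaw_ne_zero hx
    exact Observable.bind (V := fun l h => l ++ R x h)
      ((hL x h2).obs.mono Set.subset_union_left) fun l _ =>
        ((hR x h3).obs.mono Set.subset_union_right).comp (l ++ ·)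
  refine ⟨?_, fun A => ?_⟩
  · exact Observable.bind (V := fun x h => L x h ++ R x h) (hX.mono hS)
      fun x hx => (hobs x hx).mono (Set.union_subset hT₁ hT₂)
  have hbind := law_bind (V := fun x h => L x h ++ R x h) (Set.disjoint_union_right.2 ⟨hST₁, hST₂⟩)
    hX hobs fun l => l.Nodup ∧ l.toFinset = A
  rw [hbind]
  set AL := A.filter (· ≤ off + l) with hAL
  set AR := A.filter (off + l < ·) with hAR
  have eN : off + l + (N - l) = off + N := by omega
  set cond : ℕ → Prop := fun x => x ≤ n ∧ AL ∈ (Finset.Ioc off (off + l)).powersetCard x ∧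
    AR ∈ (Finset.Ioc (off + l) (off + N)).powersetCard (n - x) with hcond
  have hterm : ∀ x, hashLaw {h | X h = x} *
      hashLaw {h | (L x h ++ R x h).Nodup ∧ (L x h ++ R x h).toFinset = A} =
      if cond x then ((N.choose n : ℕ) : ℝ≥0∞)⁻¹ else 0 := by
    intro x
    by_cases hx : hashLaw {h | X h = x} = 0
    · rw [hx, zero_mul, if_neg]
      rintro ⟨h1, h2, h3⟩
      have h4 := Finset.card_le_card (Finset.mem_powersetCard.1 h2).1
      rw [(Finset.mem_powersetCard.1 h2).2, Nat.card_Ioc] at h4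
      have h5 := Finset.card_le_card (Finset.mem_powersetCard.1 h3).1
      rw [(Finset.mem_powersetCard.1 h3).2, Nat.card_Ioc] at h5
      rw [hlaw, hyperLaw_eq hn, if_pos h1, ENNReal.div_eq_zero_iff, mul_eq_zero] at hx
      rcases hx with (hx | hx) | hx
      · exact choose_inv_ne (M := l) (m := x) (by omega) hx
      · exact choose_inv_ne (M := N - l) (m := n - x) (by omega) hx
      · exact ENNReal.natCast_ne_top _ hx
    · rw [hlaw] at hx ⊢
      obtain ⟨h1, h2, h3⟩ := hyperLaw_ne_zero hx
      have hLx := hL x h2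
      have hRx := hR x h3
      -- The event separates into a left and a right condition only almost surely, when both outputs
      -- stay in their own parts of the range.
      have e1 : hashLaw {h | (L x h ++ R x h).Nodup ∧ (L x h ++ R x h).toFinset = A} =
          hashLaw {h | ((L x h).Nodup ∧ (L x h).toFinset = AL) ∧
            ((R x h).Nodup ∧ (R x h).toFinset = AR)} := by
        refine measure_congr ?_
        filter_upwards [hLx.ae h2, hRx.ae h3] with h hh1 hh2
        refine propext (append_eq_iff (N := N) (Finset.mem_powersetCard.1 hh1.2).1 ?_)
        rw [← eN]
        exact (Finset.mem_powersetCard.1 hh2.2).1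
      rw [e1, Observable.indep hT hLx.obs hRx.obs (fun l => l.Nodup ∧ l.toFinset = AL)
        (fun l => l.Nodup ∧ l.toFinset = AR), hLx.law, hRx.law, eN, hyperLaw_eq hn, if_pos h1]
      have n1 := choose_inv_ne h2
      have n2 := choose_inv_ne h3
      by_cases c1 : AL ∈ (Finset.Ioc off (off + l)).powersetCard x
      · by_cases c2 : AR ∈ (Finset.Ioc (off + l) (off + N)).powersetCard (n - x)
        · rw [if_pos c1, if_pos c2, if_pos ⟨h1, c1, c2⟩, ENNReal.div_eq_inv_mul]
          calc _ = ((N.choose n : ℕ) : ℝ≥0∞)⁻¹ *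
                ((l.choose x : ℝ≥0∞) * (l.choose x : ℝ≥0∞)⁻¹) *
                (((N - l).choose (n - x) : ℝ≥0∞) * ((N - l).choose (n - x) : ℝ≥0∞)⁻¹) := by ring
            _ = _ := by
              rw [ENNReal.mul_inv_cancel n1 (ENNReal.natCast_ne_top _),
                ENNReal.mul_inv_cancel n2 (ENNReal.natCast_ne_top _), mul_one, mul_one]
        · rw [if_neg c2, if_neg (show ¬ cond x from fun hc => c2 hc.2.2)]; simp
      · rw [if_neg c1, if_neg (show ¬ cond x from fun hc => c1 hc.2.1)]; simp
  rw [tsum_congr hterm]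
  have hunion : AL ∪ AR = A := by
    ext x
    simp only [hAL, hAR, Finset.mem_filter, Finset.mem_union]
    have := le_or_gt x (off + l)
    tauto
  have hcard : AL.card + AR.card = A.card := by
    rw [← Finset.card_union_of_disjoint, hunion]
    rw [Finset.disjoint_left]
    intro x h1 h2
    exact absurd (Finset.mem_filter.1 h1).2 (not_le.2 (Finset.mem_filter.1 h2).2)
  by_cases hA : A ∈ (Finset.Ioc off (off + N)).powersetCard n
  · rw [if_pos hA]
    obtain ⟨hA1, hA2⟩ := Finset.mem_powersetCard.1 hA
    have hc : cond AL.card := by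
      refine ⟨by omega, Finset.mem_powersetCard.2 ⟨fun x hx => ?_, rfl⟩,
        Finset.mem_powersetCard.2 ⟨fun x hx => ?_, by omega⟩⟩
      · obtain ⟨h1, h2⟩ := Finset.mem_filter.1 hx
        exact Finset.mem_Ioc.2 ⟨(Finset.mem_Ioc.1 (hA1 h1)).1, h2⟩
      · obtain ⟨h1, h2⟩ := Finset.mem_filter.1 hx
        exact Finset.mem_Ioc.2 ⟨h2, (Finset.mem_Ioc.1 (hA1 h1)).2⟩
    rw [tsum_eq_single AL.card, if_pos hc]
    exact fun x hx => if_neg fun hcx => hx (Finset.mem_powersetCard.1 hcx.2.1).2.symm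
  · rw [if_neg hA]
    refine ENNReal.tsum_eq_zero.2 fun x => if_neg fun hc => hA ?_
    obtain ⟨h1, h2, h3⟩ := hc
    obtain ⟨h4, h5⟩ := Finset.mem_powersetCard.1 h2
    obtain ⟨h6, h7⟩ := Finset.mem_powersetCard.1 h3
    refine Finset.mem_powersetCard.2 ⟨?_, by omega⟩
    rw [← hunion]
    refine Finset.union_subset (h4.trans ?_) (h6.trans ?_)
    · exact Finset.Ioc_subset_Ioc le_rfl (by omega)
    · exact Finset.Ioc_subset_Ioc (by omega) le_rfl

/-! ## Local sources -/

@[simp] lemma bind_val {α β : Type} (x : Run α) (f : α → Run β) : (x >>= f).val = (f x.val).val := rfl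

@[simp] lemma bind_time {α β : Type} (x : Run α) (f : α → Run β) :
    (x >>= f).time = x.time + (f x.val).time := rfl

@[simp] lemma ops_val {α : Type} (k : ℕ) (a : α) : (ops k a).val = a := rfl

@[simp] lemma ops_time {α : Type} (k : ℕ) (a : α) : (ops k a).time = k := rfl

/-- The keys of the deviates of a local source. -/
def localKeys (e : List ℕ → Key) : Set Key := e '' {path | path ≠ []}

/-- The keys of the stream of a local source. -/
def streamKeys (e : List ℕ → Key) : Set Key := Set.range fun t => e [t]

section LocalKeys

variable {e : List ℕ → Key}

lemma injective_sub (he : Function.Injective e) (a : ℕ) :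
    Function.Injective fun path => e (a :: path) := fun _ _ h => (List.cons.inj (he h)).2

lemma injective_stream (he : Function.Injective e) : Function.Injective fun t => e [t] :=
  fun _ _ h => (List.cons.inj (he h)).1

lemma streamKeys_subset : streamKeys e ⊆ localKeys e := by
  rintro _ ⟨t, rfl⟩
  exact ⟨[t], by simp, rfl⟩

lemma localKeys_sub_subset (a : ℕ) : localKeys (fun path => e (a :: path)) ⊆ localKeys e := by
  rintro _ ⟨p, _, rfl⟩
  exact ⟨a :: p, by simp, rfl⟩

/-- Stream keys have paths of length one, those of a subsource have length at least two, because
`localKeys` omits the empty path. -/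
lemma disjoint_stream_sub (he : Function.Injective e) (a : ℕ) :
    Disjoint (streamKeys e) (localKeys fun path => e (a :: path)) := by
  rw [Set.disjoint_left]
  rintro _ ⟨t, rfl⟩ ⟨p, hp, h⟩
  exact hp (List.cons.inj (he h)).2

lemma disjoint_sub_sub (he : Function.Injective e) {a b : ℕ} (hab : a ≠ b) :
    Disjoint (localKeys fun path => e (a :: path)) (localKeys fun path => e (b :: path)) := by
  rw [Set.disjoint_left]
  rintro _ ⟨p, _, rfl⟩ ⟨p', _, h⟩
  exact hab (List.cons.inj (he h)).1.symm

end LocalKeys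

/-! ## Uniform deviates -/

lemma volume_coe_mem {s : Set ℝ} (hs : MeasurableSet s) :
    volume {u : I | (u : ℝ) ∈ s} = volume (s ∩ Set.Icc 0 1) := by
  have := unitInterval.measurePreserving_coe.measure_preimage hs.nullMeasurableSet
  rw [Measure.restrict_apply hs] at this
  exact this

lemma volume_coe_lt {c : ℝ} (hc : c ≤ 1) : volume {u : I | (u : ℝ) < c} = ENNReal.ofReal c := by
  have h := volume_coe_mem (measurableSet_Iio (a := c))
  have e : Set.Iio c ∩ Set.Icc (0 : ℝ) 1 = Set.Ico 0 c := by
    ext x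
    simp only [Set.mem_inter_iff, Set.mem_Iio, Set.mem_Icc, Set.mem_Ico]
    exact ⟨fun hx => ⟨hx.2.1, hx.1⟩, fun hx => ⟨hx.2, hx.1, by linarith [hx.2]⟩⟩
  rw [e, Real.volume_Ico, sub_zero] at h
  exact h

lemma volume_fin_one {Q : I → Prop} (hQ : MeasurableSet {v | Q v}) :
    volume {u : Fin 1 → I | Q (u 0)} = volume {v : I | Q v} :=
  (measurePreserving_eval (fun _ : Fin 1 => (volume : Measure I)) 0).measure_preimage
    hQ.nullMeasurableSet

lemma TrialLaw.of_tsum {d : ℕ} {trial : (Fin d → I) → Run (Option ℕ)} {P : ℕ → ℝ≥0∞} {a : ℕ}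
    {s : ℝ≥0∞} (time_le : ∀ u, (trial u).time ≤ a)
    (meas : ∀ x, MeasurableSet {u | (trial u).val = some x})
    (law : ∀ x, volume {u | (trial u).val = some x} = P x * s) (hP : ∑' x, P x = 1) :
    TrialLaw trial P a s := by
  refine ⟨time_le, meas, law, ?_⟩
  have : {u | (trial u).val.isSome = true} = ⋃ x, {u | (trial u).val = some x} := by
    ext u; simp [Option.isSome_iff_exists]
  rw [this, measure_iUnion _ meas, tsum_congr law, ENNReal.tsum_mul_right, hP, one_mul]
  intro x y hxy
  rw [Function.onFun, Set.disjoint_left]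
  intro u h1 h2
  exact hxy (Option.some.inj ((show _ = _ from h1).symm.trans h2))

/-! ## Algorithm H -/

/-- The contents of a hash table: distinct keys of `1..M`. -/
def IsTable (M : ℕ) (T : List ℕ) : Prop := T.Nodup ∧ T.toFinset ⊆ Finset.Ioc 0 M

/-- Distribution of the next key that Algorithm H inserts. -/
noncomputable def freshPMF (M : ℕ) (T : List ℕ) (x : ℕ) : ℝ≥0∞ :=
  if x ∈ Finset.Ioc 0 M \ T.toFinset then ((M - T.length : ℕ) : ℝ≥0∞)⁻¹ else 0

lemma IsTable.card_fresh {M : ℕ} {T : List ℕ} (hT : IsTable M T) :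
    (Finset.Ioc 0 M \ T.toFinset).card = M - T.length := by
  rw [Finset.card_sdiff_of_subset hT.2, List.toFinset_card_of_nodup hT.1, Nat.card_Ioc]
  rfl

lemma IsTable.cons {M : ℕ} {T : List ℕ} (hT : IsTable M T) {x : ℕ}
    (hx : x ∈ Finset.Ioc 0 M \ T.toFinset) : IsTable M (x :: T) := by
  obtain ⟨h1, h2⟩ := Finset.mem_sdiff.1 hx
  refine ⟨List.nodup_cons.2 ⟨by simpa using h2, hT.1⟩, ?_⟩
  rw [List.toFinset_cons]
  exact Finset.insert_subset h1 hT.2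

lemma tsum_freshPMF {M : ℕ} {T : List ℕ} (hT : IsTable M T) (h : T.length < M) :
    ∑' x, freshPMF M T x = 1 := by
  unfold freshPMF
  rw [tsum_eq_sum (s := Finset.Ioc 0 M \ T.toFinset) fun x hx => if_neg hx,
    Finset.sum_congr rfl fun x hx => if_pos hx, Finset.sum_const, hT.card_fresh, nsmul_eq_mul,
    ENNReal.mul_inv_cancel _ (ENNReal.natCast_ne_top _)]
  exact_mod_cast (by omega : M - T.length ≠ 0)

lemma hashTrial_val (cells M : ℕ) (T : List ℕ) (u : I) : (hashTrial cells M T u).val =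
    if min M (⌊(M : ℝ) * (u : ℝ)⌋₊ + 1) ∈ T then none
    else some (min M (⌊(M : ℝ) * (u : ℝ)⌋₊ + 1)) := by
  by_cases h : min M (⌊(M : ℝ) * (u : ℝ)⌋₊ + 1) ∈ T <;> simp [hashTrial, lookup, h]

/-- The event is the difference of two events `y < key`, each the complement of an interval. The
`min` matters only for the deviate `u = 1`. -/
lemma volume_bucket {M x : ℕ} (hx : x ∈ Finset.Ioc 0 M) :
    volume {u : I | min M (⌊(M : ℝ) * (u : ℝ)⌋₊ + 1) = x} = (M : ℝ≥0∞)⁻¹ := by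
  obtain ⟨h1, h2⟩ := Finset.mem_Ioc.1 hx
  have hM : (0 : ℝ) < M := by exact_mod_cast (by omega : 0 < M)
  have hle : ∀ y : ℕ, 1 ≤ y → y ≤ M → volume {u : I | y < min M (⌊(M : ℝ) * (u : ℝ)⌋₊ + 1)} =
      1 - ENNReal.ofReal ((y : ℝ) / M) := by
    intro y hy1 hy
    rcases eq_or_lt_of_le hy with rfl | hlt
    · rw [div_self hM.ne', ENNReal.ofReal_one, tsub_self]
      convert measure_empty (μ := (volume : Measure I)) using 2
      ext u; simp
    · have : {u : I | y < min M (⌊(M : ℝ) * (u : ℝ)⌋₊ + 1)} = {u : I | (u : ℝ) < (y : ℝ) / M}ᶜ := by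
        ext u
        simp only [Set.mem_ofPred_eq, lt_min_iff, Set.mem_compl_iff, not_lt]
        rw [div_le_iff₀ hM, mul_comm]
        constructor
        · rintro ⟨_, h⟩
          exact (Nat.le_floor_iff' (by omega)).1 (by omega)
        · intro h
          have := (Nat.le_floor_iff' (by omega)).2 h
          exact ⟨hlt, by omega⟩
      rw [this, prob_compl_eq_one_sub (measurableSet_lt measurable_subtype_coe measurable_const),
        volume_coe_lt ((div_le_one hM).2 (by exact_mod_cast hy))]
  have hle' : ∀ y : ℕ, y ≤ M → volume {u : I | y < min M (⌊(M : ℝ) * (u : ℝ)⌋₊ + 1)} =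
      1 - ENNReal.ofReal ((y : ℝ) / M) := by
    intro y hy
    rcases Nat.eq_zero_or_pos y with rfl | hy0
    · have : {u : I | 0 < min M (⌊(M : ℝ) * (u : ℝ)⌋₊ + 1)} = Set.univ := by
        ext u
        simp only [Set.mem_ofPred_eq, lt_min_iff, Set.mem_univ, iff_true]
        exact ⟨by omega, by omega⟩
      rw [this]; simp
    · exact hle y hy0 hy
  have hmeas : ∀ y : ℕ, MeasurableSet {u : I | y < min M (⌊(M : ℝ) * (u : ℝ)⌋₊ + 1)} := by
    intro y
    refine measurableSet_lt measurable_const ?_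
    fun_prop
  have hd : {u : I | min M (⌊(M : ℝ) * (u : ℝ)⌋₊ + 1) = x} =
      {u : I | x - 1 < min M (⌊(M : ℝ) * (u : ℝ)⌋₊ + 1)} \
        {u : I | x < min M (⌊(M : ℝ) * (u : ℝ)⌋₊ + 1)} := by
    ext u
    simp only [Set.mem_ofPred_eq, Set.mem_sdiff]
    omega
  rw [hd, measure_sdiff _ (hmeas x).nullMeasurableSet (measure_ne_top _ _), hle' _ h2,
    hle' _ (by omega)]
  · rw [← ENNReal.ofReal_one, ← ENNReal.ofReal_sub _ (by positivity),
      ← ENNReal.ofReal_sub _ (by positivity), ← ENNReal.ofReal_sub _ ?_,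
      ← ENNReal.ofReal_natCast, ← ENNReal.ofReal_inv_of_pos hM]
    · congr 1
      rw [Nat.cast_sub (by omega : 1 ≤ x)]
      field_simp
      push_cast
      ring
    · rw [sub_nonneg, div_le_one hM]
      exact_mod_cast h2
  · intro u hu
    simp only [Set.mem_ofPred_eq] at hu ⊢
    omega

/-- The length of the chains in a hash table. -/
def ChainBound (cells M t b : ℕ) : Prop := ∀ T : List ℕ, IsTable M T → T.length ≤ t →
  ∀ x ∈ Finset.Ioc 0 M, (T.filter fun y => cell cells M y = cell cells M x).length ≤ b

/-- This crude bound is enough in the base case of Algorithm R, where a table holds fewer than `n₀`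
keys however few cells there are. -/
lemma chainBound_length (cells M t : ℕ) : ChainBound cells M t t := fun _ _ h _ _ =>
  (List.length_filter_le _ _).trans h

/-- With `M` cells the key `y` has cell `y - 1`: there are no collisions. -/
lemma chainBound_injective (M t : ℕ) : ChainBound M M t 1 := by
  intro T hT _ x hx
  have hx' := Finset.mem_Ioc.1 hx
  have hcell : ∀ y, cell M M y = y - 1 := fun y => Nat.mul_div_cancel _ (by omega)
  have hsub : (T.filter fun y => cell M M y = cell M M x).toFinset ⊆ {x} := by
    intro y hy
    simp only [List.mem_toFinset, List.mem_filter, hcell, decide_eq_true_eq] at hy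
    have := Finset.mem_Ioc.1 (hT.2 (List.mem_toFinset.2 hy.1))
    exact Finset.mem_singleton.2 (by omega)
  have := Finset.card_le_card hsub
  rwa [List.toFinset_card_of_nodup (hT.1.filter _), Finset.card_singleton] at this

lemma hashTrial_law {cells M b : ℕ} {T : List ℕ} (hT : IsTable M T) (hlt : T.length < M)
    (hb : ∀ x ∈ Finset.Ioc 0 M, (T.filter fun y => cell cells M y = cell cells M x).length ≤ b) :
    TrialLaw (fun u : Fin 1 → I => hashTrial cells M T (u 0)) (freshPMF M T) (9 + 2 * b)
      (((M - T.length : ℕ) : ℝ≥0∞) * (M : ℝ≥0∞)⁻¹) := by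
  have hmin : ∀ u : I, min M (⌊(M : ℝ) * (u : ℝ)⌋₊ + 1) ∈ Finset.Ioc 0 M := fun u =>
    Finset.mem_Ioc.2 ⟨lt_min (by omega) (by omega), min_le_left _ _⟩
  have hset : ∀ x, {u : I | (hashTrial cells M T u).val = some x} =
      if x ∈ Finset.Ioc 0 M \ T.toFinset then
        {u : I | min M (⌊(M : ℝ) * (u : ℝ)⌋₊ + 1) = x} else ∅ := by
    intro x
    ext u
    rw [Set.mem_ofPred_eq, hashTrial_val]
    have hu := hmin u
    split_ifs with h1 h2 h2
    · simp only [Set.mem_ofPred_eq, false_iff]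
      rintro rfl
      exact (Finset.mem_sdiff.1 h2).2 (List.mem_toFinset.2 h1)
    · simp
    · simp
    · simp only [Option.some.injEq, Set.mem_empty_iff_false, iff_false]
      rintro rfl
      exact h2 (Finset.mem_sdiff.2 ⟨hu, fun h => h1 (List.mem_toFinset.1 h)⟩)
  have hmeas : ∀ x, MeasurableSet {u : I | (hashTrial cells M T u).val = some x} := by
    intro x
    rw [hset]
    split_ifs
    · refine measurableSet_eq_fun ?_ measurable_const
      fun_prop
    · exact MeasurableSet.empty
  refine TrialLaw.of_tsum (fun u => ?_) (fun x => ?_) (fun x => ?_) (tsum_freshPMF hT hlt)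
  · have := hb _ (hmin (u 0))
    change ((5 : ℕ) : ℕ∞) + (((3 + 2 * (T.filter fun y => cell cells M y =
      cell cells M (min M (⌊(M : ℝ) * (u 0 : ℝ)⌋₊ + 1))).length : ℕ) : ℕ∞) + (1 : ℕ)) ≤ _
    norm_cast
    omega
  · exact (measurable_pi_apply (X := fun _ : Fin 1 => I) 0) (hmeas x)
  · rw [volume_fin_one (hmeas x), hset, freshPMF]
    split_ifs with hx
    · rw [volume_bucket (Finset.mem_sdiff.1 hx).1, ← mul_assoc, ENNReal.inv_mul_cancel _
        (ENNReal.natCast_ne_top _), one_mul]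
      exact_mod_cast (by omega : M - T.length ≠ 0)
    · simp

/-! ### Algorithm H: drawing fresh keys -/

section HashInsert

variable {cells M : ℕ} {e : List ℕ → Key}

lemma hashInsert_step_deviate {T : List ℕ} (hT : IsTable M T) (hlt : T.length < M)
    (he : Function.Injective e) :
    Deviate (streamKeys e)
      (fun h => retry fun t => hashTrial cells M T (Source.stream (fun p => h (e p)) t))
      (freshPMF M T) := by
  have H := hashTrial_law hT hlt (cells := cells) (chainBound_length cells M _ T hT le_rfl)
  have hpos : 0 < (((M - T.length : ℕ) : ℝ≥0∞) * (M : ℝ≥0∞)⁻¹) :=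
    ENNReal.mul_pos (by exact_mod_cast (by omega : M - T.length ≠ 0)) (by simp)
  have := retry_deviate H (injective_stream he) hpos (S := streamKeys e) fun i => ⟨i, rfl⟩
  simpa only [Source.stream, one_mul, Fin.val_zero, add_zero] using this

/-- The table never holds more than half of the universe, so a fresh key is found with probability
at least 1/2. The complement variant of Algorithm H exists to ensure this. -/
lemma hashInsert_step_cost {t b : ℕ} (hb : ChainBound cells M t b) {T : List ℕ} (hT : IsTable M T)
    (hlt : 2 * (T.length + 1) ≤ M) (hle : T.length ≤ t) (he : Function.Injective e) {w : ℝ≥0∞}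
    (hw : 1 ≤ w) (hw' : (1 - 2⁻¹) * w ^ (9 + 2 * b) < 1) :
    JointCost w (streamKeys e)
      (fun h => retry fun t => hashTrial cells M T (Source.stream (fun p => h (e p)) t))
      (retryFactor 2⁻¹ (w ^ (9 + 2 * b))) := by
  have H := hashTrial_law hT (by omega) (cells := cells) (hb T hT hle)
  have hq : (2⁻¹ : ℝ≥0∞) ≤ ((M - T.length : ℕ) : ℝ≥0∞) * (M : ℝ≥0∞)⁻¹ := by
    have hM : (M : ℝ≥0∞) ≠ 0 := by exact_mod_cast (by omega : M ≠ 0)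
    rw [← div_eq_mul_inv, ENNReal.le_div_iff_mul_le (Or.inl hM) (Or.inl (ENNReal.natCast_ne_top _)),
      mul_comm, ← div_eq_mul_inv, ENNReal.div_le_iff_le_mul (Or.inl (by simp)) (Or.inl (by simp))]
    exact_mod_cast (by omega : M ≤ (M - T.length) * 2)
  have := retry_jointCost H (injective_stream he) (by simp) hq hw hw' (S := streamKeys e)
    fun i => ⟨i, rfl⟩
  simpa only [Source.stream, one_mul, Fin.val_zero, add_zero] using this

/-- Any of the `k + 1` missing keys may be drawn first, each with probability `1 / (n + 1)`; this is
the induction step of `hashInsert_obs_law`. -/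
lemma choose_succ_inv {n k : ℕ} : ((k + 1 : ℕ) : ℝ≥0∞) *
    (((n + 1 : ℕ) : ℝ≥0∞)⁻¹ * ((n.choose k : ℕ) : ℝ≥0∞)⁻¹) =
      (((n + 1).choose (k + 1) : ℕ) : ℝ≥0∞)⁻¹ := by
  have h := Nat.add_one_mul_choose_eq n k
  have hk : ((k + 1 : ℕ) : ℝ≥0∞) ≠ 0 := by exact_mod_cast Nat.succ_ne_zero k
  have hn : ((n + 1 : ℕ) : ℝ≥0∞) ≠ 0 := by exact_mod_cast Nat.succ_ne_zero n
  rw [← ENNReal.mul_inv (Or.inl hn) (Or.inl (ENNReal.natCast_ne_top _)), ← Nat.cast_mul, h,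
    Nat.cast_mul, ENNReal.mul_inv (Or.inr (ENNReal.natCast_ne_top _)) (Or.inr hk), mul_comm,
    mul_assoc, ENNReal.inv_mul_cancel hk (ENNReal.natCast_ne_top _), mul_one]

lemma hashInsert_succ (m : ℕ) (T : List ℕ) (s : Source) : hashInsert cells M (m + 1) T s =
    (retry fun t => hashTrial cells M T (s.stream t)) >>= fun x =>
      ops 4 (x :: T) >>= fun T' => hashInsert cells M m T' (s.sub 1) := rfl

/-- The induction needs an arbitrary initial table `T`: the final set is then uniform among the
supersets of `T` of the right size. -/
lemma hashInsert_obs_law (m : ℕ) : ∀ (T : List ℕ) (e : List ℕ → Key), Function.Injective e →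
    IsTable M T → T.length + m ≤ M →
    Observable (localKeys e) (fun h => (hashInsert cells M m T fun p => h (e p)).val) ∧
    ∀ A : Finset ℕ, hashLaw {h | (hashInsert cells M m T fun p => h (e p)).val.Nodup ∧
        (hashInsert cells M m T fun p => h (e p)).val.toFinset = A} =
      if T.toFinset ⊆ A ∧ A ∈ (Finset.Ioc 0 M).powersetCard (T.length + m) then
        (((M - T.length).choose m : ℕ) : ℝ≥0∞)⁻¹ else 0 := by
  induction m with
  | zero =>
    intro T e he hT hm
    refine ⟨observable_const T, fun A => ?_⟩
    simp only [hashInsert, ops_val, hT.1, true_and, add_zero, Nat.choose_zero_right, Nat.cast_one,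
      inv_one]
    by_cases hA : T.toFinset = A
    · subst hA
      rw [if_pos ⟨le_rfl, Finset.mem_powersetCard.2 ⟨hT.2, List.toFinset_card_of_nodup hT.1⟩⟩]
      simp
    · rw [if_neg]
      · simp [hA]
      · rintro ⟨h1, h2⟩
        refine hA (Finset.eq_of_subset_of_card_le h1 ?_)
        rw [(Finset.mem_powersetCard.1 h2).2, List.toFinset_card_of_nodup hT.1]
  | succ m ih =>
    intro T e he hT hm
    have hD := hashInsert_step_deviate (cells := cells) hT (by omega) he
    have hpos : ∀ x, hashLaw {h | (retry fun t => hashTrial cells M T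
        (Source.stream (fun p => h (e p)) t)).val = x} ≠ 0 →
        x ∈ Finset.Ioc 0 M \ T.toFinset := by
      intro x hx
      rw [hD.law, freshPMF] at hx
      by_contra hcon
      exact hx (if_neg hcon)
    have hI : ∀ x, x ∈ Finset.Ioc 0 M \ T.toFinset → _ := fun x hx =>
      ih (x :: T) (fun p => e (1 :: p)) (injective_sub he 1) (hT.cons hx)
        (by simp only [List.length_cons]; omega)
    have hval : ∀ h : Key → I, (hashInsert cells M (m + 1) T fun p => h (e p)).val =
        (fun x (h : Key → I) => (hashInsert cells M m (x :: T) fun p => h (e (1 :: p))).val)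
          (retry fun t => hashTrial cells M T (Source.stream (fun p => h (e p)) t)).val h := by
      intro h
      rw [hashInsert_succ]
      rfl
    simp_rw [hval]
    refine ⟨Observable.bind (V := fun x h => (hashInsert cells M m (x :: T)
      fun p => h (e (1 :: p))).val) (hD.obs.mono streamKeys_subset)
      fun x hx => (hI x (hpos x hx)).1.mono (localKeys_sub_subset 1), fun A => ?_⟩
    have := law_bind (V := fun x h => (hashInsert cells M m (x :: T) fun p => h (e (1 :: p))).val)
      (disjoint_stream_sub he 1) hD.obs (fun x hx => (hI x (hpos x hx)).1)
      fun l => l.Nodup ∧ l.toFinset = A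
    rw [this]
    have hterm : ∀ x, hashLaw {h | (retry fun t => hashTrial cells M T
        (Source.stream (fun p => h (e p)) t)).val = x} *
        hashLaw {h | (hashInsert cells M m (x :: T) fun p => h (e (1 :: p))).val.Nodup ∧
        (hashInsert cells M m (x :: T) fun p => h (e (1 :: p))).val.toFinset = A} =
        if x ∈ A \ T.toFinset then (if T.toFinset ⊆ A ∧
          A ∈ (Finset.Ioc 0 M).powersetCard (T.length + (m + 1)) then
          ((M - T.length : ℕ) : ℝ≥0∞)⁻¹ * (((M - (T.length + 1)).choose m : ℕ) : ℝ≥0∞)⁻¹ else 0)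
        else 0 := by
      intro x
      rw [hD.law, freshPMF]
      by_cases hx : x ∈ Finset.Ioc 0 M \ T.toFinset
      · obtain ⟨hx1, hx2⟩ := Finset.mem_sdiff.1 hx
        rw [if_pos hx, (hI x hx).2, List.length_cons, List.toFinset_cons,
          mul_ite, mul_zero, show T.length + 1 + m = T.length + (m + 1) by ring]
        by_cases hxA : x ∈ A <;>
          simp [hxA, (by simpa using hx2 : x ∉ T), Finset.insert_subset_iff]
      · rw [if_neg hx, zero_mul]
        split_ifs with h1 h2
        · exact absurd (Finset.mem_sdiff.2 ⟨(Finset.mem_powersetCard.1 h2.2).1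
            (Finset.mem_sdiff.1 h1).1, (Finset.mem_sdiff.1 h1).2⟩) hx
        · rfl
        · rfl
    rw [tsum_congr hterm, tsum_eq_sum (s := A \ T.toFinset) fun x hx => if_neg hx,
      Finset.sum_congr rfl fun x hx => if_pos hx, Finset.sum_const]
    split_ifs with hA
    · rw [Finset.card_sdiff_of_subset hA.1, (Finset.mem_powersetCard.1 hA.2).2,
        List.toFinset_card_of_nodup hT.1, nsmul_eq_mul, add_tsub_cancel_left]
      have e1 : M - T.length = (M - (T.length + 1)) + 1 := by omega
      rw [e1]
      exact choose_succ_inv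
    · simp

lemma isTable_nil : IsTable M [] := ⟨List.nodup_nil, by simp⟩

lemma hashInsert_samples (he : Function.Injective e) {m : ℕ} (hm : m ≤ M) :
    Samples (localKeys e) (fun h => (hashInsert cells M m [] fun p => h (e p)).val) 0 M m := by
  obtain ⟨h1, h2⟩ := hashInsert_obs_law (cells := cells) m [] e he (isTable_nil (M := M))
    (by simpa using hm)
  refine ⟨h1, fun A => ?_⟩
  rw [h2]
  simp

lemma hashInsert_cost {t b : ℕ} (hb : ChainBound cells M t b) {w : ℝ≥0∞}
    (hw : 1 ≤ w) (hw' : (1 - 2⁻¹) * w ^ (9 + 2 * b) < 1) (m : ℕ) :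
    ∀ (T : List ℕ) (e : List ℕ → Key), Function.Injective e → IsTable M T → T.length + m ≤ t →
      2 * (T.length + m) ≤ M →
      Cost w (localKeys e) (fun h => hashInsert cells M m T fun p => h (e p))
        ((retryFactor 2⁻¹ (w ^ (9 + 2 * b)) * w ^ 4) ^ m * w) := by
  induction m with
  | zero =>
    intro T e _ _ _ _
    have := cost_of_time_le (S := localKeys e) hw (c := 1) (R := fun h => hashInsert cells M 0 T
      fun p => h (e p)) (Filter.Eventually.of_forall fun h => le_rfl)
    simpa using this
  | succ m ih =>
    intro T e he hT ht hM
    have hD := hashInsert_step_deviate (cells := cells) hT (by omega) he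
    have hJ := hashInsert_step_cost hb hT (by omega) (by omega) he hw hw'
    have hC : ∀ x, hashLaw {h | (retry fun t => hashTrial cells M T
        (Source.stream (fun p => h (e p)) t)).val = x} ≠ 0 →
        Cost w (localKeys fun p => e (1 :: p)) (fun h => ops 4 (x :: T) >>= fun T' =>
          hashInsert cells M m T' fun p => h (e (1 :: p)))
          ((retryFactor 2⁻¹ (w ^ (9 + 2 * b)) * w ^ 4) ^ m * w * w ^ 4) := by
      intro x hx
      rw [hD.law, freshPMF] at hx
      have hx' : x ∈ Finset.Ioc 0 M \ T.toFinset := by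
        by_contra hcon
        exact hx (if_neg hcon)
      refine Cost.time_add hw (ih (x :: T) _ (injective_sub he 1) (hT.cons hx') ?_ ?_)
        (Filter.Eventually.of_forall fun h => ?_)
      · simp only [List.length_cons]; omega
      · simp only [List.length_cons]; omega
      · simp [add_comm]
    have := Cost.bind hw (disjoint_stream_sub he 1) hD.obs hJ hC
    refine (this.mono (Set.union_subset streamKeys_subset (localKeys_sub_subset 1)) ?_)
    rw [ENNReal.tsum_mul_right, hD.obs.tsum_law, one_mul]
    refine le_of_eq ?_
    ring

end HashInsert

/-! ### Algorithm H: passing to the complement -/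

section HashComplement

variable {cells M : ℕ}

lemma hashComplement_val (T : List ℕ) (k : ℕ) : (hashComplement cells M T k).val.Nodup ∧
    (hashComplement cells M T k).val.toFinset = Finset.Ioc 0 k \ T.toFinset := by
  induction k with
  | zero => simp [hashComplement]
  | succ k ih =>
    have hI : Finset.Ioc 0 (k + 1) = insert (k + 1) (Finset.Ioc 0 k) := by
      ext x; simp only [Finset.mem_Ioc, Finset.mem_insert]; omega
    have hnot : k + 1 ∉ (hashComplement cells M T k).val := by
      rw [← List.mem_toFinset, ih.2]
      simp
    by_cases h : k + 1 ∈ T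
    · have e : (hashComplement cells M T (k + 1)).val = (hashComplement cells M T k).val := by
        simp [hashComplement, lookup, h]
      rw [e, hI, Finset.insert_sdiff_of_mem _ (by simpa using h)]
      exact ih
    · have e : (hashComplement cells M T (k + 1)).val =
          (k + 1) :: (hashComplement cells M T k).val := by
        simp [hashComplement, lookup, h]
      rw [e, hI, Finset.insert_sdiff_of_notMem _ (by simpa using h), List.toFinset_cons, ih.2]
      exact ⟨List.nodup_cons.2 ⟨hnot, ih.1⟩, rfl⟩

lemma hashComplement_time {b : ℕ} {T : List ℕ}
    (hb : ∀ x ∈ Finset.Ioc 0 M, (T.filter fun y => cell cells M y = cell cells M x).length ≤ b)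
    (k : ℕ) (hk : k ≤ M) : (hashComplement cells M T k).time ≤ ((6 + 2 * b) * k + 1 : ℕ) := by
  induction k with
  | zero => simp [hashComplement]
  | succ k ih =>
    have h1 := hb (k + 1) (Finset.mem_Ioc.2 ⟨by omega, hk⟩)
    have h2 := ih (by omega)
    change ((3 + 2 * _ : ℕ) : ℕ∞) + ((hashComplement cells M T k).time + (3 : ℕ)) ≤ _
    calc _ ≤ ((3 + 2 * b : ℕ) : ℕ∞) + ((((6 + 2 * b) * k + 1 : ℕ) : ℕ∞) + (3 : ℕ)) := by
          gcongr
      _ = _ := by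
          rw [← Nat.cast_add, ← Nat.cast_add]
          congr 1
          ring

/-- Complementation is a bijection between the sets of size `M - m` and those of size `m`, and the
two binomial coefficients agree. -/
lemma Samples.complement {S : Set Key} {V : (Key → I) → List ℕ} {m : ℕ} (hm : m ≤ M)
    (H : Samples S V 0 M (M - m)) :
    Samples S (fun h => (hashComplement cells M (V h) M).val) 0 M m := by
  refine ⟨H.obs.comp fun T => (hashComplement cells M T M).val, fun A => ?_⟩
  simp only [(hashComplement_val _ _).1, true_and, (hashComplement_val _ _).2, zero_add]
  by_cases hA : A ⊆ Finset.Ioc 0 M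
  · have h1 := H.law (Finset.Ioc 0 M \ A)
    have hc : (Finset.Ioc 0 M \ A).card = M - A.card := by
      rw [Finset.card_sdiff_of_subset hA, Nat.card_Ioc, Nat.sub_zero]
    have hcA := Finset.card_le_card hA
    rw [Nat.card_Ioc] at hcA
    have h2 : (Finset.Ioc 0 M \ A ∈ (Finset.Ioc 0 (0 + M)).powersetCard (M - m)) ↔
        A ∈ (Finset.Ioc 0 M).powersetCard m := by
      rw [Finset.mem_powersetCard, Finset.mem_powersetCard, hc, zero_add]
      simp only [Finset.sdiff_subset, true_and, hA]
      omega
    simp only [h2, Nat.choose_symm hm] at h1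
    rw [← h1]
    refine measure_congr ?_
    filter_upwards [H.ae (Nat.sub_le M m)] with h hh
    have hsub := (Finset.mem_powersetCard.1 hh.2).1
    rw [zero_add] at hsub
    refine propext ⟨fun h3 => ⟨hh.1, ?_⟩, fun h3 => ?_⟩
    · rw [← show _ = A from h3, Finset.sdiff_sdiff_eq_self hsub]
    · change Finset.Ioc 0 M \ (V h).toFinset = A
      rw [show (V h).toFinset = _ from h3.2, Finset.sdiff_sdiff_eq_self hA]
  · rw [if_neg fun h => hA (Finset.mem_powersetCard.1 h).1]
    convert measure_empty (μ := hashLaw) using 2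
    ext h
    simp only [Set.mem_ofPred_eq, Set.mem_empty_iff_false, iff_false]
    rintro rfl
    exact hA Finset.sdiff_subset

end HashComplement

/-! ### Algorithm H: law and cost -/

section AlgH

variable {e : List ℕ → Key}

lemma algH_of_le {cells m M off : ℕ} (h : 2 * m ≤ M) (s : Source) : algH cells m M off s =
    hashInsert cells M m [] s >>= fun T => ops (4 + 2 * T.length) (T.map fun x => off + x) := by
  unfold algH
  rw [if_pos h]

lemma algH_of_lt {cells m M off : ℕ} (h : ¬ 2 * m ≤ M) (s : Source) : algH cells m M off s =
    (hashInsert cells M (M - m) [] s >>= fun T => hashComplement cells M T M) >>= fun T =>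
      ops (4 + 2 * T.length) (T.map fun x => off + x) := by
  unfold algH
  rw [if_neg h]

lemma algH_samples {cells m M : ℕ} (off : ℕ) (hm : m ≤ M) (he : Function.Injective e) :
    Samples (localKeys e) (fun h => (algH cells m M off fun p => h (e p)).val) off M m := by
  by_cases h : 2 * m ≤ M
  · simp only [algH_of_le h]
    exact (hashInsert_samples he hm).map_add hm off
  · simp only [algH_of_lt h]
    exact ((hashInsert_samples he (Nat.sub_le M m)).complement hm).map_add hm off

lemma algH_cost {cells m M b : ℕ} (off : ℕ) (hm : m ≤ M) (he : Function.Injective e)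
    (hb : ChainBound cells M m b) {w : ℝ≥0∞} (hw : 1 ≤ w)
    (hw' : (1 - 2⁻¹) * w ^ (9 + 2 * b) < 1) :
    Cost w (localKeys e) (fun h => algH cells m M off fun p => h (e p))
      ((retryFactor 2⁻¹ (w ^ (9 + 2 * b)) * w ^ (18 + 4 * b)) ^ (m + 1)) := by
  set g := retryFactor 2⁻¹ (w ^ (9 + 2 * b)) with hg
  have hg1 : 1 ≤ g := by rw [hg, retryFactor]; exact le_self_add
  by_cases h : 2 * m ≤ M
  · have h1 := hashInsert_cost hb hw hw' m [] e he isTable_nil (by simp) (by simpa using h)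
    have h2 : ∀ᵐ x ∂hashLaw, (algH cells m M off fun p => x (e p)).time ≤
        (hashInsert cells M m [] fun p => x (e p)).time + (4 + 2 * m : ℕ) := by
      filter_upwards [(hashInsert_samples (cells := cells) he hm).ae hm] with x hx
      rw [algH_of_le h, bind_time, ops_time]
      have : (hashInsert cells M m [] fun p => x (e p)).val.length = m := by
        rw [← List.toFinset_card_of_nodup hx.1]
        exact (Finset.mem_powersetCard.1 hx.2).2
      rw [this]
    refine (Cost.time_add hw h1 h2).mono le_rfl ?_
    calc (g * w ^ 4) ^ m * w * w ^ (4 + 2 * m) = g ^ m * w ^ (6 * m + 5) := by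
          rw [mul_pow]; ring
      _ ≤ g ^ (m + 1) * w ^ ((18 + 4 * b) * (m + 1)) := by
          refine mul_le_mul' (pow_le_pow_right₀ hg1 (by omega)) (pow_le_pow_right₀ hw ?_)
          nlinarith
      _ = _ := by rw [mul_pow, ← pow_mul]
  · have h1 := hashInsert_cost hb hw hw' (M - m) [] e he isTable_nil
      (by simp only [List.length_nil]; omega) (by simp only [List.length_nil]; omega)
    have hs := hashInsert_samples (cells := cells) he (Nat.sub_le M m)
    have h2 : ∀ᵐ x ∂hashLaw, (algH cells m M off fun p => x (e p)).time ≤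
        (hashInsert cells M (M - m) [] fun p => x (e p)).time +
          ((6 + 2 * b) * M + 1 + (4 + 2 * m) : ℕ) := by
      filter_upwards [hs.ae (Nat.sub_le M m), (hs.complement (cells := cells) hm).ae hm] with x hx hx'
      rw [algH_of_lt h, bind_time, ops_time, bind_time, bind_val]
      have h3 : (hashComplement cells M (hashInsert cells M (M - m) [] fun p => x (e p)).val
          M).val.length = m := by
        rw [← List.toFinset_card_of_nodup hx'.1]
        exact (Finset.mem_powersetCard.1 hx'.2).2
      have h4 : (hashInsert cells M (M - m) [] fun p => x (e p)).val.length = M - m := by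
        rw [← List.toFinset_card_of_nodup hx.1]
        exact (Finset.mem_powersetCard.1 hx.2).2
      have h5 := hashComplement_time (cells := cells) (hb _ ⟨hx.1, by
        simpa using (Finset.mem_powersetCard.1 hx.2).1⟩ (by omega)) M le_rfl
      rw [h3, add_assoc, Nat.cast_add ((6 + 2 * b) * M + 1)]
      exact add_le_add le_rfl (add_le_add h5 le_rfl)
    refine (Cost.time_add hw h1 h2).mono le_rfl ?_
    -- In this branch `M < 2 * m`, so the scan of the whole universe is still linear in `m`.
    calc (g * w ^ 4) ^ (M - m) * w * w ^ ((6 + 2 * b) * M + 1 + (4 + 2 * m))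
        = g ^ (M - m) * w ^ (4 * (M - m) + 1 + ((6 + 2 * b) * M + 1 + (4 + 2 * m))) := by
          rw [mul_pow]; ring
      _ ≤ g ^ (m + 1) * w ^ ((18 + 4 * b) * (m + 1)) := by
          refine mul_le_mul' (pow_le_pow_right₀ hg1 (by omega)) (pow_le_pow_right₀ hw ?_)
          have e1 : (6 + 2 * b) * M ≤ (6 + 2 * b) * (2 * m) := Nat.mul_le_mul_left _ (by omega)
          have e2 : M - m ≤ m := by omega
          nlinarith
      _ = _ := by rw [mul_pow, ← pow_mul]

end AlgH

@[simp] lemma ops_bind_val {α β : Type} (k : ℕ) (a : α) (f : α → Run β) :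
    (ops k a >>= f).val = (f a).val := rfl

@[simp] lemma ops_bind_time {α β : Type} (k : ℕ) (a : α) (f : α → Run β) :
    (ops k a >>= f).time = k + (f a).time := rfl

/-! ## Method A -/

/-- The running quotient is kept equal to `(top + m choose m + 1) / D`: one step of the loop
multiplies it by `top / (top + m)`, taken after `top` has decreased and with the matching `M - 1`
below. With `D = M choose (m + 1)` these are the tail probabilities of the gap, so the loop inverts
the distribution function. -/
lemma lt_skipScan_iff {v D : ℝ} (hv : 0 ≤ v) (hD : 0 < D) (m top : ℕ) : ∀ k : ℕ,
    k < (skipScan v top (top + m + 1) (((top + m).choose (m + 1) : ℝ) / D)).val ↔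
      v < ((top + m - k).choose (m + 1) : ℝ) / D := by
  induction top with
  | zero =>
    intro k
    have : (0 + m - k).choose (m + 1) = 0 := Nat.choose_eq_zero_of_lt (by omega)
    rw [this]
    simp [skipScan, hv]
  | succ top ih =>
    intro k
    by_cases h : v < ((top + 1 + m).choose (m + 1) : ℝ) / D
    · have hq : ((top + 1 + m).choose (m + 1) : ℝ) / D * (top : ℝ) / ((top + 1 + m + 1 - 1 : ℕ) : ℝ) =
          ((top + m).choose (m + 1) : ℝ) / D := by
        have h1 := Nat.choose_mul_succ_eq (top + m) (m + 1)
        rw [show top + m + 1 - (m + 1) = top by omega] at h1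
        have h2 : ((top + m).choose (m + 1) : ℝ) * ((top + m + 1 : ℕ) : ℝ) =
          ((top + m + 1).choose (m + 1) : ℝ) * (top : ℝ) := by exact_mod_cast h1
        have h3 : ((top + m + 1 : ℕ) : ℝ) ≠ 0 := by positivity
        rw [show top + 1 + m + 1 - 1 = top + m + 1 by omega, show top + 1 + m = top + m + 1 by omega]
        rw [div_mul_eq_mul_div, ← h2]
        field_simp
      have hval : (skipScan v (top + 1) (top + 1 + m + 1)
          (((top + 1 + m).choose (m + 1) : ℝ) / D)).val =
          (skipScan v top (top + m + 1) (((top + m).choose (m + 1) : ℝ) / D)).val + 1 := by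
        rw [skipScan, if_pos h, hq, show top + 1 + m + 1 - 1 = top + m + 1 by omega]
        rfl
      rw [hval]
      cases k with
      | zero => simpa using h
      | succ k =>
        rw [Nat.add_lt_add_iff_right, ih k, show top + 1 + m - (k + 1) = top + m - k by omega]
    · have hval : (skipScan v (top + 1) (top + 1 + m + 1)
          (((top + 1 + m).choose (m + 1) : ℝ) / D)).val = 0 := by
        rw [skipScan, if_neg h]; rfl
      rw [hval]
      simp only [not_lt_zero, false_iff, not_lt]
      refine le_trans ?_ (not_lt.1 h)
      gcongr
      omega

lemma lt_skipScan_initial_iff {v : ℝ} (hv : 0 ≤ v) {m M : ℕ} (hm : m + 1 ≤ M) (k : ℕ) :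
    k < (skipScan v (M - (m + 1)) M (((M - (m + 1) : ℕ) : ℝ) / (M : ℝ))).val ↔
      v < ((M - (k + 1)).choose (m + 1) : ℝ) / (M.choose (m + 1) : ℝ) := by
  obtain ⟨top, rfl⟩ : ∃ top, M = top + m + 1 := ⟨M - (m + 1), by omega⟩
  have hD : (0 : ℝ) < ((top + m + 1).choose (m + 1) : ℝ) := by
    exact_mod_cast Nat.choose_pos hm
  have hq : (top : ℝ) / ((top + m + 1 : ℕ) : ℝ) =
      ((top + m).choose (m + 1) : ℝ) / ((top + m + 1).choose (m + 1) : ℝ) := by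
    have h1 := Nat.choose_mul_succ_eq (top + m) (m + 1)
    rw [show top + m + 1 - (m + 1) = top by omega] at h1
    have h2 : ((top + m).choose (m + 1) : ℝ) * ((top + m + 1 : ℕ) : ℝ) =
      ((top + m + 1).choose (m + 1) : ℝ) * (top : ℝ) := by exact_mod_cast h1
    rw [div_eq_div_iff (by positivity) hD.ne']
    linarith
  rw [show top + m + 1 - (m + 1) = top by omega, hq, lt_skipScan_iff hv hD,
    show top + m + 1 - (k + 1) = top + m - k by omega]

lemma skipScan_val_le (v : ℝ) (top : ℕ) : ∀ M quot, (skipScan v top M quot).val ≤ top := by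
  induction top with
  | zero => intro M quot; simp [skipScan]
  | succ top ih =>
    intro M quot
    rw [skipScan]
    split_ifs
    · exact Nat.succ_le_succ (ih _ _)
    · simp

lemma skipScan_time (v : ℝ) (top : ℕ) : ∀ M quot, (skipScan v top M quot).time ≤
    (7 * (skipScan v top M quot).val + 1 : ℕ) := by
  induction top with
  | zero => intro M quot; simp [skipScan]
  | succ top ih =>
    intro M quot
    rw [skipScan]
    split_ifs
    · rw [bind_time, bind_val, ops_time, ops_val]
      refine (add_le_add (ih _ _) le_rfl).trans ?_
      norm_cast
    · simp

/-- The elements skipped and the elements taken together number at most `M`, so the bound is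
deterministic. -/
lemma methodA_time (m : ℕ) : ∀ M off s, (methodA m M off s).time ≤ (7 * M + 12 * m + 1 : ℕ) := by
  induction m with
  | zero => intro M off s; simp [methodA]
  | succ m ih =>
    intro M off s
    rw [methodA]
    simp only [bind_time, ops_time, ops_val]
    have h1 := skipScan_time (s.stream 0 : ℝ) (M - (m + 1)) M (((M - (m + 1) : ℕ) : ℝ) / (M : ℝ))
    have h2 := skipScan_val_le (s.stream 0 : ℝ) (M - (m + 1)) M (((M - (m + 1) : ℕ) : ℝ) / (M : ℝ))
    generalize (skipScan (s.stream 0 : ℝ) (M - (m + 1)) M (((M - (m + 1) : ℕ) : ℝ) / (M : ℝ))) = X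
      at h1 h2
    refine (add_le_add le_rfl (add_le_add h1 (add_le_add (ih _ _ _) le_rfl))).trans ?_
    norm_cast
    omega

lemma div_choose_le_one (a b k : ℕ) (h : a ≤ b) :
    ((a.choose k : ℕ) : ℝ) / ((b.choose k : ℕ) : ℝ) ≤ 1 := by
  refine div_le_one_of_le₀ ?_ (by positivity)
  exact_mod_cast Nat.choose_le_choose k h

lemma volume_skipScan {m M : ℕ} (hm : m + 1 ≤ M) (k : ℕ) :
    MeasurableSet {v : I | (skipScan (v : ℝ) (M - (m + 1)) M
      (((M - (m + 1) : ℕ) : ℝ) / (M : ℝ))).val = k} ∧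
    volume {v : I | (skipScan (v : ℝ) (M - (m + 1)) M
      (((M - (m + 1) : ℕ) : ℝ) / (M : ℝ))).val = k} = skipPMF m M k := by
  set X : I → ℕ := fun v => (skipScan (v : ℝ) (M - (m + 1)) M
    (((M - (m + 1) : ℕ) : ℝ) / (M : ℝ))).val
  have hDn : 0 < M.choose (m + 1) := Nat.choose_pos hm
  have hD : (0 : ℝ) < (M.choose (m + 1) : ℝ) := by exact_mod_cast hDn
  have hge : ∀ j, MeasurableSet {v | j ≤ X v} ∧ volume {v | j ≤ X v} =
      ENNReal.ofReal (((M - j).choose (m + 1) : ℝ) / (M.choose (m + 1) : ℝ)) := by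
    intro j
    cases j with
    | zero =>
      simp only [zero_le, Set.ofPred_true, MeasurableSet.univ, measure_univ, true_and, Nat.sub_zero]
      rw [div_self hD.ne', ENNReal.ofReal_one]
    | succ j =>
      have : {v | j + 1 ≤ X v} = {v : I | (v : ℝ) < ((M - (j + 1)).choose (m + 1) : ℝ) /
          (M.choose (m + 1) : ℝ)} := by
        ext v
        exact lt_skipScan_initial_iff v.2.1 hm j
      rw [this]
      exact ⟨measurableSet_lt measurable_subtype_coe measurable_const,
        volume_coe_lt (div_choose_le_one _ _ _ (by omega))⟩
  have he : {v | X v = k} = {v | k ≤ X v} \ {v | k + 1 ≤ X v} := by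
    ext v
    simp only [Set.mem_ofPred_eq, Set.mem_sdiff]
    omega
  change MeasurableSet {v | X v = k} ∧ volume {v | X v = k} = skipPMF m M k
  rw [he]
  refine ⟨(hge k).1.diff (hge (k + 1)).1, ?_⟩
  rw [measure_sdiff _ (hge (k + 1)).1.nullMeasurableSet (measure_ne_top _ _), (hge k).2,
    (hge (k + 1)).2, ← ENNReal.ofReal_sub _ (by positivity), ← sub_div, skipPMF]
  · split_ifs with hk
    · obtain ⟨j, hj⟩ : ∃ j, M - k = j + 1 := ⟨M - (k + 1), by omega⟩
      rw [hj, show M - (k + 1) = j by omega, Nat.choose_succ_succ, ENNReal.ofReal_div_of_pos hD,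
        ENNReal.ofReal_natCast]
      push_cast
      rw [add_sub_cancel_right, ENNReal.ofReal_natCast]
    · rw [show M - k = 0 by omega, show M - (k + 1) = 0 by omega]
      simp
  · intro v hv
    simp only [Set.mem_ofPred_eq] at hv ⊢
    omega

lemma methodA_samples (m : ℕ) : ∀ (M off : ℕ) (e : List ℕ → Key), Function.Injective e → m ≤ M →
    Samples (localKeys e) (fun h => (methodA m M off fun p => h (e p)).val) off M m := by
  induction m with
  | zero => exact fun M off e _ _ => samples_nil _ off M
  | succ m ih =>
    intro M off e he hm
    refine Samples.cons (disjoint_stream_sub he 1) streamKeys_subset (localKeys_sub_subset 1)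
      (X := fun h => (skipScan (h (e [0]) : ℝ) (M - (m + 1)) M
        (((M - (m + 1) : ℕ) : ℝ) / (M : ℝ))).val)
      (V := fun k h => (methodA m (M - (k + 1)) (off + (k + 1)) fun p => h (e (1 :: p))).val)
      ?_ (fun k => ?_) (fun k hk hk' => ih _ _ _ (injective_sub he 1) hk')
    · refine ⟨_, fun A _ => ?_, Filter.EventuallyEq.rfl⟩
      have : ((fun h : Key → I => (skipScan (h (e [0]) : ℝ) (M - (m + 1)) M
          (((M - (m + 1) : ℕ) : ℝ) / (M : ℝ))).val) ⁻¹' A) = (fun h : Key → I => h (e [0])) ⁻¹'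
          (⋃ k ∈ A, {v : I | (skipScan (v : ℝ) (M - (m + 1)) M
            (((M - (m + 1) : ℕ) : ℝ) / (M : ℝ))).val = k}) := by
        ext h; simp
      rw [this]
      exact measurable_eval (S := streamKeys e) ⟨0, rfl⟩
        (MeasurableSet.biUnion (Set.to_countable A) fun k _ => (volume_skipScan hm k).1)
    · have h1 := volume_skipScan hm k
      have h2 : MeasurePreserving (fun h : Key → I => h (e [0])) hashLaw volume :=
        measurePreserving_eval_infinitePi _ _
      rw [← h1.2, ← h2.measure_preimage h1.1.nullMeasurableSet]
      rfl

/-! ## The rejection method of Algorithm D -/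

/-- Factor by factor, `(n - K - i) / (n - i) ≤ (n - K) / n`. It yields the majorant of Algorithm D
and the comparison of hypergeometric with binomial moments. -/
lemma choose_sub_le {n K : ℕ} (hK : K ≤ n) (j : ℕ) :
    ((n - K).choose j : ℝ) ≤ (1 - (K : ℝ) / n) ^ j * (n.choose j : ℝ) := by
  have h0 : 0 ≤ 1 - (K : ℝ) / n :=
    sub_nonneg.2 (div_le_one_of_le₀ (by exact_mod_cast hK) (by positivity))
  induction j with
  | zero => simp
  | succ j ih =>
    by_cases hj : n - K ≤ j
    · rw [Nat.choose_eq_zero_of_lt (by omega)]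
      simp only [Nat.cast_zero]
      positivity
    · have h1 : ((n - K).choose (j + 1) : ℝ) * (j + 1) =
          ((n - K).choose j : ℝ) * ((n : ℝ) - K - j) := by
        have := Nat.choose_succ_right_eq (n - K) j
        have h2 : ((n - K - j : ℕ) : ℝ) = (n : ℝ) - K - j := by
          rw [Nat.cast_sub (by omega), Nat.cast_sub hK]
        rw [← h2]
        exact_mod_cast this
      have h3 : (n.choose (j + 1) : ℝ) * (j + 1) = (n.choose j : ℝ) * ((n : ℝ) - j) := by
        have := Nat.choose_succ_right_eq n j
        rw [← Nat.cast_sub (by omega : j ≤ n)]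
        exact_mod_cast this
      have hn : (0 : ℝ) < n := by exact_mod_cast (by omega : 0 < n)
      have hpos : (0 : ℝ) ≤ (n : ℝ) - K - j := by
        have : ((K + j : ℕ) : ℝ) ≤ n := by exact_mod_cast (by omega : K + j ≤ n)
        push_cast at this; linarith
      have h4 : (n : ℝ) - K - j ≤ (1 - (K : ℝ) / n) * ((n : ℝ) - j) := by
        have : (K : ℝ) / n * j ≤ 1 * K := by
          rw [div_mul_eq_mul_div, mul_comm, one_mul, div_le_iff₀ hn]
          have : (j : ℝ) ≤ n := by exact_mod_cast (by omega : j ≤ n)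
          nlinarith [(Nat.cast_nonneg K : (0 : ℝ) ≤ K)]
        have h5 : (K : ℝ) / n * n = K := div_mul_cancel₀ _ hn.ne'
        nlinarith
      refine le_of_mul_le_mul_right ?_ (by positivity : (0 : ℝ) < (j : ℝ) + 1)
      calc _ = ((n - K).choose j : ℝ) * ((n : ℝ) - K - j) := h1
        _ ≤ ((1 - (K : ℝ) / n) ^ j * (n.choose j : ℝ)) * ((1 - (K : ℝ) / n) * ((n : ℝ) - j)) := by
          gcongr
        _ = (1 - (K : ℝ) / n) ^ (j + 1) * ((n.choose j : ℝ) * ((n : ℝ) - j)) := by ring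
        _ = _ := by rw [← h3]; ring

/-- Each factor `1 - k / (n - i)` is at least `1 - k / D`, as `D ≤ n - i` for `i < j`. It justifies
the quick acceptance test of Algorithm D. -/
lemma le_choose_sub {n k D : ℕ} (hD : 0 < D) (hk : k ≤ D) (j : ℕ) (hj : D + j ≤ n + 1) :
    (1 - (k : ℝ) / D) ^ j * (n.choose j : ℝ) ≤ ((n - k).choose j : ℝ) := by
  have hD' : (0 : ℝ) < D := by exact_mod_cast hD
  have h0 : 0 ≤ 1 - (k : ℝ) / D :=
    sub_nonneg.2 (div_le_one_of_le₀ (by exact_mod_cast hk) hD'.le)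
  induction j with
  | zero => simp
  | succ j ih =>
    have h1 : ((n - k).choose (j + 1) : ℝ) * (j + 1) =
        ((n - k).choose j : ℝ) * ((n : ℝ) - k - j) := by
      have := Nat.choose_succ_right_eq (n - k) j
      have h2 : ((n - k - j : ℕ) : ℝ) = (n : ℝ) - k - j := by
        rw [Nat.cast_sub (by omega), Nat.cast_sub (by omega)]
      rw [← h2]
      exact_mod_cast this
    have h3 : (n.choose (j + 1) : ℝ) * (j + 1) = (n.choose j : ℝ) * ((n : ℝ) - j) := by
      have := Nat.choose_succ_right_eq n j
      rw [← Nat.cast_sub (by omega : j ≤ n)]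
      exact_mod_cast this
    have hDj : (D : ℝ) ≤ (n : ℝ) - j := by
      have : ((D + j : ℕ) : ℝ) ≤ n := by exact_mod_cast (by omega : D + j ≤ n)
      push_cast at this; linarith
    have h4 : (1 - (k : ℝ) / D) * ((n : ℝ) - j) ≤ (n : ℝ) - k - j := by
      have h5 : (k : ℝ) / D * D = k := div_mul_cancel₀ _ hD'.ne'
      have h6 : (k : ℝ) / D * D ≤ (k : ℝ) / D * ((n : ℝ) - j) := by gcongr
      linarith
    refine le_of_mul_le_mul_right ?_ (by positivity : (0 : ℝ) < (j : ℝ) + 1)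
    calc (1 - (k : ℝ) / D) ^ (j + 1) * (n.choose (j + 1) : ℝ) * (j + 1)
        = ((1 - (k : ℝ) / D) ^ j * (n.choose j : ℝ)) * ((1 - (k : ℝ) / D) * ((n : ℝ) - j)) := by
          rw [mul_assoc, h3]; ring
      _ ≤ ((n - k).choose j : ℝ) * ((n : ℝ) - k - j) := by
          have : 0 ≤ (1 - (k : ℝ) / D) * ((n : ℝ) - j) := mul_nonneg h0 (hD'.le.trans hDj)
          gcongr
          exact ih (by omega)
      _ = _ := h1.symm

lemma exp_lnChoose {a b : ℕ} (h : b ≤ a) : Real.exp (lnChoose a b).val = (a.choose b : ℝ) := by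
  have hval : (lnChoose a b).val = Real.log (a.factorial : ℝ) - Real.log (b.factorial : ℝ) -
    Real.log ((a - b).factorial : ℝ) := rfl
  have hp : ∀ n : ℕ, (0 : ℝ) < (n.factorial : ℝ) := fun n => by exact_mod_cast n.factorial_pos
  rw [hval, Real.exp_sub, Real.exp_sub, Real.exp_log (hp _), Real.exp_log (hp _),
    Real.exp_log (hp _), Nat.cast_choose ℝ h, div_div]

lemma lnChoose_time (a b : ℕ) : (lnChoose a b).time = 6 := rfl

/-- Area of a region under a graph. -/
lemma volume_prod_region {A : Set (I × I)} (hA : MeasurableSet A) {α β : ℝ} (h0 : 0 ≤ α)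
    (hαβ : α ≤ β) (h1 : β ≤ 1) {φ : ℝ → ℝ} (hφ : IntervalIntegrable φ volume α β)
    (hφm : Measurable φ) (hpos : ∀ x ∈ Set.Ioc α β, 0 ≤ φ x)
    (hsec : ∀ᵐ v : I, volume {u : I | (v, u) ∈ A} =
      (Set.Ioc α β).indicator (fun x => ENNReal.ofReal (φ x)) (v : ℝ)) :
    volume A = ENNReal.ofReal (∫ x in α..β, φ x) := by
  have hm : Measurable ((Set.Ioc α β).indicator fun x => ENNReal.ofReal (φ x)) :=
    hφm.ennreal_ofReal.indicator measurableSet_Ioc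
  have hsub : Set.Ioc α β ⊆ I := fun x hx => ⟨h0.trans hx.1.le, hx.2.trans h1⟩
  have h2 : volume A = ∫⁻ v : I, volume {u : I | (v, u) ∈ A} := Measure.prod_apply hA
  rw [h2, lintegral_congr_ae hsec, unitInterval.measurePreserving_coe.lintegral_comp hm,
    lintegral_indicator measurableSet_Ioc, Measure.restrict_restrict measurableSet_Ioc,
    Set.inter_eq_left.2 hsub,
    intervalIntegral.integral_of_le hαβ, ofReal_integral_eq_lintegral_ofReal]
  · exact (intervalIntegrable_iff_integrableOn_Ioc_of_le hαβ).1 hφ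
  · exact (ae_restrict_iff' measurableSet_Ioc).2 (Filter.Eventually.of_forall hpos)

lemma volume_fin_two {A : Set (I × I)} (hA : MeasurableSet A) :
    volume {u : Fin 2 → I | (u 1, u 0) ∈ A} = volume A := by
  have h1 := (volume_preserving_finTwoArrow I)
  have h2 : MeasurePreserving (Prod.swap : I × I → I × I) (volume) (volume) :=
    Measure.measurePreserving_swap
  have h3 := (h2.comp h1).measure_preimage hA.nullMeasurableSet
  rw [← h3]
  rfl

section SkipTrial

variable {m M : ℕ}

lemma skipTrial_time (u v : I) : (skipTrial (m + 1) M u v).time ≤ 48 := by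
  unfold skipTrial
  simp only [ops_bind_time]
  split_ifs
  · simp only [ops_time]
    norm_num
  · simp only [ops_bind_time]
    split_ifs
    · simp only [ops_time]
      norm_num
    · simp only [bind_time, ops_time, lnChoose_time]
      norm_num

/-- Quick acceptance implies the exact test, so it saves time without changing the outcome. For the
proposal `x = M (1 - y)` the majorant depends on `y` only through `y ^ m`. -/
lemma skipTrial_val_iff (hm : m + 1 ≤ M) (u v : I) (k : ℕ) :
    (skipTrial (m + 1) M u v).val = some k ↔
      ⌊(M : ℝ) * (1 - (v : ℝ) ^ (1 / ((m + 1 : ℕ) : ℝ)))⌋₊ = k ∧ k ≤ M - (m + 1) ∧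
      (u : ℝ) * (((m + 1 : ℕ) : ℝ) / ((M - m : ℕ) : ℝ) * ((v : ℝ) ^ (1 / ((m + 1 : ℕ) : ℝ))) ^ m) ≤
        ((M - (k + 1)).choose m : ℝ) / (M.choose (m + 1) : ℝ) := by
  set y := (v : ℝ) ^ (1 / ((m + 1 : ℕ) : ℝ)) with hy
  have hMpos : (0 : ℝ) < M := by exact_mod_cast (by omega : 0 < M)
  have eM : M - (m + 1) + 1 = M - m := by omega
  have hhat : 1 - (M : ℝ) * (1 - y) / M = y := by
    field_simp
    ring
  set K := ⌊(M : ℝ) * (1 - y)⌋₊ with hK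
  by_cases hKM : M - (m + 1) < K
  · have hval : (skipTrial (m + 1) M u v).val = none := by
      unfold skipTrial
      simp only [ops_bind_val, ← hy, ← hK]
      rw [if_pos hKM]
      rfl
    rw [hval]
    simp only [reduceCtorEq, false_iff, not_and]
    rintro h1 h2
    omega
  · have hexp : Real.exp ((lnChoose (M - K - 1) m).val - (lnChoose M (m + 1)).val) =
        ((M - (K + 1)).choose m : ℝ) / (M.choose (m + 1) : ℝ) := by
      rw [Real.exp_sub, exp_lnChoose (by omega), exp_lnChoose hm, Nat.sub_sub]
    have hlow : ((m + 1 : ℕ) : ℝ) / M * (1 - (K : ℝ) / ((M - m : ℕ) : ℝ)) ^ m ≤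
        ((M - (K + 1)).choose m : ℝ) / (M.choose (m + 1) : ℝ) := by
      obtain ⟨n, rfl⟩ : ∃ n, M = n + 1 := ⟨M - 1, by omega⟩
      have h1 := le_choose_sub (n := n) (k := K) (D := n + 1 - m) (by omega) (by omega) m (by omega)
      have h2 : ((n + 1).choose (m + 1) : ℝ) * ((m + 1 : ℕ) : ℝ) = ((n + 1 : ℕ) : ℝ) * (n.choose m) := by
        exact_mod_cast (Nat.add_one_mul_choose_eq n m).symm
      have hc : (0 : ℝ) < ((n + 1).choose (m + 1) : ℝ) := by
        exact_mod_cast Nat.choose_pos hm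
      rw [show n + 1 - (K + 1) = n - K by omega, le_div_iff₀ hc, div_mul_eq_mul_div,
        div_mul_eq_mul_div, div_le_iff₀ hMpos]
      calc _ = (1 - (K : ℝ) / ((n + 1 - m : ℕ) : ℝ)) ^ m *
            (((n + 1).choose (m + 1) : ℝ) * ((m + 1 : ℕ) : ℝ)) := by ring
        _ = ((1 - (K : ℝ) / ((n + 1 - m : ℕ) : ℝ)) ^ m * (n.choose m)) * ((n + 1 : ℕ) : ℝ) := by
          rw [h2]; ring
        _ ≤ _ := by gcongr
    have hval : (skipTrial (m + 1) M u v).val =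
        if (u : ℝ) * (((m + 1 : ℕ) : ℝ) / ((M - m : ℕ) : ℝ) * y ^ m) ≤
          ((M - (K + 1)).choose m : ℝ) / (M.choose (m + 1) : ℝ) then some K else none := by
      unfold skipTrial
      simp only [ops_bind_val, ← hy, ← hK]
      rw [if_neg hKM]
      simp only [ops_bind_val, hhat, eM, add_tsub_cancel_right]
      by_cases hq : (u : ℝ) * (((m + 1 : ℕ) : ℝ) / ((M - m : ℕ) : ℝ) * y ^ m) ≤
          ((m + 1 : ℕ) : ℝ) / M * (1 - (K : ℝ) / ((M - m : ℕ) : ℝ)) ^ m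
      · rw [if_pos (by simpa using hq), if_pos (hq.trans hlow)]
        rfl
      · rw [if_neg (by simpa using hq), ← hexp]
        rfl
    rw [hval]
    split_ifs with hc
    · simp only [Option.some.injEq]
      constructor
      · rintro rfl
        exact ⟨rfl, not_lt.1 hKM, hc⟩
      · exact fun h => h.1
    · simp only [false_iff]
      rintro ⟨rfl, _, h⟩
      exact hc h

lemma tsum_skipPMF (hm : m + 1 ≤ M) : ∑' k, skipPMF m M k = 1 := by
  have h := fun k => volume_skipScan hm k
  simp_rw [← fun k => (h k).2]
  rw [← measure_iUnion _ fun k => (h k).1]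
  · convert measure_univ (μ := (volume : Measure I))
    ext v; simp
  · intro j k hjk
    rw [Function.onFun, Set.disjoint_left]
    intro v h1 h2
    exact hjk ((show _ = j from h1).symm.trans h2)

lemma volume_skipTrial (hm : m + 1 ≤ M) {k : ℕ} (hk : k ≤ M - (m + 1)) :
    MeasurableSet {z : I × I | (skipTrial (m + 1) M z.2 z.1).val = some k} ∧
    volume {z : I × I | (skipTrial (m + 1) M z.2 z.1).val = some k} = ENNReal.ofReal
      (((M - (k + 1)).choose m : ℝ) / (M.choose (m + 1) : ℝ) * (((M - m : ℕ) : ℝ) / M)) := by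
  set f : ℝ := ((M - (k + 1)).choose m : ℝ) / (M.choose (m + 1) : ℝ) with hf
  set H : ℝ := ((m + 1 : ℕ) : ℝ) / ((M - m : ℕ) : ℝ) with hH
  set p : ℝ := 1 / ((m + 1 : ℕ) : ℝ) with hp
  have hMpos : (0 : ℝ) < M := by exact_mod_cast (by omega : 0 < M)
  have hm1 : (0 : ℝ) < ((m + 1 : ℕ) : ℝ) := by positivity
  have hMm : (0 : ℝ) < ((M - m : ℕ) : ℝ) := by exact_mod_cast (by omega : 0 < M - m)
  have hHpos : 0 < H := div_pos hm1 hMm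
  have hcM : (0 : ℝ) < (M.choose (m + 1) : ℝ) := by exact_mod_cast Nat.choose_pos hm
  have hfpos : 0 < f := div_pos (by exact_mod_cast Nat.choose_pos (by omega)) hcM
  have hppos : 0 < p := by positivity
  have hset : {z : I × I | (skipTrial (m + 1) M z.2 z.1).val = some k} =
      {z : I × I | ⌊(M : ℝ) * (1 - (z.1 : ℝ) ^ p)⌋₊ = k ∧
        (z.2 : ℝ) * (H * ((z.1 : ℝ) ^ p) ^ m) ≤ f} := by
    ext z
    rw [Set.mem_ofPred_eq, skipTrial_val_iff hm]
    simp only [Set.mem_ofPred_eq, hk, true_and]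
    exact Iff.rfl
  have hA : MeasurableSet {z : I × I | (skipTrial (m + 1) M z.2 z.1).val = some k} := by
    rw [hset]
    have h1 : MeasurableSet {z : I × I | ⌊(M : ℝ) * (1 - (z.1 : ℝ) ^ p)⌋₊ = k} :=
      measurableSet_eq_fun (by fun_prop) measurable_const
    have h2 : MeasurableSet {z : I × I | (z.2 : ℝ) * (H * ((z.1 : ℝ) ^ p) ^ m) ≤ f} :=
      measurableSet_le (by fun_prop) measurable_const
    exact h1.inter h2
  refine ⟨hA, ?_⟩
  set b : ℝ := 1 - ((k + 1 : ℕ) : ℝ) / M with hb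
  set c : ℝ := 1 - (k : ℝ) / M with hc
  have hb0 : 0 ≤ b := sub_nonneg.2 (div_le_one_of_le₀ (by exact_mod_cast (by omega : k + 1 ≤ M))
    hMpos.le)
  have hbc : b ≤ c := by rw [hb, hc]; gcongr; omega
  have hc1 : c ≤ 1 := sub_le_self _ (by positivity)
  have hc0 := hb0.trans hbc
  -- The majorant dominates the probability of `k` even at the far end `k + 1` of the interval that
  -- is rounded down to `k`.
  have hfH : f ≤ H * b ^ m := by
    have h1 := choose_sub_le (n := M) (K := k + 1) (by omega) m
    have h2 : (M.choose (m + 1) : ℝ) * ((m + 1 : ℕ) : ℝ) = (M.choose m : ℝ) * ((M - m : ℕ) : ℝ) := by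
      exact_mod_cast Nat.choose_succ_right_eq M m
    rw [hf, div_le_iff₀ hcM, hH, div_mul_eq_mul_div, div_mul_eq_mul_div, le_div_iff₀ hMm]
    calc _ ≤ (b ^ m * (M.choose m : ℝ)) * ((M - m : ℕ) : ℝ) := by gcongr
      _ = b ^ m * ((M.choose m : ℝ) * ((M - m : ℕ) : ℝ)) := by ring
      _ = _ := by rw [← h2]; ring
  have hroot : ∀ z : ℝ, 0 ≤ z → (z ^ p) ^ (m + 1) = z := by
    intro z hz
    rw [hp, one_div, Real.rpow_inv_natCast_pow hz (by omega)]
  have hroot' : ∀ z : ℝ, 0 ≤ z → (z ^ (m + 1)) ^ p = z := by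
    intro z hz
    rw [hp, one_div, Real.pow_rpow_inv_natCast hz (by omega)]
  have hmem : ∀ v : I, ⌊(M : ℝ) * (1 - (v : ℝ) ^ p)⌋₊ = k ↔
      (v : ℝ) ∈ Set.Ioc (b ^ (m + 1)) (c ^ (m + 1)) := by
    intro v
    have hy0 : 0 ≤ (v : ℝ) ^ p := Real.rpow_nonneg v.2.1 _
    have hy1 : (v : ℝ) ^ p ≤ 1 := Real.rpow_le_one v.2.1 v.2.2 hppos.le
    have hv := hroot v v.2.1
    rw [Nat.floor_eq_iff (mul_nonneg hMpos.le (sub_nonneg.2 hy1)), Set.mem_Ioc, ← hv,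
      pow_lt_pow_iff_left₀ hb0 hy0 (by omega),
      pow_le_pow_iff_left₀ hy0 hc0 (by omega), hv, hb, hc]
    push_cast
    constructor
    · rintro ⟨h1, h2⟩
      constructor
      · rw [sub_lt_comm, lt_div_iff₀ hMpos]; linarith
      · rw [le_sub_comm, div_le_iff₀ hMpos]; linarith
    · rintro ⟨h1, h2⟩
      rw [sub_lt_comm, lt_div_iff₀ hMpos] at h1
      rw [le_sub_comm, div_le_iff₀ hMpos] at h2
      exact ⟨by linarith, by linarith⟩
  -- The section over `v` has length `f / (H y^m)` with `y = v ^ p`; written as a power of `v` it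
  -- can be integrated.
  have hφ : ∀ v : ℝ, 0 < v → v ^ (p - 1) = ((v ^ p) ^ m)⁻¹ := by
    intro v hv
    have hy : 0 < v ^ p := Real.rpow_pos_of_pos hv _
    rw [Real.rpow_sub hv, Real.rpow_one, eq_comm, inv_eq_iff_eq_inv, inv_div, eq_div_iff hy.ne',
      ← pow_succ, hroot v hv.le]
  have hint : IntervalIntegrable (fun v : ℝ => f / H * v ^ (p - 1)) volume
      (b ^ (m + 1)) (c ^ (m + 1)) :=
    (intervalIntegral.intervalIntegrable_rpow' (by linarith)).const_mul _
  have hsec : ∀ v : I, volume {u : I | (v, u) ∈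
      {z : I × I | (skipTrial (m + 1) M z.2 z.1).val = some k}} =
      (Set.Ioc (b ^ (m + 1)) (c ^ (m + 1))).indicator
        (fun x => ENNReal.ofReal (f / H * x ^ (p - 1))) (v : ℝ) := by
    intro v
    rw [hset]
    by_cases hv : (v : ℝ) ∈ Set.Ioc (b ^ (m + 1)) (c ^ (m + 1))
    · rw [Set.indicator_of_mem hv]
      have hv0 : (0 : ℝ) < v := (pow_nonneg hb0 _).trans_lt hv.1
      have hy : 0 < (v : ℝ) ^ p := Real.rpow_pos_of_pos hv0 _
      have hyb : b ≤ (v : ℝ) ^ p := by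
        rw [← hroot' b hb0]
        exact Real.rpow_le_rpow (pow_nonneg hb0 _) hv.1.le hppos.le
      have hle1 : f / H * (v : ℝ) ^ (p - 1) ≤ 1 := by
        rw [hφ v hv0, ← div_eq_mul_inv, div_div, div_le_one (by positivity)]
        refine hfH.trans ?_
        gcongr
      have hs : {u : I | (v, u) ∈ {z : I × I | ⌊(M : ℝ) * (1 - (z.1 : ℝ) ^ p)⌋₊ = k ∧
          (z.2 : ℝ) * (H * ((z.1 : ℝ) ^ p) ^ m) ≤ f}} =
          {u : I | (u : ℝ) ∈ Set.Iic (f / H * (v : ℝ) ^ (p - 1))} := by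
        ext u
        simp only [Set.mem_ofPred_eq, (hmem v).2 hv, true_and, Set.mem_Iic]
        rw [hφ v hv0, ← div_eq_mul_inv, div_div]
        exact (le_div_iff₀ (by positivity)).symm
      rw [hs, volume_coe_mem measurableSet_Iic]
      have hs2 : Set.Iic (f / H * (v : ℝ) ^ (p - 1)) ∩ Set.Icc 0 1 =
          Set.Icc 0 (f / H * (v : ℝ) ^ (p - 1)) := by
        ext x
        simp only [Set.mem_inter_iff, Set.mem_Iic, Set.mem_Icc]
        exact ⟨fun h => ⟨h.2.1, h.1⟩, fun h => ⟨h.2, h.1, h.2.trans hle1⟩⟩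
      rw [hs2, Real.volume_Icc, sub_zero]
    · rw [Set.indicator_of_notMem hv]
      have hs : {u : I | (v, u) ∈ {z : I × I | ⌊(M : ℝ) * (1 - (z.1 : ℝ) ^ p)⌋₊ = k ∧
          (z.2 : ℝ) * (H * ((z.1 : ℝ) ^ p) ^ m) ≤ f}} = ∅ := by
        ext u
        simp only [Set.mem_ofPred_eq, Set.mem_empty_iff_false, iff_false, not_and]
        exact fun h => absurd ((hmem v).1 h) hv
      rw [hs, measure_empty]
  rw [volume_prod_region hA (pow_nonneg hb0 _) (pow_le_pow_left₀ hb0 hbc _) (pow_le_one₀ hc0 hc1)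
    hint (by fun_prop) (fun x hx => mul_nonneg (div_nonneg hfpos.le hHpos.le)
      (Real.rpow_nonneg ((pow_nonneg hb0 _).trans hx.1.le) _)) (Filter.Eventually.of_forall hsec)]
  congr 1
  -- The integral is `(f / H) (c - b) / p` with `c - b = 1 / M`. Thus the acceptance factor `(M - m)
  -- / M` does not depend on `k`.
  rw [intervalIntegral.integral_const_mul, integral_rpow (Or.inl (by linarith)), sub_add_cancel,
    hroot' c hc0, hroot' b hb0, hb, hc, hH, hp]
  push_cast
  field_simp
  ring

lemma skipTrial_law (hm : m + 1 ≤ M) :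
    TrialLaw (fun u : Fin 2 → I => skipTrial (m + 1) M (u 0) (u 1)) (skipPMF m M) 48
      (((M - m : ℕ) : ℝ≥0∞) * (M : ℝ≥0∞)⁻¹) := by
  have hMpos : (0 : ℝ) < M := by exact_mod_cast (by omega : 0 < M)
  have hcM : (0 : ℝ) < (M.choose (m + 1) : ℝ) := by exact_mod_cast Nat.choose_pos hm
  have key : ∀ k, MeasurableSet {z : I × I | (skipTrial (m + 1) M z.2 z.1).val = some k} ∧
      volume {z : I × I | (skipTrial (m + 1) M z.2 z.1).val = some k} =
        skipPMF m M k * (((M - m : ℕ) : ℝ≥0∞) * (M : ℝ≥0∞)⁻¹) := by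
    intro k
    by_cases hk : k ≤ M - (m + 1)
    · obtain ⟨h1, h2⟩ := volume_skipTrial hm hk
      refine ⟨h1, ?_⟩
      rw [h2, skipPMF, if_pos (by omega), ENNReal.ofReal_mul (by positivity),
        ENNReal.ofReal_div_of_pos hcM, ENNReal.ofReal_div_of_pos hMpos, ENNReal.ofReal_natCast,
        ENNReal.ofReal_natCast, ENNReal.ofReal_natCast, ENNReal.ofReal_natCast, div_eq_mul_inv
        ((M - m : ℕ) : ℝ≥0∞)]
    · have he : {z : I × I | (skipTrial (m + 1) M z.2 z.1).val = some k} = ∅ := by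
        ext z
        simp only [Set.mem_ofPred_eq, Set.mem_empty_iff_false, iff_false, skipTrial_val_iff hm]
        exact fun h => hk h.2.1
      have hz : skipPMF m M k = 0 := by
        by_contra hne
        have := skipPMF_ne_zero hne
        omega
      rw [he, hz]
      simp
  refine TrialLaw.of_tsum (fun u => skipTrial_time _ _) (fun k => ?_) (fun k => ?_)
    (tsum_skipPMF hm)
  · have hmeas : Measurable fun u : Fin 2 → I => (u 1, u 0) := by fun_prop
    exact hmeas (key k).1
  · rw [← (key k).2]
    exact volume_fin_two (key k).1

end SkipTrial

/-! ## Algorithm D -/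

section AlgD

variable {r : ℕ}

lemma algD_succ (m M off : ℕ) (s : Source) : algD r (m + 1) M off s =
    if M ≤ r * (m + 1) then methodA (m + 1) M off s >>= fun T => ops 3 T
    else (retry fun t => skipTrial (m + 1) M (s.stream (2 * t)) (s.stream (2 * t + 1))) >>= fun k =>
      algD r m (M - (k + 1)) (off + (k + 1)) (s.sub 1) >>= fun rest =>
        ops 10 ((off + (k + 1)) :: rest) := by
  rw [algD]

lemma skip_deviate {m M : ℕ} (hm : m + 1 ≤ M) {e : List ℕ → Key} (he : Function.Injective e) :
    Deviate (streamKeys e) (fun h => retry fun t => skipTrial (m + 1) M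
      (Source.stream (fun p => h (e p)) (2 * t)) (Source.stream (fun p => h (e p)) (2 * t + 1)))
      (skipPMF m M) := by
  have hpos : 0 < (((M - m : ℕ) : ℝ≥0∞) * (M : ℝ≥0∞)⁻¹) :=
    ENNReal.mul_pos (by exact_mod_cast (by omega : M - m ≠ 0)) (by simp)
  exact retry_deviate (skipTrial_law hm) (injective_stream he) hpos (S := streamKeys e)
    fun i => ⟨i, rfl⟩

/-- Algorithm D makes a rejection trial only while fewer than the fraction `1 / r ≤ 1 / 2` is
wanted, so the acceptance probability `(M - m) / M` is at least 1/2. -/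
lemma skip_jointCost {m M : ℕ} (hm : 2 * (m + 1) ≤ M) {e : List ℕ → Key}
    (he : Function.Injective e) {w : ℝ≥0∞} (hw : 1 ≤ w) (hw' : (1 - 2⁻¹) * w ^ 48 < 1) :
    JointCost w (streamKeys e) (fun h => retry fun t => skipTrial (m + 1) M
      (Source.stream (fun p => h (e p)) (2 * t)) (Source.stream (fun p => h (e p)) (2 * t + 1)))
      (retryFactor 2⁻¹ (w ^ 48)) := by
  have hq : (2⁻¹ : ℝ≥0∞) ≤ ((M - m : ℕ) : ℝ≥0∞) * (M : ℝ≥0∞)⁻¹ := by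
    have hM : (M : ℝ≥0∞) ≠ 0 := by exact_mod_cast (by omega : M ≠ 0)
    rw [← div_eq_mul_inv, ENNReal.le_div_iff_mul_le (Or.inl hM) (Or.inl (ENNReal.natCast_ne_top _)),
      mul_comm, ← div_eq_mul_inv, ENNReal.div_le_iff_le_mul (Or.inl (by simp)) (Or.inl (by simp))]
    exact_mod_cast (by omega : M ≤ (M - m) * 2)
  exact retry_jointCost (skipTrial_law (by omega)) (injective_stream he) (by simp) hq hw hw'
    (S := streamKeys e) fun i => ⟨i, rfl⟩

lemma algD_samples (m : ℕ) : ∀ (M off : ℕ) (e : List ℕ → Key), Function.Injective e →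
    m ≤ M → Samples (localKeys e) (fun h => (algD r m M off fun p => h (e p)).val) off M m := by
  induction m with
  | zero => exact fun M off e _ _ => samples_nil _ off M
  | succ m ih =>
    intro M off e he hm
    simp only [algD_succ]
    by_cases h : M ≤ r * (m + 1)
    · simp only [if_pos h]
      exact methodA_samples (m + 1) M off e he hm
    · simp only [if_neg h]
      have hD := skip_deviate hm he
      exact Samples.cons (disjoint_stream_sub he 1) streamKeys_subset (localKeys_sub_subset 1)
        (V := fun k h => (algD r m (M - (k + 1)) (off + (k + 1)) fun p => h (e (1 :: p))).val)
        hD.obs hD.law (fun k hk hk' => ih _ _ _ (injective_sub he 1) hk')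

lemma algD_cost (hr : 2 ≤ r) {w : ℝ≥0∞} (hw : 1 ≤ w) (hw' : (1 - 2⁻¹) * w ^ 48 < 1) (m : ℕ) :
    ∀ (M off : ℕ) (e : List ℕ → Key), Function.Injective e → m ≤ M →
    Cost w (localKeys e) (fun h => algD r m M off fun p => h (e p))
      ((retryFactor 2⁻¹ (w ^ 48) * w ^ (7 * r + 16)) ^ (m + 1)) := by
  set g := retryFactor 2⁻¹ (w ^ 48) with hg
  have hg1 : 1 ≤ g := by rw [hg, retryFactor]; exact le_self_add
  have hpow : ∀ (j c : ℕ), c ≤ (7 * r + 16) * j → w ^ c ≤ (g * w ^ (7 * r + 16)) ^ j := by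
    intro j c hc
    rw [mul_pow, ← pow_mul]
    exact (pow_le_pow_right₀ hw hc).trans (le_mul_of_one_le_left' (one_le_pow₀ hg1))
  induction m with
  | zero =>
    intro M off e _ _
    exact (cost_of_time_le hw (c := 1) (Filter.Eventually.of_forall fun h => le_rfl)).mono le_rfl
      (hpow _ _ (by omega))
  | succ m ih =>
    intro M off e he hm
    simp only [algD_succ]
    by_cases h : M ≤ r * (m + 1)
    · simp only [if_pos h]
      -- Here `M ≤ r * (m + 1)`, so Method A takes at most `7 r + 12` steps per sample element plus
      -- 4; this is where the exponent `7 * r + 16` comes from.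
      refine (cost_of_time_le hw (c := 7 * M + 12 * (m + 1) + 1 + 3)
        (Filter.Eventually.of_forall fun x => ?_)).mono le_rfl (hpow _ _ ?_)
      · rw [bind_time, ops_time, Nat.cast_add]
        exact add_le_add (methodA_time _ _ _ _) le_rfl
      · nlinarith
    · simp only [if_neg h]
      have h2 : 2 * (m + 1) ≤ M := by
        have := Nat.mul_le_mul_right (m + 1) hr
        omega
      have hD := skip_deviate hm he
      have hJ := skip_jointCost h2 he hw hw'
      have hC : ∀ k, hashLaw {h | (retry fun t => skipTrial (m + 1) M
          (Source.stream (fun p => h (e p)) (2 * t))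
          (Source.stream (fun p => h (e p)) (2 * t + 1))).val = k} ≠ 0 →
          Cost w (localKeys fun p => e (1 :: p)) (fun h =>
            algD r m (M - (k + 1)) (off + (k + 1)) (fun p => h (e (1 :: p))) >>= fun rest =>
              ops 10 ((off + (k + 1)) :: rest)) ((g * w ^ (7 * r + 16)) ^ (m + 1) * w ^ 10) := by
        intro k hk
        rw [hD.law] at hk
        exact Cost.time_add hw (ih _ _ _ (injective_sub he 1) (skipPMF_ne_zero hk).1)
          (Filter.Eventually.of_forall fun x => le_rfl)
      have := Cost.bind hw (disjoint_stream_sub he 1) hD.obs hJ hC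
      refine this.mono (Set.union_subset streamKeys_subset (localKeys_sub_subset 1)) ?_
      rw [ENNReal.tsum_mul_right, hD.obs.tsum_law, one_mul]
      calc g * ((g * w ^ (7 * r + 16)) ^ (m + 1) * w ^ 10)
          = (g * w ^ (7 * r + 16)) ^ (m + 1) * (g * w ^ 10) := by ring
        _ ≤ (g * w ^ (7 * r + 16)) ^ (m + 1) * (g * w ^ (7 * r + 16)) :=
          mul_le_mul' le_rfl (mul_le_mul' le_rfl (pow_le_pow_right₀ hw (by omega)))
        _ = _ := (pow_succ _ _).symm

end AlgD

/-! ## Hypergeometric generators -/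

lemma trialLaw_generator {G : Generator} {a : ℕ} {q : ℝ} {n l N : ℕ}
    (h : (∀ u, (G.trial n l N u).time ≤ a) ∧
      (∀ x, MeasurableSet {u | (G.trial n l N u).val = some x}) ∧
      q ≤ volume.real {u | (G.trial n l N u).val.isSome = true} ∧
      ∀ x, volume.real {u | (G.trial n l N u).val = some x} =
        hyperPMF n l N x * volume.real {u | (G.trial n l N u).val.isSome = true}) :
    ∃ s, ENNReal.ofReal q ≤ s ∧ TrialLaw (G.trial n l N) (hyperLaw n l N) a s := by
  obtain ⟨h1, h2, h3, h4⟩ := h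
  refine ⟨_, ?_, h1, h2, fun x => ?_, rfl⟩
  · rw [← ofReal_measureReal]
    exact ENNReal.ofReal_le_ofReal h3
  · rw [← ofReal_measureReal, h4, ENNReal.ofReal_mul (hyperPMF_nonneg _ _ _ _), ofReal_measureReal]
    rfl

/-- `G` produces hypergeometric deviates; a trial takes at most `a` steps and succeeds with
probability at least `q`. -/
def Generator.HasConstants (G : Generator) (a : ℕ) (q : ℝ≥0∞) : Prop :=
  0 < q ∧ q ≤ 1 ∧ ∀ n l N : ℕ, n ≤ N → l ≤ N →
    ∃ s, q ≤ s ∧ TrialLaw (G.trial n l N) (hyperLaw n l N) a s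

lemma Generator.IsHypergeometric.exists_constants {G : Generator} (hG : G.IsHypergeometric) :
    ∃ a q, G.HasConstants a q := by
  obtain ⟨a, q, hq, h⟩ := hG
  have h' := fun n l N hn hl => trialLaw_generator (h n l N hn hl)
  refine ⟨a, ENNReal.ofReal q, ENNReal.ofReal_pos.2 hq, ?_, h'⟩
  obtain ⟨s, hs, H⟩ := h' 0 0 0 le_rfl le_rfl
  exact hs.trans (H.accept ▸ prob_le_one)

section Generator

variable {G : Generator} {a : ℕ} {q : ℝ≥0∞}

lemma Generator.HasConstants.deviate (hG : G.HasConstants a q) {n l N : ℕ} (hn : n ≤ N) (hl : l ≤ N)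
    {e : ℕ → Key} (he : Function.Injective e) :
    Deviate (Set.range e) (fun h => G.run n l N fun t => h (e t)) (hyperLaw n l N) := by
  obtain ⟨s, hs, H⟩ := hG.2.2 n l N hn hl
  exact retry_deviate H he (hG.1.trans_le hs) fun i => ⟨i, rfl⟩

lemma Generator.HasConstants.jointCost (hG : G.HasConstants a q) {n l N : ℕ} (hn : n ≤ N)
    (hl : l ≤ N) {e : ℕ → Key} (he : Function.Injective e) {w : ℝ≥0∞} (hw : 1 ≤ w)
    (hw' : (1 - q) * w ^ a < 1) :
    JointCost w (Set.range e) (fun h => G.run n l N fun t => h (e t)) (retryFactor q (w ^ a)) := by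
  obtain ⟨s, hs, H⟩ := hG.2.2 n l N hn hl
  exact retry_jointCost H he hG.1 hs hw hw' fun i => ⟨i, rfl⟩

end Generator

/-! ## Algorithm R -/

/-- With `a`, `b` the two halves of the universe: a sample of at least two elements falls into a
single half with probability at most 1/2. -/
lemma two_mul_choose_add_le {a b m : ℕ} (hab : a ≤ b) (hba : b ≤ a + 1) (hm : 2 ≤ m) :
    2 * (a.choose m + b.choose m) ≤ (a + b).choose m := by
  induction m, hm using Nat.le_induction with
  | base =>
    have h : (2 * ((a.choose 2 : ℝ) + (b.choose 2 : ℝ))) ≤ ((a + b).choose 2 : ℝ) := by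
      rw [Nat.cast_choose_two, Nat.cast_choose_two, Nat.cast_choose_two]
      have h0 : (0 : ℝ) ≤ a := Nat.cast_nonneg a
      rcases (by omega : b = a ∨ b = a + 1) with rfl | rfl
      · push_cast; nlinarith
      · push_cast; nlinarith
    exact_mod_cast h
  | succ m hm ih =>
    have h1 := Nat.choose_succ_right_eq a m
    have h2 := Nat.choose_succ_right_eq b m
    have h3 := Nat.choose_succ_right_eq (a + b) m
    refine Nat.le_of_mul_le_mul_right (c := m + 1) ?_ (Nat.succ_pos m)
    calc 2 * (a.choose (m + 1) + b.choose (m + 1)) * (m + 1)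
        = 2 * (a.choose (m + 1) * (m + 1) + b.choose (m + 1) * (m + 1)) := by ring
      _ = 2 * (a.choose m * (a - m) + b.choose m * (b - m)) := by rw [h1, h2]
      _ ≤ 2 * (a.choose m * (a + b - m) + b.choose m * (a + b - m)) := by gcongr <;> omega
      _ = 2 * (a.choose m + b.choose m) * (a + b - m) := by ring
      _ ≤ (a + b).choose m * (a + b - m) := Nat.mul_le_mul_right _ ih
      _ = _ := h3.symm

lemma hyperLaw_trivial_le {m M : ℕ} (hm : 2 ≤ m) (hM : m ≤ M) :
    hyperLaw m (M / 2) M 0 + hyperLaw m (M / 2) M m ≤ ENNReal.ofReal (1 / 2) := by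
  unfold hyperLaw
  rw [← ENNReal.ofReal_add (hyperPMF_nonneg _ _ _ _) (hyperPMF_nonneg _ _ _ _)]
  refine ENNReal.ofReal_le_ofReal ?_
  have hc : (0 : ℝ) < (M.choose m : ℝ) := by exact_mod_cast Nat.choose_pos hM
  have h := two_mul_choose_add_le (a := M / 2) (b := M - M / 2) (m := m) (by omega) (by omega) hm
  rw [show M / 2 + (M - M / 2) = M by omega] at h
  have h' : 2 * (((M / 2).choose m : ℝ) + ((M - M / 2).choose m : ℝ)) ≤ (M.choose m : ℝ) := by
    exact_mod_cast h
  simp only [hyperPMF, Nat.choose_zero_right, Nat.cast_one, one_mul, Nat.sub_zero, zero_le, if_true,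
    mul_one, le_refl, Nat.sub_self]
  rw [← add_div, div_le_iff₀ hc]
  linarith

/-- Potential function for the analysis of Algorithm R. -/
noncomputable def potential (m : ℕ) : ℝ := if m = 0 then 5 / 4 else 4 ^ m / 3

lemma potential_pos (m : ℕ) : 0 < potential m := by
  unfold potential
  split_ifs <;> positivity

lemma five_fourths_le_potential (m : ℕ) : 5 / 4 ≤ potential m := by
  unfold potential
  split_ifs with h
  · exact le_rfl
  · have : (4 : ℝ) ^ 1 ≤ 4 ^ m := pow_le_pow_right₀ (by norm_num) (by omega)
    linarith

lemma potential_le (m : ℕ) : potential m ≤ 4 ^ (m + 1) := by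
  unfold potential
  split_ifs with h
  · subst h; norm_num
  · have : (0 : ℝ) < 4 ^ m := by positivity
    rw [pow_succ]; linarith

lemma potential_zero : potential 0 = 5 / 4 := if_pos rfl

lemma potential_of_ne {m : ℕ} (hm : m ≠ 0) : potential m = 4 ^ m / 3 := if_neg hm

/-- A proper split divides the potential `4^m / 3` by 3, whereas a trivial one multiplies it by
`5/4`, the price of an empty subproblem. The constant `11/36` is `5/12 - 1/9`. -/
lemma potential_mul_le {m x : ℕ} (hm : 2 ≤ m) (hx : x ≤ m) : potential x * potential (m - x) ≤
    4 ^ m / 9 + if x = 0 ∨ x = m then 11 / 36 * 4 ^ m else 0 := by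
  have h4 : (0 : ℝ) < 4 ^ m := by positivity
  by_cases h0 : x = 0
  · subst h0
    rw [if_pos (Or.inl rfl)]
    rw [Nat.sub_zero, potential_zero, potential_of_ne (by omega)]
    linarith
  · by_cases h1 : x = m
    · subst h1
      rw [if_pos (Or.inr rfl)]
      rw [Nat.sub_self, potential_zero, potential_of_ne h0]
      linarith
    · rw [if_neg (by tauto)]
      rw [potential_of_ne h0, potential_of_ne (by omega : m - x ≠ 0)]
      have : (4 : ℝ) ^ m = 4 ^ x * 4 ^ (m - x) := by rw [← pow_add]; congr 1; omega
      rw [this]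
      linarith

/-- Trivial splits have probability at most 1/2, so the mean is at most `(1/9 + 11/72) 4^m = (19/24)
(4^m / 3)`. The factor `4/5` leaves room for the steps spent at the node. -/
lemma tsum_potential_le {m M : ℕ} (hm : 2 ≤ m) (hM : m ≤ M)
    (hsum : ∑' x, hyperLaw m (M / 2) M x = 1) :
    ∑' x, hyperLaw m (M / 2) M x *
      (ENNReal.ofReal (potential x) * ENNReal.ofReal (potential (m - x))) ≤
      ENNReal.ofReal (4 / 5 * potential m) := by
  set P := hyperLaw m (M / 2) M with hP
  have h4 : (0 : ℝ) < 4 ^ m := by positivity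
  have hterm : ∀ x, P x * (ENNReal.ofReal (potential x) * ENNReal.ofReal (potential (m - x))) ≤
      P x * ENNReal.ofReal (4 ^ m / 9) +
        (if x = 0 ∨ x = m then P x * ENNReal.ofReal (11 / 36 * 4 ^ m) else 0) := by
    intro x
    by_cases hx : P x = 0
    · simp [hx]
    · have hxm := (hyperLaw_ne_zero hx).1
      rw [← ENNReal.ofReal_mul (potential_pos x).le]
      calc _ ≤ P x * ENNReal.ofReal
            (4 ^ m / 9 + if x = 0 ∨ x = m then 11 / 36 * 4 ^ m else 0) := by
            gcongr
            exact potential_mul_le hm hxm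
        _ = _ := by
            rw [ENNReal.ofReal_add (by positivity) (by split_ifs <;> positivity), mul_add]
            split_ifs <;> simp
  have hfin : ∑' x, (if x = 0 ∨ x = m then P x * ENNReal.ofReal (11 / 36 * 4 ^ m) else 0) =
      (P 0 + P m) * ENNReal.ofReal (11 / 36 * 4 ^ m) := by
    rw [tsum_eq_sum (s := {0, m}) fun x hx => if_neg (by simpa using hx),
      Finset.sum_pair (by omega)]
    simp [add_mul]
  calc _ ≤ ∑' x, (P x * ENNReal.ofReal (4 ^ m / 9) +
        (if x = 0 ∨ x = m then P x * ENNReal.ofReal (11 / 36 * 4 ^ m) else 0)) :=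
        ENNReal.tsum_le_tsum hterm
    _ = ENNReal.ofReal (4 ^ m / 9) + (P 0 + P m) * ENNReal.ofReal (11 / 36 * 4 ^ m) := by
        rw [ENNReal.tsum_add, ENNReal.tsum_mul_right, hsum, one_mul, hfin]
    _ ≤ ENNReal.ofReal (4 ^ m / 9) + ENNReal.ofReal (1 / 2) * ENNReal.ofReal (11 / 36 * 4 ^ m) := by
        gcongr
        exact hyperLaw_trivial_le hm hM
    _ = ENNReal.ofReal (4 ^ m / 9 + 1 / 2 * (11 / 36 * 4 ^ m)) := by
        rw [← ENNReal.ofReal_mul (by norm_num), ← ENNReal.ofReal_add (by positivity) (by positivity)]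
    _ ≤ _ := by
        refine ENNReal.ofReal_le_ofReal ?_
        rw [potential_of_ne (by omega : m ≠ 0)]
        linarith

section AlgR

variable {G : Generator} {a : ℕ} {q : ℝ≥0∞} {n₀ : ℕ}
  {base : ℕ → ℕ → ℕ → Source → Run (List ℕ)}

lemma algR_base {m M off : ℕ} {s : Source} (h : m < n₀ ∨ M < 2) :
    algR G n₀ base m M off s = base m M off s >>= fun T => ops 2 T := by
  rw [algR, dif_pos h]

lemma algR_split {m M off : ℕ} {s : Source} (h : ¬ (m < n₀ ∨ M < 2)) :
    algR G n₀ base m M off s = G.run m (M / 2) M s.stream >>= fun x =>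
      algR G n₀ base x (M / 2) off (s.sub 1) >>= fun A =>
      algR G n₀ base (m - x) (M - M / 2) (off + M / 2) (s.sub 2) >>= fun B => ops 8 (A ++ B) := by
  rw [algR, dif_neg h]

lemma algR_samples (hG : G.HasConstants a q)
    (hbase : ∀ (m M off : ℕ) (e : List ℕ → Key), Function.Injective e → m ≤ M →
      Samples (localKeys e) (fun h => (base m M off fun p => h (e p)).val) off M m) (M : ℕ) :
    ∀ (m off : ℕ) (e : List ℕ → Key), Function.Injective e → m ≤ M →
      Samples (localKeys e) (fun h => (algR G n₀ base m M off fun p => h (e p)).val) off M m := by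
  induction M using Nat.strong_induction_on with
  | _ M ih =>
    intro m off e he hm
    by_cases h : m < n₀ ∨ M < 2
    · simp only [algR_base h]
      exact hbase m M off e he hm
    · simp only [algR_split h]
      have hD := hG.deviate hm (Nat.div_le_self M 2) (injective_stream he)
      exact Samples.append (disjoint_stream_sub he 1) (disjoint_stream_sub he 2)
        (disjoint_sub_sub he (by norm_num)) streamKeys_subset (localKeys_sub_subset 1)
        (localKeys_sub_subset 2) hm (Nat.div_le_self M 2)
        (L := fun x h => (algR G n₀ base x (M / 2) off fun p => h (e (1 :: p))).val)
        (R := fun x h => (algR G n₀ base (m - x) (M - M / 2) (off + M / 2)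
          fun p => h (e (2 :: p))).val) hD.obs hD.law
        (fun x hx => ih _ (by omega) x off _ (injective_sub he 1) hx)
        (fun x hx => ih _ (by omega) (m - x) _ _ (injective_sub he 2) hx)

/-- At a node the overhead `5/4` is compensated by the factor `4/5` of `tsum_potential_le`; hence
the bound depends on `m` only, although the depth of the recursion grows with `M`. The base case
fits because the potential never drops below `5/4`. -/
lemma algR_cost (hG : G.HasConstants a q) (hn₀ : 2 ≤ n₀) {w : ℝ≥0∞} (hw : 1 ≤ w)
    (hwq : (1 - q) * w ^ a < 1) (hgw : retryFactor q (w ^ a) * w ^ 8 ≤ ENNReal.ofReal (5 / 4))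
    {E : ℝ≥0∞} (hE : E * w ^ 2 ≤ ENNReal.ofReal (5 / 4))
    (hbase : ∀ (m M off : ℕ) (e : List ℕ → Key), Function.Injective e → m ≤ M → m < n₀ →
      Cost w (localKeys e) (fun h => base m M off fun p => h (e p)) E) (M : ℕ) :
    ∀ (m off : ℕ) (e : List ℕ → Key), Function.Injective e → m ≤ M →
      Cost w (localKeys e) (fun h => algR G n₀ base m M off fun p => h (e p))
        (ENNReal.ofReal (potential m)) := by
  induction M using Nat.strong_induction_on with
  | _ M ih =>
    intro m off e he hm
    by_cases h : m < n₀ ∨ M < 2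
    · simp only [algR_base h]
      exact (Cost.time_add hw (hbase m M off e he hm (by omega))
        (Filter.Eventually.of_forall fun x => le_rfl)).mono le_rfl
        (hE.trans (ENNReal.ofReal_le_ofReal (five_fourths_le_potential m)))
    · simp only [algR_split h]
      have hD := hG.deviate hm (Nat.div_le_self M 2) (injective_stream he)
      have hJ := hG.jointCost hm (Nat.div_le_self M 2) (injective_stream he) hw hwq
      have hC : ∀ x, hashLaw {h | (G.run m (M / 2) M fun t => h (e [t])).val = x} ≠ 0 →
          Cost w (localKeys (fun p => e (1 :: p)) ∪ localKeys fun p => e (2 :: p)) (fun h =>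
            algR G n₀ base x (M / 2) off (fun p => h (e (1 :: p))) >>= fun A =>
            algR G n₀ base (m - x) (M - M / 2) (off + M / 2) (fun p => h (e (2 :: p))) >>= fun B =>
            ops 8 (A ++ B))
          (ENNReal.ofReal (potential x) * ENNReal.ofReal (potential (m - x)) * w ^ 8) := by
        intro x hx
        rw [hD.law] at hx
        obtain ⟨_, h2, h3⟩ := hyperLaw_ne_zero hx
        refine Cost.time_add hw (Cost.add hw (disjoint_sub_sub he (by norm_num))
          (ih _ (by omega) x off _ (injective_sub he 1) h2)
          (ih _ (by omega) (m - x) (off + M / 2) _ (injective_sub he 2) h3))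
          (Filter.Eventually.of_forall fun y => ?_)
        simp only [bind_time, ops_time, add_assoc]
        exact le_rfl
      have hkey := Cost.bind hw (Set.disjoint_union_right.2
        ⟨disjoint_stream_sub he 1, disjoint_stream_sub he 2⟩) hD.obs hJ hC
      refine hkey.mono (Set.union_subset streamKeys_subset
        (Set.union_subset (localKeys_sub_subset 1) (localKeys_sub_subset 2))) ?_
      have hsum : ∑' x, hyperLaw m (M / 2) M x = 1 := by
        rw [← hD.obs.tsum_law]
        exact tsum_congr fun x => (hD.law x).symm
      calc _ = (retryFactor q (w ^ a) * w ^ 8) * ∑' x, hyperLaw m (M / 2) M x *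
            (ENNReal.ofReal (potential x) * ENNReal.ofReal (potential (m - x))) := by
            rw [mul_assoc, ← ENNReal.tsum_mul_left (a := w ^ 8)]
            refine congrArg (retryFactor q (w ^ a) * ·) (tsum_congr fun x => ?_)
            rw [← hD.law x]
            ring
        _ ≤ ENNReal.ofReal (5 / 4) * ENNReal.ofReal (4 / 5 * potential m) :=
            mul_le_mul' hgw (tsum_potential_le (by omega) hm hsum)
        _ = _ := by
            rw [← ENNReal.ofReal_mul (by norm_num)]
            congr 1
            ring

end AlgR

/-! ## The local algorithms -/

lemma LocalSampler.run_samples {G : Generator} {a : ℕ} {q : ℝ≥0∞} (hG : G.HasConstants a q)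
    (L : LocalSampler) (m M off : ℕ) {e : List ℕ → Key} (he : Function.Injective e) (hm : m ≤ M) :
    Samples (localKeys e) (fun h => (L.run G m M off fun p => h (e p)).val) off M m := by
  cases L with
  | H => exact algH_samples off hm he
  | D r => exact algD_samples m M off e he hm
  | RH n₀ cells =>
    exact algR_samples hG (fun m M off e he hm => algH_samples off hm he) M m off e he hm
  | RD n₀ r =>
    exact algR_samples hG (fun m M off e he hm => algD_samples m M off e he hm) M m off e he hm

lemma tendsto_pow_one (c : ℕ) :
    Filter.Tendsto (fun w : ℝ≥0∞ => w ^ c) (nhds 1) (nhds 1) := by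
  simpa using (ENNReal.continuous_pow c).tendsto 1

lemma tendsto_factor {q : ℝ≥0∞} (hq : 0 < q) (hq1 : q ≤ 1) (a b c d : ℕ) :
    Filter.Tendsto (fun w : ℝ≥0∞ => (retryFactor q (w ^ a) * w ^ b) ^ c * w ^ d) (nhds 1)
      (nhds 1) := by
  have h1 := ENNReal.Tendsto.mul (tendsto_retryFactor hq hq1 a) (Or.inl one_ne_zero)
    (tendsto_pow_one b) (Or.inl one_ne_zero)
  rw [mul_one] at h1
  have h2 := ENNReal.Tendsto.mul ((tendsto_pow_one c).comp h1) (Or.inl one_ne_zero)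
    (tendsto_pow_one d) (Or.inl one_ne_zero)
  rwa [mul_one] at h2

lemma eventually_factor_le {q : ℝ≥0∞} (hq : 0 < q) (hq1 : q ≤ 1) (a b c d : ℕ) {B : ℝ≥0∞}
    (hB : 1 < B) :
    ∀ᶠ w : ℝ≥0∞ in nhds 1, (retryFactor q (w ^ a) * w ^ b) ^ c * w ^ d ≤ B :=
  ((tendsto_factor hq hq1 a b c d).eventually_lt_const hB).mono fun _ h => h.le

lemma eventually_reject_lt {q : ℝ≥0∞} (hq : 0 < q) (a : ℕ) :
    ∀ᶠ w : ℝ≥0∞ in nhds 1, (1 - q) * w ^ a < 1 := by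
  have h2 : Filter.Tendsto (fun w : ℝ≥0∞ => (1 - q) * w ^ a) (nhds 1) (nhds ((1 - q) * 1)) :=
    ENNReal.Tendsto.const_mul (tendsto_pow_one a) (Or.inl one_ne_zero)
  rw [mul_one] at h2
  exact h2.eventually_lt_const (ENNReal.sub_lt_self ENNReal.one_ne_top one_ne_zero hq.ne')

lemma ChainBound.mono {cells M t t' b b' : ℕ} (h : ChainBound cells M t b) (ht : t' ≤ t)
    (hb : b ≤ b') : ChainBound cells M t' b' :=
  fun T hT hl x hx => (h T hT (hl.trans ht) x hx).trans hb

/-- All factors in the cost bounds of H, D and R are products of a `retryFactor` and powers of `w`,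
with exponents fixed by the tuning parameters, and so tend to 1. H and D need the factor per element
to be at most 4; R needs its node and base costs to be at most `5/4`. -/
theorem LocalSampler.eventually_cost {G : Generator} {a : ℕ} {q : ℝ≥0∞} (hG : G.HasConstants a q)
    {L : LocalSampler} (hL : L.Proper) :
    ∀ᶠ w : ℝ≥0∞ in nhds 1, 1 ≤ w → ∀ (m M off : ℕ) (e : List ℕ → Key), Function.Injective e →
      m ≤ M → Cost w (localKeys e) (fun h => L.run G m M off fun p => h (e p)) (4 ^ (m + 1)) := by
  have hhalf : (0 : ℝ≥0∞) < 2⁻¹ := by simp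
  have hhalf1 : (2⁻¹ : ℝ≥0∞) ≤ 1 := by simp
  have h54 : (1 : ℝ≥0∞) < ENNReal.ofReal (5 / 4) := by
    rw [← ENNReal.ofReal_one]
    exact (ENNReal.ofReal_lt_ofReal_iff (by norm_num)).2 (by norm_num)
  have hpot : ∀ m, ENNReal.ofReal (potential m) ≤ 4 ^ (m + 1) := by
    intro m
    refine (ENNReal.ofReal_le_ofReal (potential_le m)).trans (le_of_eq ?_)
    rw [ENNReal.ofReal_pow (by norm_num)]
    norm_num
  cases L with
  | H =>
    filter_upwards [eventually_factor_le hhalf hhalf1 11 22 1 0 (B := 4) (by norm_num),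
      eventually_reject_lt hhalf 11] with w h1 h2 hw m M off e he hm
    simp only [pow_one, pow_zero, mul_one] at h1
    exact (algH_cost off hm he (chainBound_injective M m) hw h2).mono le_rfl
      (pow_le_pow_left₀ zero_le h1 _)
  | D r =>
    filter_upwards [eventually_factor_le hhalf hhalf1 48 (7 * r + 16) 1 0 (B := 4) (by norm_num),
      eventually_reject_lt hhalf 48] with w h1 h2 hw m M off e he hm
    simp only [pow_one, pow_zero, mul_one] at h1
    exact (algD_cost hL hw h2 m M off e he hm).mono le_rfl (pow_le_pow_left₀ zero_le h1 _)
  | RH n₀ cells =>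
    filter_upwards [eventually_factor_le hhalf hhalf1 (9 + 2 * n₀) (18 + 4 * n₀) n₀ 2 h54,
      eventually_reject_lt hhalf (9 + 2 * n₀), eventually_factor_le hG.1 hG.2.1 a 8 1 0 h54,
      eventually_reject_lt hG.1 a] with w h1 h2 h3 h4 hw m M off e he hm
    simp only [pow_one, pow_zero, mul_one] at h3
    refine (algR_cost hG hL hw h4 h3 h1 (fun m M off e he hm hmn => ?_) M m off e he hm).mono
      le_rfl (hpot m)
    refine (algH_cost off hm he ((chainBound_length cells M m).mono le_rfl hmn.le) hw h2).mono
      le_rfl (pow_le_pow_right₀ ?_ hmn)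
    exact one_le_mul (by rw [retryFactor]; exact le_self_add) (one_le_pow₀ hw)
  | RD n₀ r =>
    filter_upwards [eventually_factor_le hhalf hhalf1 48 (7 * r + 16) n₀ 2 h54,
      eventually_reject_lt hhalf 48, eventually_factor_le hG.1 hG.2.1 a 8 1 0 h54,
      eventually_reject_lt hG.1 a] with w h1 h2 h3 h4 hw m M off e he hm
    simp only [pow_one, pow_zero, mul_one] at h3
    refine (algR_cost hG hL.1 hw h4 h3 h1 (fun m M off e he hm hmn => ?_) M m off e he hm).mono
      le_rfl (hpot m)
    refine (algD_cost hL.2 hw h2 m M off e he hm).mono le_rfl (pow_le_pow_right₀ ?_ hmn)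
    exact one_le_mul (by rw [retryFactor]; exact le_self_add) (one_le_pow₀ hw)

/-! ## Exponential moments of the hypergeometric distribution -/

lemma choose_le_pow_mul {l N : ℕ} (hl : l ≤ N) (k : ℕ) :
    (l.choose k : ℝ) ≤ ((l : ℝ) / N) ^ k * (N.choose k : ℝ) := by
  rcases Nat.eq_zero_or_pos N with rfl | hN
  · obtain rfl : l = 0 := by omega
    cases k <;> simp
  · have h := choose_sub_le (Nat.sub_le N l) k
    have hN' : (N : ℝ) ≠ 0 := by exact_mod_cast hN.ne'
    rw [Nat.sub_sub_self hl, Nat.cast_sub hl, sub_div, div_self hN', sub_sub_cancel] at h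
    exact h

open Polynomial in
-- Compare the coefficients of `X^n` in `(1 + (1 + y) X)^l (1 + X)^r`, where the first base is
-- expanded as `y X + (1 + X)`. This expresses the exponential moment through factorial moments,
-- whose terms are nonnegative for `y ≥ 0`.
lemma sum_choose_mul_pow (l r n : ℕ) (y : ℝ) :
    ∑ z ∈ Finset.HasAntidiagonal.antidiagonal n, (l.choose z.1 : ℝ) * (r.choose z.2 : ℝ) * (1 + y) ^ z.1 =
      ∑ k ∈ Finset.range (l + 1),
        if k ≤ n then (l.choose k : ℝ) * y ^ k * ((l - k + r).choose (n - k) : ℝ) else 0 := by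
  have h1 : (1 + C (1 + y) * X : ℝ[X]) ^ l * (1 + X) ^ r =
      ∑ k ∈ Finset.range (l + 1), C ((l.choose k : ℝ) * y ^ k) * (X ^ k * (1 + X) ^ (l - k + r)) := by
    have : (1 + C (1 + y) * X : ℝ[X]) = C y * X + (1 + X) := by
      rw [C_add, C_1]; ring
    rw [this, add_pow, Finset.sum_mul]
    refine Finset.sum_congr rfl fun k _ => ?_
    rw [C_mul, C_pow, pow_add, mul_pow, ← C_eq_natCast]
    simp only [map_natCast]
    ring
  have h3 : ∀ i, ((1 + C (1 + y) * X : ℝ[X]) ^ l).coeff i = (l.choose i : ℝ) * (1 + y) ^ i := by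
    intro i
    have : (1 + C (1 + y) * X : ℝ[X]) ^ l = ((1 + X : ℝ[X]) ^ l).comp (C (1 + y) * X) := by simp
    rw [this, comp_C_mul_X_coeff, coeff_one_add_X_pow]
  calc _ = ∑ x ∈ Finset.HasAntidiagonal.antidiagonal n,
        ((1 + C (1 + y) * X : ℝ[X]) ^ l).coeff x.1 * ((1 + X : ℝ[X]) ^ r).coeff x.2 := by
        refine Finset.sum_congr rfl fun z _ => ?_
        rw [h3, coeff_one_add_X_pow]
        ring
    _ = _ := by
        rw [← coeff_mul, h1, finsetSum_coeff]
        refine Finset.sum_congr rfl fun k _ => ?_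
        rw [coeff_C_mul, coeff_X_pow_mul', coeff_one_add_X_pow]
        split_ifs <;> simp

/-- Each term is compared with the binomial one: `l choose k` is at most `(l / (l + r))^k` times `l
+ r choose k`, and the rest regroups into `(l + r choose n) (n choose k)`. -/
lemma sum_choose_mul_pow_le {l r n : ℕ} {y : ℝ} (hy : 0 ≤ y) :
    ∑ z ∈ Finset.HasAntidiagonal.antidiagonal n, (l.choose z.1 : ℝ) * (r.choose z.2 : ℝ) * (1 + y) ^ z.1 ≤
      ((l + r).choose n : ℝ) * (1 + y * ((l : ℝ) / ((l + r : ℕ) : ℝ))) ^ n := by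
  rw [sum_choose_mul_pow, add_comm (1 : ℝ), add_pow, Finset.mul_sum, ← Finset.sum_filter]
  set q : ℝ := (l : ℝ) / ((l + r : ℕ) : ℝ) with hq
  have hq0 : 0 ≤ q := by positivity
  have hsub : (Finset.range (l + 1)).filter (· ≤ n) ⊆ Finset.range (n + 1) := by
    intro k hk
    have := (Finset.mem_filter.1 hk).2
    exact Finset.mem_range.2 (by omega)
  refine le_trans (Finset.sum_le_sum fun k hk => ?_) (Finset.sum_le_sum_of_subset_of_nonneg hsub
    fun k _ _ => by positivity)
  obtain ⟨hk1, hk2⟩ := Finset.mem_filter.1 hk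
  have hkl : k ≤ l := by have := Finset.mem_range.1 hk1; omega
  have h1 := choose_le_pow_mul (Nat.le_add_right l r) k
  have h2 : ((l + r).choose n : ℝ) * (n.choose k : ℝ) =
      ((l + r).choose k : ℝ) * ((l + r - k).choose (n - k) : ℝ) := by
    exact_mod_cast Nat.choose_mul hk2
  rw [show l - k + r = l + r - k by omega]
  calc _ ≤ (q ^ k * ((l + r).choose k : ℝ)) * y ^ k * ((l + r - k).choose (n - k) : ℝ) := by gcongr
    _ = (y * q) ^ k * (((l + r).choose k : ℝ) * ((l + r - k).choose (n - k) : ℝ)) := by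
        rw [mul_pow]; ring
    _ = _ := by rw [← h2]; ring

lemma tsum_hyperLaw_mul {n l N : ℕ} (hn : n ≤ N) {f : ℕ → ℝ} (hf : ∀ x, 0 ≤ f x) :
    ∑' x, hyperLaw n l N x * ENNReal.ofReal (f x) =
      ENNReal.ofReal ((∑ z ∈ Finset.HasAntidiagonal.antidiagonal n,
        (l.choose z.1 : ℝ) * ((N - l).choose z.2 : ℝ) * f z.1) / (N.choose n : ℝ)) := by
  have hout : ∀ x ∉ Finset.range (n + 1), hyperLaw n l N x * ENNReal.ofReal (f x) = 0 := by
    intro x hx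
    have : ¬ x ≤ n := by have := Finset.mem_range.not.1 hx; omega
    rw [hyperLaw_eq hn, if_neg this, zero_mul]
  rw [tsum_eq_sum hout, Finset.Nat.sum_antidiagonal_eq_sum_range_succ_mk, Finset.sum_div,
    ENNReal.ofReal_sum_of_nonneg fun x _ => div_nonneg (mul_nonneg (by positivity) (hf x))
      (by positivity)]
  refine Finset.sum_congr rfl fun x hx => ?_
  have hx' : x ≤ n := by have := Finset.mem_range.1 hx; omega
  rw [hyperLaw, ← ENNReal.ofReal_mul (hyperPMF_nonneg _ _ _ _), hyperPMF, if_pos hx']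
  congr 1
  ring

/-- Sampling without replacement has exponential moments no larger than those of `n` independent
draws with success probability `l / N`. -/
lemma hyperLaw_moment {n l N : ℕ} (hn : n ≤ N) (hl : l ≤ N) {y : ℝ} (hy : 0 ≤ y) :
    ∑' x, hyperLaw n l N x * ENNReal.ofReal ((1 + y) ^ x) ≤
      ENNReal.ofReal ((1 + y * ((l : ℝ) / N)) ^ n) := by
  rw [tsum_hyperLaw_mul hn fun x => by positivity]
  refine ENNReal.ofReal_le_ofReal ?_
  have hc : (0 : ℝ) < (N.choose n : ℝ) := by exact_mod_cast Nat.choose_pos hn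
  have h := sum_choose_mul_pow_le (l := l) (r := N - l) (n := n) hy
  rw [Nat.add_sub_of_le hl] at h
  rw [div_le_iff₀ hc, mul_comm _ (N.choose n : ℝ)]
  exact h

lemma hyperLaw_moment_compl {n l N : ℕ} (hn : n ≤ N) (hl : l ≤ N) {y : ℝ} (hy : 0 ≤ y) :
    ∑' x, hyperLaw n l N x * ENNReal.ofReal ((1 + y) ^ (n - x)) ≤
      ENNReal.ofReal ((1 + y * (((N - l : ℕ) : ℝ) / N)) ^ n) := by
  rw [tsum_hyperLaw_mul hn fun x => by positivity]
  refine ENNReal.ofReal_le_ofReal ?_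
  have hc : (0 : ℝ) < (N.choose n : ℝ) := by exact_mod_cast Nat.choose_pos hn
  have h := sum_choose_mul_pow_le (l := N - l) (r := l) (n := n) hy
  rw [Nat.sub_add_cancel hl] at h
  rw [div_le_iff₀ hc, mul_comm _ (N.choose n : ℝ)]
  refine le_trans (le_of_eq ?_) h
  rw [← Finset.Nat.sum_antidiagonal_swap]
  refine Finset.sum_congr rfl fun z hz => ?_
  have := Finset.HasAntidiagonal.mem_antidiagonal.1 hz
  rw [Prod.fst_swap, Prod.snd_swap, show n - z.2 = z.1 by omega]
  ring

/-! ## Algorithm P -/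

/-- The keys that are used to sample on the processors `j..k`. -/
def treeKeys (j k : ℕ) : Set Key :=
  {κ | (∃ j' k' t, κ = .node j' k' t ∧ j ≤ j' ∧ j' ≤ k' ∧ k' ≤ k) ∨
    ∃ i path, κ = .seed i path ∧ j ≤ i ∧ i ≤ k}

lemma injective_seed (i : ℕ) : Function.Injective (Key.seed i) := fun _ _ h => by
  injection h

lemma injective_node (j k : ℕ) : Function.Injective (Key.node j k) := fun _ _ h => by
  injection h

lemma localKeys_seed_subset {i j k : ℕ} (hj : j ≤ i) (hk : i ≤ k) :
    localKeys (Key.seed i) ⊆ treeKeys j k := by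
  rintro _ ⟨p, _, rfl⟩
  exact Or.inr ⟨i, p, rfl, hj, hk⟩

lemma range_node_subset {j k : ℕ} (h : j ≤ k) : Set.range (Key.node j k) ⊆ treeKeys j k := by
  rintro _ ⟨t, rfl⟩
  exact Or.inl ⟨j, k, t, rfl, le_rfl, h, le_rfl⟩

lemma treeKeys_subset {j k j' k' : ℕ} (hj : j ≤ j') (hk : k' ≤ k) :
    treeKeys j' k' ⊆ treeKeys j k := by
  rintro _ (⟨a, b, t, rfl, h1, h2, h3⟩ | ⟨i, p, rfl, h1, h2⟩)
  · exact Or.inl ⟨a, b, t, rfl, hj.trans h1, h2, h3.trans hk⟩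
  · exact Or.inr ⟨i, p, rfl, hj.trans h1, h2.trans hk⟩

lemma disjoint_treeKeys {j m j' k : ℕ} (h : m < j') : Disjoint (treeKeys j m) (treeKeys j' k) := by
  rw [Set.disjoint_left]
  rintro _ (⟨a, b, t, rfl, h1, h2, h3⟩ | ⟨i, p, rfl, h1, h2⟩)
  · rintro (⟨a', b', t', h4, h5, h6, h7⟩ | ⟨i', p', h4, h5, h6⟩)
    · injection h4
      omega
    · exact Key.noConfusion h4
  · rintro (⟨a', b', t', h4, h5, h6, h7⟩ | ⟨i', p', h4, h5, h6⟩)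
    · exact Key.noConfusion h4
    · injection h4
      omega

/-- The interval of a node is not contained in the interval of a child, so its split is independent
of everything below. -/
lemma disjoint_node_treeKeys {j k j' k' : ℕ} (h : j < j' ∨ k' < k) :
    Disjoint (Set.range (Key.node j k)) (treeKeys j' k') := by
  rw [Set.disjoint_left]
  rintro _ ⟨t, rfl⟩ (⟨a, b, t', h1, h2, h3, h4⟩ | ⟨i, p, h1, h2⟩)
  · injection h1
    omega
  · exact Key.noConfusion h1

section Tree

variable {G : Generator} {a : ℕ} {q : ℝ≥0∞} {L : LocalSampler} {B : ℕ → ℕ} {p : ℕ}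

/-- The number of elements on `j..(j + k) / 2`, when a sample of size `n` is split. -/
noncomputable def splitRun (G : Generator) (B : ℕ → ℕ) (j k n : ℕ) (h : Key → I) : Run ℕ :=
  G.run n (B ((j + k) / 2) - B (j - 1)) (B k - B (j - 1)) fun t => h (.node j k t)

lemma sampleP_left {i j k n : ℕ} (h : Key → I) (hjk : j < k) (hi : i ≤ (j + k) / 2) :
    sampleP G L B i h n j k = splitRun G B j k n h >>= fun x => ops 12 () >>= fun _ =>
      sampleP G L B i h x j ((j + k) / 2) := by
  rw [sampleP, dif_pos hjk]
  simp only [if_pos hi]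
  rfl

lemma sampleP_right {i j k n : ℕ} (h : Key → I) (hjk : j < k) (hi : ¬ i ≤ (j + k) / 2) :
    sampleP G L B i h n j k = splitRun G B j k n h >>= fun x => ops 12 () >>= fun _ =>
      sampleP G L B i h (n - x) ((j + k) / 2 + 1) k := by
  rw [sampleP, dif_pos hjk]
  simp only [if_neg hi]
  rfl

lemma sampleP_leaf {i j k n : ℕ} (h : Key → I) (hjk : ¬ j < k) :
    sampleP G L B i h n j k = ops 5 () >>= fun _ =>
      L.run G n (B i - B (i - 1)) (B (i - 1)) fun path => h (.seed i path) := by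
  rw [sampleP, dif_neg hjk]

/-- The concatenation of the outputs of the processors `j..k`. -/
noncomputable def treeList (G : Generator) (L : LocalSampler) (B : ℕ → ℕ) (j k n : ℕ) (h : Key → I) :
    List ℕ :=
  (List.range' j (k + 1 - j)).flatMap fun i => (sampleP G L B i h n j k).val

/-- The split reads only keys of the node `j..k`, not of the individual processor: all processors of
the interval obtain the same `x` and continue consistently. -/
lemma treeList_split {j k n : ℕ} (h : Key → I) (hjk : j < k) :
    treeList G L B j k n h = treeList G L B j ((j + k) / 2) (splitRun G B j k n h).val h ++
      treeList G L B ((j + k) / 2 + 1) k (n - (splitRun G B j k n h).val) h := by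
  unfold treeList
  have e : List.range' j (k + 1 - j) = List.range' j ((j + k) / 2 + 1 - j) ++
      List.range' ((j + k) / 2 + 1) (k + 1 - ((j + k) / 2 + 1)) := by
    have := List.range'_append_1 (s := j) (m := (j + k) / 2 + 1 - j)
      (n := k + 1 - ((j + k) / 2 + 1))
    rw [show j + ((j + k) / 2 + 1 - j) = (j + k) / 2 + 1 by omega,
      show (j + k) / 2 + 1 - j + (k + 1 - ((j + k) / 2 + 1)) = k + 1 - j by omega] at this
    exact this.symm
  rw [e, List.flatMap_append]
  congr 1
  · refine List.flatMap_congr fun i hi => ?_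
    have := List.mem_range'_1.1 hi
    rw [sampleP_left h hjk (by omega)]
    rfl
  · refine List.flatMap_congr fun i hi => ?_
    have := List.mem_range'_1.1 hi
    rw [sampleP_right h hjk (by omega)]
    rfl

lemma splitRun_deviate (hB : ∀ i i', i ≤ i' → i' ≤ p → B i ≤ B i')
    (hG : G.HasConstants a q) {j k n : ℕ} (hjk : j < k) (hk : k ≤ p)
    (hn : n ≤ B k - B (j - 1)) :
    Deviate (Set.range (Key.node j k)) (splitRun G B j k n)
      (hyperLaw n (B ((j + k) / 2) - B (j - 1)) (B k - B (j - 1))) := by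
  have := hB ((j + k) / 2) k (by omega) hk
  exact hG.deviate hn (by omega) (injective_node j k)

/-- Induction on the length of the interval: a leaf is a local sample, an inner node an instance of
`Samples.append`. -/
theorem treeList_samples (hB : ∀ i i', i ≤ i' → i' ≤ p → B i ≤ B i')
    (hG : G.HasConstants a q) (d : ℕ) : ∀ j k n : ℕ, k - j = d → 1 ≤ j →
    j ≤ k → k ≤ p → n ≤ B k - B (j - 1) →
    Samples (treeKeys j k) (treeList G L B j k n) (B (j - 1)) (B k - B (j - 1)) n := by
  induction d using Nat.strong_induction_on with
  | _ d ih =>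
    intro j k n hd hj hjk hk hn
    rcases eq_or_lt_of_le hjk with rfl | hlt
    · have e : treeList G L B j j n = fun h => (L.run G n (B j - B (j - 1)) (B (j - 1))
          fun path => h (.seed j path)).val := by
        funext h
        simp [treeList, sampleP_leaf]
      rw [e]
      exact (L.run_samples hG n _ _ (injective_seed j) hn).mono (localKeys_seed_subset le_rfl le_rfl)
    · have hD := splitRun_deviate hB hG hlt hk hn
      have e : treeList G L B j k n = fun h =>
          treeList G L B j ((j + k) / 2) (splitRun G B j k n h).val h ++
          treeList G L B ((j + k) / 2 + 1) k (n - (splitRun G B j k n h).val) h := by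
        funext h
        exact treeList_split h hlt
      have b1 := hB (j - 1) ((j + k) / 2) (by omega) (by omega)
      have b2 := hB ((j + k) / 2) k (by omega) hk
      rw [e]
      refine Samples.append (T₁ := treeKeys j ((j + k) / 2))
        (T₂ := treeKeys ((j + k) / 2 + 1) k) (disjoint_node_treeKeys (Or.inr (by omega)))
        (disjoint_node_treeKeys (Or.inl (by omega))) (disjoint_treeKeys (by omega))
        (range_node_subset hjk) (treeKeys_subset le_rfl (by omega)) (treeKeys_subset (by omega) le_rfl)
        hn (by omega) (L := fun x => treeList G L B j ((j + k) / 2) x)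
        (R := fun x => treeList G L B ((j + k) / 2 + 1) k (n - x)) hD.obs hD.law
        (fun x hx => ih _ (by omega) _ _ _ rfl hj (by omega) (by omega) hx) (fun x hx => ?_)
      have := ih (k - ((j + k) / 2 + 1)) (by omega) ((j + k) / 2 + 1) k (n - x) rfl (by omega)
        (by omega) hk (by rw [Nat.add_sub_cancel]; omega)
      rw [Nat.add_sub_cancel] at this
      rw [show B (j - 1) + (B ((j + k) / 2) - B (j - 1)) = B ((j + k) / 2) by omega,
        show B k - B (j - 1) - (B ((j + k) / 2) - B (j - 1)) = B k - B ((j + k) / 2) by omega]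
      exact this

/-- The bound reproduces itself from child to parent: averaging `(1 + 3 Mi/l)^x` over the split
gives at most `(1 + 3 Mi/U)^n`, where `Mi`, `l` and `U` are the universe sizes of the processor, the
child and the node. Each level adds one factor for its split; the hypothesis `k - j < 2 ^ d` allows
`d` levels. -/
theorem sampleP_cost (hB : ∀ i i', i ≤ i' → i' ≤ p → B i ≤ B i')
    (hG : G.HasConstants a q) {w : ℝ≥0∞} (hw : 1 ≤ w)
    (hwq : (1 - q) * w ^ a < 1)
    (hL : ∀ (m M off : ℕ) (e : List ℕ → Key), Function.Injective e →
      m ≤ M → Cost w (localKeys e) (fun h => L.run G m M off fun p => h (e p)) (4 ^ (m + 1)))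
    {i : ℕ} (d : ℕ) : ∀ j k n : ℕ, k - j < 2 ^ d → 1 ≤ j → j ≤ i → i ≤ k → k ≤ p →
    n ≤ B k - B (j - 1) →
    Cost w (treeKeys j k) (fun h => sampleP G L B i h n j k)
      ((retryFactor q (w ^ a) * w ^ 12) ^ d * (4 * w ^ 5) * ENNReal.ofReal
        ((1 + 3 * (((B i - B (i - 1) : ℕ) : ℝ) / ((B k - B (j - 1) : ℕ) : ℝ))) ^ n)) := by
  have hg : 1 ≤ retryFactor q (w ^ a) * w ^ 12 :=
    one_le_mul (by rw [retryFactor]; exact le_self_add) (one_le_pow₀ hw)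
  have hleaf : ∀ d j n : ℕ, 1 ≤ j → j = i → n ≤ B j - B (j - 1) →
    Cost w (treeKeys j j) (fun h => sampleP G L B i h n j j)
      ((retryFactor q (w ^ a) * w ^ 12) ^ d * (4 * w ^ 5) * ENNReal.ofReal
        ((1 + 3 * (((B i - B (i - 1) : ℕ) : ℝ) / ((B j - B (j - 1) : ℕ) : ℝ))) ^ n)) := by
    rintro d j n hj rfl hn
    have h1 := Cost.time_add hw (R' := fun h => sampleP G L B j h n j j) (c := 5)
      (hL n (B j - B (j - 1)) (B (j - 1)) (Key.seed j) (injective_seed j) hn)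
      (Filter.Eventually.of_forall fun h => by
        rw [sampleP_leaf h (lt_irrefl j), ops_bind_time, add_comm])
    refine h1.mono (localKeys_seed_subset le_rfl le_rfl) ?_
    -- The 3 is chosen to give base 4 at a leaf. An empty universe makes the quotient `0 / 0 = 0`,
    -- but then `n = 0`.
    have h2 : (1 + 3 * (((B j - B (j - 1) : ℕ) : ℝ) / ((B j - B (j - 1) : ℕ) : ℝ))) ^ n =
        (4 : ℝ) ^ n := by
      rcases Nat.eq_zero_or_pos n with rfl | hn0
      · simp
      · rw [div_self]
        · norm_num
        · exact_mod_cast (by omega : B j - B (j - 1) ≠ 0)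
    have h3 : ENNReal.ofReal (4 ^ n) = 4 ^ n := by
      rw [ENNReal.ofReal_pow (by norm_num)]; norm_num
    rw [h2, h3]
    calc (4 : ℝ≥0∞) ^ (n + 1) * w ^ 5 = 1 * (4 * w ^ 5) * 4 ^ n := by ring
      _ ≤ _ := by gcongr; exact one_le_pow₀ hg
  induction d with
  | zero =>
    intro j k n hd hj hji hik hk hn
    obtain rfl : j = k := by simp at hd; omega
    exact hleaf 0 j n hj (by omega) hn
  | succ d ih =>
    intro j k n hd hj hji hik hk hn
    rcases eq_or_lt_of_le (hji.trans hik) with rfl | hlt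
    · exact hleaf (d + 1) j n hj (by omega) hn
    rw [pow_succ] at hd
    have hD := splitRun_deviate hB hG hlt hk hn
    have b1 := hB (j - 1) ((j + k) / 2) (by omega) (by omega)
    have b2 := hB ((j + k) / 2) k (by omega) hk
    have hJ : JointCost w (Set.range (Key.node j k)) (splitRun G B j k n)
        (retryFactor q (w ^ a)) := hG.jointCost hn (by omega) (injective_node j k) hw hwq
    set l := B ((j + k) / 2) - B (j - 1) with hl
    set U := B k - B (j - 1) with hU
    set Mi := B i - B (i - 1) with hMi
    set γ := retryFactor q (w ^ a) * w ^ 12 with hγ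
    by_cases hi : i ≤ (j + k) / 2
    · have hMl : Mi ≤ l := by
        have := hB (j - 1) (i - 1) (by omega) (by omega)
        have := hB i ((j + k) / 2) (by omega) (by omega)
        omega
      have hC : ∀ x, hashLaw {h | (splitRun G B j k n h).val = x} ≠ 0 →
          Cost w (treeKeys j ((j + k) / 2)) (fun h => ops 12 () >>= fun _ =>
            sampleP G L B i h x j ((j + k) / 2)) (γ ^ d * (4 * w ^ 5) * ENNReal.ofReal
              ((1 + 3 * ((Mi : ℝ) / (l : ℝ))) ^ x) * w ^ 12) := by
        intro x hx
        rw [hD.law] at hx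
        exact Cost.time_add hw (ih j ((j + k) / 2) x (by omega) hj hji hi (by omega)
          (hyperLaw_ne_zero hx).2.1) (Filter.Eventually.of_forall fun h => by
            rw [ops_bind_time, add_comm])
      have hkey := Cost.bind hw (disjoint_node_treeKeys (Or.inr (by omega))) hD.obs hJ hC
      simp only [sampleP_left _ hlt hi]
      refine hkey.mono (Set.union_subset (range_node_subset hlt.le)
        (treeKeys_subset le_rfl (by omega))) ?_
      -- Universe sizes telescope; for `l = 0` the division is degenerate, but then `Mi = 0` too.
      have hy : 3 * ((Mi : ℝ) / l) * ((l : ℝ) / U) = 3 * ((Mi : ℝ) / U) := by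
        rcases Nat.eq_zero_or_pos l with h0 | h0
        · obtain h0' : Mi = 0 := by omega
          simp [h0']
        · have : (l : ℝ) ≠ 0 := by exact_mod_cast h0.ne'
          field_simp
      have hmom := hyperLaw_moment hn (show l ≤ U by omega) (y := 3 * ((Mi : ℝ) / l))
        (by positivity)
      rw [hy] at hmom
      calc _ = γ ^ (d + 1) * (4 * w ^ 5) * ∑' x, hyperLaw n l U x *
            ENNReal.ofReal ((1 + 3 * ((Mi : ℝ) / (l : ℝ))) ^ x) := by
            rw [← ENNReal.tsum_mul_left, ← ENNReal.tsum_mul_left]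
            refine tsum_congr fun x => ?_
            rw [← hD.law x, pow_succ γ d]
            nth_rewrite 3 [hγ]
            ring
        _ ≤ _ := by gcongr
    · have hMl : Mi ≤ U - l := by
        have := hB ((j + k) / 2) (i - 1) (by omega) (by omega)
        have := hB i k (by omega) (by omega)
        omega
      have eU : B k - B ((j + k) / 2 + 1 - 1) = U - l := by
        rw [Nat.add_sub_cancel]; omega
      have hC : ∀ x, hashLaw {h | (splitRun G B j k n h).val = x} ≠ 0 →
          Cost w (treeKeys ((j + k) / 2 + 1) k) (fun h => ops 12 () >>= fun _ =>
            sampleP G L B i h (n - x) ((j + k) / 2 + 1) k) (γ ^ d * (4 * w ^ 5) * ENNReal.ofReal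
              ((1 + 3 * ((Mi : ℝ) / ((U - l : ℕ) : ℝ))) ^ (n - x)) * w ^ 12) := by
        intro x hx
        rw [hD.law] at hx
        have := ih ((j + k) / 2 + 1) k (n - x) (by omega) (by omega) (by omega) hik hk
          (by rw [eU]; exact (hyperLaw_ne_zero hx).2.2)
        rw [eU] at this
        exact Cost.time_add hw this (Filter.Eventually.of_forall fun h => by
            rw [ops_bind_time, add_comm])
      have hkey := Cost.bind hw (disjoint_node_treeKeys (Or.inl (by omega))) hD.obs hJ hC
      simp only [sampleP_right _ hlt hi]
      refine hkey.mono (Set.union_subset (range_node_subset hlt.le)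
        (treeKeys_subset (by omega) le_rfl)) ?_
      have hy : 3 * ((Mi : ℝ) / ((U - l : ℕ) : ℝ)) * (((U - l : ℕ) : ℝ) / U) =
          3 * ((Mi : ℝ) / U) := by
        rcases Nat.eq_zero_or_pos (U - l) with h0 | h0
        · obtain h0' : Mi = 0 := by omega
          simp [h0']
        · have : ((U - l : ℕ) : ℝ) ≠ 0 := by exact_mod_cast h0.ne'
          field_simp
      have hmom := hyperLaw_moment_compl hn (show l ≤ U by omega)
        (y := 3 * ((Mi : ℝ) / ((U - l : ℕ) : ℝ))) (by positivity)
      rw [hy] at hmom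
      calc _ = γ ^ (d + 1) * (4 * w ^ 5) * ∑' x, hyperLaw n l U x *
            ENNReal.ofReal ((1 + 3 * ((Mi : ℝ) / ((U - l : ℕ) : ℝ))) ^ (n - x)) := by
            rw [← ENNReal.tsum_mul_left, ← ENNReal.tsum_mul_left]
            refine tsum_congr fun x => ?_
            rw [← hD.law x, pow_succ γ d]
            nth_rewrite 3 [hγ]
            ring
        _ ≤ _ := by gcongr

/-- The output of a processor is almost surely a list without repetitions of elements of its part
of the range. -/
theorem sampleP_ae (hB : ∀ i i', i ≤ i' → i' ≤ p → B i ≤ B i')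
    (hG : G.HasConstants a q) (d : ℕ) {i : ℕ} : ∀ j k n : ℕ, k - j = d → 1 ≤ j →
    j ≤ i → i ≤ k → k ≤ p → n ≤ B k - B (j - 1) →
    ∀ᵐ h ∂hashLaw, (sampleP G L B i h n j k).val.Nodup ∧
      ∀ x ∈ (sampleP G L B i h n j k).val, B (i - 1) < x ∧ x ≤ B i := by
  induction d using Nat.strong_induction_on with
  | _ d ih =>
    intro j k n hd hj hji hik hk hn
    rcases eq_or_lt_of_le (hji.trans hik) with rfl | hlt
    · obtain rfl : j = i := by omega
      simp only [sampleP_leaf _ (lt_irrefl j), ops_bind_val]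
      filter_upwards [(L.run_samples hG n (B j - B (j - 1)) (B (j - 1)) (injective_seed j) hn).ae hn]
        with h hh
      refine ⟨hh.1, fun x hx => ?_⟩
      have h1 := Finset.mem_Ioc.1 ((Finset.mem_powersetCard.1 hh.2).1 (List.mem_toFinset.2 hx))
      have h2 := hB (j - 1) j (by omega) hk
      omega
    · have hD := splitRun_deviate hB hG hlt hk hn
      by_cases hi : i ≤ (j + k) / 2
      · simp only [sampleP_left _ hlt hi, bind_val]
        refine ae_of_countable (X := fun h => (splitRun G B j k n h).val)
          (Q := fun x h => (sampleP G L B i h x j ((j + k) / 2)).val.Nodup ∧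
            ∀ y ∈ (sampleP G L B i h x j ((j + k) / 2)).val, B (i - 1) < y ∧ y ≤ B i)
          fun x hx => ?_
        rw [hD.law] at hx
        exact ih _ (by omega) _ _ _ rfl hj hji hi (by omega) (hyperLaw_ne_zero hx).2.1
      · simp only [sampleP_right _ hlt hi, bind_val]
        refine ae_of_countable (X := fun h => (splitRun G B j k n h).val)
          (Q := fun x h => (sampleP G L B i h (n - x) ((j + k) / 2 + 1) k).val.Nodup ∧
            ∀ y ∈ (sampleP G L B i h (n - x) ((j + k) / 2 + 1) k).val, B (i - 1) < y ∧ y ≤ B i)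
          fun x hx => ?_
        rw [hD.law] at hx
        have b1 := hB (j - 1) ((j + k) / 2) (by omega) (by omega)
        have b2 := hB ((j + k) / 2) k (by omega) hk
        have := (hyperLaw_ne_zero hx).2.2
        exact ih (k - ((j + k) / 2 + 1)) (by omega) _ _ _ rfl (by omega) (by omega) hik hk
          (by rw [Nat.add_sub_cancel]; omega)

end Tree

/-! ## Correctness and running time of Algorithm P -/

/-- Markov's inequality for `w ^ time`, applied to the measurable majorant; the tail event itself
need not be measurable. -/
lemma Cost.tail {α : Type} {w : ℝ≥0∞} {S : Set Key} {R : (Key → I) → Run α} {E : ℝ≥0∞}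
    (hw : 1 ≤ w) (hw' : w ≠ ⊤) (hR : Cost w S R E) (x : ℝ) :
    hashLaw {h | ENNReal.ofReal x < (((R h).time : ℕ∞) : ℝ≥0∞)} ≤
      ENNReal.ofReal (Real.exp (-(Real.log w.toReal * x))) * E := by
  obtain ⟨τ, h1, h2, h3⟩ := hR
  have hw1 : 1 ≤ w.toReal := by
    rw [← ENNReal.toReal_one]
    exact (ENNReal.toReal_le_toReal ENNReal.one_ne_top hw').2 hw
  set b := Real.log w.toReal with hb
  have hb0 : 0 ≤ b := Real.log_nonneg hw1
  have hm := mul_meas_ge_le_lintegral (μ := hashLaw) (h1.mono (keyAlgebra_le S) le_rfl)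
    (ENNReal.ofReal (Real.exp (b * x)))
  have hsub : hashLaw {h | ENNReal.ofReal x < (((R h).time : ℕ∞) : ℝ≥0∞)} ≤
      hashLaw {h | ENNReal.ofReal (Real.exp (b * x)) ≤ τ h} := by
    refine measure_mono_ae ?_
    filter_upwards [h2] with h hh hx
    refine le_trans ?_ hh
    change ENNReal.ofReal x < (((R h).time : ℕ∞) : ℝ≥0∞) at hx
    generalize (R h).time = s at hx ⊢
    induction s using ENat.recTopCoe with
    | top => simp
    | coe t =>
      have hxt : x < t := by
        rw [ENat.toENNReal_coe, ← ENNReal.ofReal_natCast] at hx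
        exact (ENNReal.ofReal_lt_ofReal_iff'.1 hx).1
      have e : w ^ t = ENNReal.ofReal (Real.exp (b * t)) := by
        rw [hb, mul_comm, Real.exp_nat_mul, Real.exp_log (by linarith),
          ENNReal.ofReal_pow (by linarith), ENNReal.ofReal_toReal hw']
      rw [weight_coe, e]
      exact ENNReal.ofReal_le_ofReal (Real.exp_le_exp.2 (mul_le_mul_of_nonneg_left hxt.le hb0))
  refine hsub.trans ?_
  calc _ = ENNReal.ofReal (Real.exp (-(b * x))) * (ENNReal.ofReal (Real.exp (b * x)) *
        hashLaw {h | ENNReal.ofReal (Real.exp (b * x)) ≤ τ h}) := by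
        rw [← mul_assoc, ← ENNReal.ofReal_mul (Real.exp_pos _).le, ← Real.exp_add]
        simp
    _ ≤ _ := by gcongr; exact hm.trans h3

lemma monotone_of_steps {B : ℕ → ℕ} {p : ℕ} (h : ∀ i < p, B i ≤ B (i + 1)) :
    ∀ i i', i ≤ i' → i' ≤ p → B i ≤ B i' := by
  intro i i' hi
  induction i', hi using Nat.le_induction with
  | base => exact fun _ => le_rfl
  | succ k _ ih => exact fun hk => (ih (by omega)).trans (h k (by omega))

/-- Finitely many conditions hold near `w = 1`, hence for some finite `w` strictly above 1. -/
lemma exists_weight {G : Generator} {a : ℕ} {q : ℝ≥0∞} (hG : G.HasConstants a q)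
    {L : LocalSampler} (hL : L.Proper) :
    ∃ w : ℝ≥0∞, 1 < w ∧ w ≠ ⊤ ∧ (1 - q) * w ^ a < 1 ∧ retryFactor q (w ^ a) * w ^ 12 ≤ 2 ∧
      w ^ 5 ≤ 2 ∧ ∀ (m M off : ℕ) (e : List ℕ → Key), Function.Injective e →
      m ≤ M → Cost w (localKeys e) (fun h => L.run G m M off fun p => h (e p)) (4 ^ (m + 1)) := by
  have hne : (nhdsWithin (1 : ℝ≥0∞) (Set.Ioi 1)).NeBot :=
    nhdsGT_neBot_of_exists_gt ⟨2, by norm_num⟩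
  have h2 : ∀ᶠ w : ℝ≥0∞ in nhds 1, w ^ 5 ≤ 2 := by
    have : Filter.Tendsto (fun w : ℝ≥0∞ => w ^ 5) (nhds 1) (nhds 1) := tendsto_pow_one 5
    exact (this.eventually_lt_const (by norm_num)).mono fun _ h => h.le
  have hev := ((eventually_factor_le hG.1 hG.2.1 a 12 1 0 (B := 2) (by norm_num)).and
    ((eventually_reject_lt hG.1 a).and (h2.and ((LocalSampler.eventually_cost hG hL).and
    (eventually_lt_nhds (b := ⊤) ENNReal.one_lt_top)))))
  obtain ⟨w, ⟨h3, h4, h5, h6, h7⟩, h8⟩ :=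
    ((hev.filter_mono (nhdsWithin_le_nhds (s := Set.Ioi 1))).and
      (self_mem_nhdsWithin (s := Set.Ioi 1))).exists
  exact ⟨w, h8, h7.ne, h4, by simpa using h3, h5, h6 (le_of_lt h8)⟩

lemma two_pow_clog_le {p : ℕ} (hp : 1 ≤ p) : 2 ^ Nat.clog 2 p ≤ 2 * p := by
  rcases Nat.lt_or_ge 1 p with h | h
  · have h1 := Nat.pow_pred_clog_lt_self (by norm_num : 1 < 2) h
    have h2 : 0 < Nat.clog 2 p := Nat.clog_pos (by norm_num) h
    obtain ⟨d, hd⟩ := Nat.exists_eq_succ_of_ne_zero h2.ne'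
    rw [hd] at h1 ⊢
    rw [Nat.pred_succ] at h1
    rw [pow_succ]
    omega
  · obtain rfl : p = 1 := by omega
    simp

section Parallel

variable {G : Generator} {a : ℕ} {q : ℝ≥0∞} {L : LocalSampler} {B : ℕ → ℕ} {n N p : ℕ}

lemma sample_eq_treeList (h : Key → I) : sample G L B n p h = (treeList G L B 1 p n h).toFinset := by
  ext x
  simp only [sample, treeList, processor, Finset.mem_biUnion, Finset.mem_Icc, List.mem_toFinset,
    List.mem_flatMap, List.mem_range'_1]
  refine exists_congr fun i => and_congr_left fun _ => ?_
  omega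

/-- The sample is uniformly distributed. -/
theorem hashLaw_sample_eq (hG : G.HasConstants a q) (hp : 1 ≤ p) (hn : n ≤ N) (h0 : B 0 = 0)
    (hN : B p = N) (hB : ∀ i i', i ≤ i' → i' ≤ p → B i ≤ B i') {S : Finset ℕ}
    (hS : S ∈ (Finset.Icc 1 N).powersetCard n) :
    hashLaw {h | sample G L B n p h = S} = ((N.choose n : ℝ≥0∞))⁻¹ := by
  have H := treeList_samples (L := L) hB hG (p - 1) 1 p n rfl le_rfl hp le_rfl
    (by rw [Nat.sub_self, h0, hN]; omega)
  rw [Nat.sub_self, h0, hN, Nat.sub_zero] at H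
  have hI : Finset.Ioc 0 (0 + N) = Finset.Icc 1 N := by
    ext x; simp only [Finset.mem_Ioc, Finset.mem_Icc]; omega
  have h1 := H.law S
  rw [hI, if_pos hS] at h1
  rw [← h1]
  refine measure_congr ?_
  filter_upwards [H.ae hn] with h hh
  change (sample G L B n p h = S) = ((treeList G L B 1 p n h).Nodup ∧ _)
  rw [sample_eq_treeList]
  simp [hh.1]

/-- The mean of the exponential weight of the running time of a processor. -/
theorem processor_cost (hG : G.HasConstants a q) {w : ℝ≥0∞} (hw : 1 ≤ w)
    (hwq : (1 - q) * w ^ a < 1) (hw2 : retryFactor q (w ^ a) * w ^ 12 ≤ 2) (hw5 : w ^ 5 ≤ 2)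
    (hL : ∀ (m M off : ℕ) (e : List ℕ → Key), Function.Injective e →
      m ≤ M → Cost w (localKeys e) (fun h => L.run G m M off fun p => h (e p)) (4 ^ (m + 1)))
    (hp : 1 ≤ p) (hn : n ≤ N) (h0 : B 0 = 0) (hN : B p = N)
    (hB : ∀ i i', i ≤ i' → i' ≤ p → B i ≤ B i') {D : ℝ} (hD : 0 ≤ D)
    (hBD : ∀ i < p, (B (i + 1) : ℝ) - (B i : ℝ) ≤ D * ((N : ℝ) / (p : ℝ)))
    {i : ℕ} (hi : i ∈ Finset.Icc 1 p) :
    Cost w (treeKeys 1 p) (fun h => processor G L B n p h i)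
      (ENNReal.ofReal (16 * p * Real.exp (3 * D * (n / p)))) := by
  obtain ⟨hi1, hip⟩ := Finset.mem_Icc.1 hi
  have h := sampleP_cost hB hG hw hwq hL (i := i) (Nat.clog 2 p) 1 p n
    (lt_of_lt_of_le (by omega) (Nat.le_pow_clog (by norm_num) p)) le_rfl hi1 hip le_rfl
    (by rw [Nat.sub_self, h0, hN]; omega)
  refine h.mono le_rfl ?_
  rw [Nat.sub_self, h0, hN, Nat.sub_zero]
  have hM : ((B i - B (i - 1) : ℕ) : ℝ) / (N : ℝ) ≤ D / p := by
    have h1 := hBD (i - 1) (by omega)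
    rw [Nat.sub_add_cancel hi1] at h1
    rw [Nat.cast_sub (hB _ _ (Nat.sub_le _ _) hip)]
    rcases Nat.eq_zero_or_pos N with rfl | hpos
    · simp only [Nat.cast_zero, div_zero]; positivity
    · rw [div_le_iff₀ (by exact_mod_cast hpos)]
      calc _ ≤ _ := h1
        _ = _ := by ring
  have h2 : (1 + 3 * (((B i - B (i - 1) : ℕ) : ℝ) / (N : ℝ))) ^ n ≤
      Real.exp (3 * D * (n / p)) := by
    calc _ ≤ Real.exp (3 * (D / p)) ^ n := by
          refine pow_le_pow_left₀ (by positivity) ?_ n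
          have := Real.add_one_le_exp (3 * (D / p))
          linarith
      _ = _ := by rw [← Real.exp_nat_mul]; congr 1; ring
  -- The tree has `⌈log₂ p⌉` levels with a factor of at most 2 each.
  have h3 : (2 : ℝ≥0∞) ^ Nat.clog 2 p ≤ 2 * p := by exact_mod_cast two_pow_clog_le hp
  calc _ ≤ 2 ^ Nat.clog 2 p * (4 * 2) * ENNReal.ofReal (Real.exp (3 * D * (n / p))) := by gcongr
    _ ≤ (2 * p) * (4 * 2) * ENNReal.ofReal (Real.exp (3 * D * (n / p))) := by gcongr
    _ = _ := by
      rw [ENNReal.ofReal_mul (by positivity), ENNReal.ofReal_mul (by norm_num),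
        ENNReal.ofReal_natCast, show ENNReal.ofReal 16 = 16 by norm_num]
      ring

/-- All processors terminate and generate distinct elements of their parts of the range. -/
theorem parallel_ae (hG : G.HasConstants a q) {w E : ℝ≥0∞} (hE : E ≠ ⊤)
    (hC : ∀ i ∈ Finset.Icc 1 p, Cost w (treeKeys 1 p) (fun h => processor G L B n p h i) E)
    (hn : n ≤ N) (h0 : B 0 = 0) (hN : B p = N) (hB : ∀ i i', i ≤ i' → i' ≤ p → B i ≤ B i') :
    ∀ᵐ h ∂hashLaw, parallelTime G L B n p h < ⊤ ∧
      ∀ i ∈ Finset.Icc 1 p, (processor G L B n p h i).val.Nodup ∧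
        ∀ x ∈ (processor G L B n p h i).val, B (i - 1) < x ∧ x ≤ B i := by
  have h1 : ∀ᵐ h ∂hashLaw, ∀ i ∈ Finset.Icc 1 p, (processor G L B n p h i).time < ⊤ :=
    (Finset.eventually_all _).2 fun i hi => (hC i hi).ae_time_lt_top hE
  have h2 : ∀ᵐ h ∂hashLaw, ∀ i ∈ Finset.Icc 1 p, (processor G L B n p h i).val.Nodup ∧
      ∀ x ∈ (processor G L B n p h i).val, B (i - 1) < x ∧ x ≤ B i := by
    refine (Finset.eventually_all _).2 fun i hi => ?_
    obtain ⟨hi1, hip⟩ := Finset.mem_Icc.1 hi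
    exact sampleP_ae hB hG (p - 1) 1 p n rfl le_rfl hi1 hip le_rfl
      (by rw [Nat.sub_self, h0, hN]; omega)
  filter_upwards [h1, h2] with h h3 h4
  exact ⟨(Finset.sup_lt_iff (by simp)).2 h3, h4⟩

lemma parallelTime_tail {w E : ℝ≥0∞} (hw : 1 ≤ w) (hw' : w ≠ ⊤) (hp : 1 ≤ p)
    (hC : ∀ i ∈ Finset.Icc 1 p, Cost w (treeKeys 1 p) (fun h => processor G L B n p h i) E) (x : ℝ) :
    hashLaw {h | ENNReal.ofReal x < ((parallelTime G L B n p h : ℕ∞) : ℝ≥0∞)} ≤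
      p * (ENNReal.ofReal (Real.exp (-(Real.log w.toReal * x))) * E) := by
  have hsub : {h | ENNReal.ofReal x < ((parallelTime G L B n p h : ℕ∞) : ℝ≥0∞)} ⊆
      ⋃ i ∈ Finset.Icc 1 p,
        {h | ENNReal.ofReal x < (((processor G L B n p h i).time : ℕ∞) : ℝ≥0∞)} := by
    intro h hh
    obtain ⟨i, hi, e⟩ := Finset.exists_mem_eq_sup (Finset.Icc 1 p) ⟨1, by simp [hp]⟩
      fun i => (processor G L B n p h i).time
    refine Set.mem_biUnion hi ?_
    change ENNReal.ofReal x < ((parallelTime G L B n p h : ℕ∞) : ℝ≥0∞) at hh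
    rwa [parallelTime, e] at hh
  refine (measure_mono hsub).trans ((measure_biUnion_finset_le _ _).trans ?_)
  refine (Finset.sum_le_sum fun i hi => (hC i hi).tail hw hw' x).trans ?_
  simp

/-- For `p ≥ 2` the prefactor `16 p * p` is at most `p ^ 6`. In the exponent `b A = 3 D + 6 + c`,
the summand `3 D` absorbs `exp (3 D z)`, 6 the prefactor, and `c` leaves `p ^ (-c)`. -/
lemma tail_bound {b A D c z : ℝ} (hD : 0 ≤ D) (hc : 0 < c) (hz : 0 ≤ z) (hp : 2 ≤ p)
    (hA : b * A = 3 * D + 6 + c) :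
    (p : ℝ) * (Real.exp (-(b * (A * (z + Real.logb 2 p)))) * (16 * p * Real.exp (3 * D * z))) ≤
      (p : ℝ) ^ (-c) := by
  have hp' : (2 : ℝ) ≤ p := by exact_mod_cast hp
  have hp0 : (0 : ℝ) < p := by linarith
  have hl0 : 0 ≤ Real.log p := Real.log_nonneg (by linarith)
  have hlog : Real.log p ≤ Real.logb 2 p := by
    rw [Real.logb, le_div_iff₀ (Real.log_pos (by norm_num))]
    have : Real.log 2 ≤ 1 := by linarith [Real.log_le_sub_one_of_pos (show (0 : ℝ) < 2 by norm_num)]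
    nlinarith
  have h16 : (16 : ℝ) ≤ Real.exp (4 * Real.log p) := by
    have : Real.exp (4 * Real.log p) = (p : ℝ) ^ 4 := by
      rw [show (4 : ℝ) = (4 : ℕ) by norm_num, Real.exp_nat_mul, Real.exp_log hp0]
    rw [this]
    calc (16 : ℝ) = 2 ^ 4 := by norm_num
      _ ≤ _ := by gcongr
  rw [Real.rpow_def_of_pos hp0]
  calc _ ≤ Real.exp (Real.log p) * (Real.exp (-(b * (A * (z + Real.logb 2 p)))) *
        (Real.exp (4 * Real.log p) * Real.exp (Real.log p) * Real.exp (3 * D * z))) := by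
        rw [Real.exp_log hp0]; gcongr
    _ = Real.exp (6 * Real.log p + 3 * D * z - (b * A) * (z + Real.logb 2 p)) := by
        simp only [← Real.exp_add]; congr 1; ring
    _ ≤ _ := by
        rw [hA]
        refine Real.exp_le_exp.2 ?_
        have h1 : (3 * D + 6 + c) * Real.log p ≤ (3 * D + 6 + c) * Real.logb 2 p :=
          mul_le_mul_of_nonneg_left hlog (by linarith)
        have h2 : 0 ≤ 3 * D * Real.log p := by positivity
        have h3 : 0 ≤ (6 + c) * z := by positivity
        linarith

end Parallel

/-- The running time and the correctness of Algorithm P. -/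
theorem algorithmP {G : Generator} (hG : G.IsHypergeometric) {L : LocalSampler} (hL : L.Proper)
    (C : ℝ) {c : ℝ} (hc : 0 < c) :
    ∃ A : ℝ, 0 < A ∧
      ∀ (p n N : ℕ) (B : ℕ → ℕ), 1 ≤ p → n ≤ N → B 0 = 0 → B p = N →
        (∀ i < p, B i ≤ B (i + 1)) →
        (∀ i < p, (B (i + 1) : ℝ) - (B i : ℝ) ≤ C * ((N : ℝ) / (p : ℝ))) →
        hashLaw {h | ENNReal.ofReal (A * ((n : ℝ) / (p : ℝ) + Real.logb 2 (p : ℝ))) <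
              ((parallelTime G L B n p h : ℕ∞) : ℝ≥0∞)}
          ≤ ENNReal.ofReal ((p : ℝ) ^ (-c)) ∧
        (∀ᵐ h ∂hashLaw, parallelTime G L B n p h < ⊤ ∧
          ∀ i ∈ Finset.Icc 1 p, (processor G L B n p h i).val.Nodup ∧
            ∀ x ∈ (processor G L B n p h i).val, B (i - 1) < x ∧ x ≤ B i) ∧
        ∀ S ∈ (Finset.Icc 1 N).powersetCard n,
          hashLaw {h | sample G L B n p h = S} = ((N.choose n : ℝ≥0∞))⁻¹ := by
  obtain ⟨a, q, hq⟩ := hG.exists_constants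
  obtain ⟨w, hw, hwt, hwq, hw2, hw5, hwL⟩ := exists_weight hq hL
  have hb : 0 < Real.log w.toReal := by
    refine Real.log_pos ?_
    rw [← ENNReal.toReal_one]
    exact (ENNReal.toReal_lt_toReal ENNReal.one_ne_top hwt).2 hw
  set b := Real.log w.toReal
  -- `C` is an arbitrary real number; the moment bounds need a nonnegative constant.
  set D := max C 0
  have hD : 0 ≤ D := le_max_right _ _
  have hA : b * ((3 * D + 6 + c) / b) = 3 * D + 6 + c := mul_div_cancel₀ _ hb.ne'
  refine ⟨(3 * D + 6 + c) / b, by positivity, fun p n N B hp hn h0 hN hB hBC => ?_⟩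
  have hmono := monotone_of_steps hB
  have hC := fun i hi => processor_cost hq hw.le hwq hw2 hw5 hwL hp hn h0 hN hmono hD
    (fun i hi => (hBC i hi).trans (mul_le_mul_of_nonneg_right (le_max_left C 0) (by positivity)))
    (i := i) hi
  refine ⟨?_, parallel_ae hq ENNReal.ofReal_ne_top hC hn h0 hN hmono,
    fun S hS => hashLaw_sample_eq hq hp hn h0 hN hmono hS⟩
  -- For `p = 1` the bound `1 ^ (-c) = 1` is trivial.
  rcases eq_or_lt_of_le hp with rfl | hp2
  · simpa using prob_le_one
  · refine (parallelTime_tail hw.le hwt hp hC _).trans ?_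
    rw [← ENNReal.ofReal_mul (Real.exp_pos _).le, ← ENNReal.ofReal_natCast,
      ← ENNReal.ofReal_mul (by positivity)]
    exact ENNReal.ofReal_le_ofReal (tail_bound hD hc (by positivity) hp2 hA)

/-! ## Discrete log-concave sequences -/

section LogConcave

variable {F : ℕ → ℝ}

/-- Log-concavity makes successive ratios nonincreasing, and the first is at most 1. `hpos` says
that the support has no gaps. -/
lemma le_of_logConcave (h1 : F 1 ≤ F 0) (hpos : ∀ j, 0 < F (j + 1) → 0 < F j)
    (hlc : ∀ j, F j * F (j + 2) ≤ F (j + 1) ^ 2) (j : ℕ) (hj : 0 < F (j + 1)) :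
    F (j + 1) ≤ F j := by
  induction j with
  | zero => exact h1
  | succ j ih =>
    have h2 := hpos _ hj
    have h3 := hpos _ h2
    have h4 := ih h2
    have h5 := hlc j
    refine le_of_mul_le_mul_left ?_ h3
    calc _ ≤ F (j + 1) ^ 2 := h5
      _ = F (j + 1) * F (j + 1) := sq _
      _ ≤ _ := by gcongr

/-- `j ↦ log (F 0) - log (F j)` is convex on the support and vanishes at 0, so its quotient by `j`
does not decrease; stated without division. -/
lemma log_convex_step (hpos : ∀ j, 0 < F (j + 1) → 0 < F j)
    (hlc : ∀ j, F j * F (j + 2) ≤ F (j + 1) ^ 2) (j : ℕ) (hj : 0 < F (j + 1)) :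
    ((j : ℝ) + 1) * (Real.log (F 0) - Real.log (F j)) ≤
      j * (Real.log (F 0) - Real.log (F (j + 1))) := by
  induction j with
  | zero => simp
  | succ j ih =>
    have h2 := hpos _ hj
    have h3 := hpos _ h2
    have h4 := ih h2
    have h5 : Real.log (F j) + Real.log (F (j + 1 + 1)) ≤ 2 * Real.log (F (j + 1)) := by
      rw [← Real.log_mul h3.ne' hj.ne', show (2 : ℝ) = (2 : ℕ) by norm_num, ← Real.log_pow]
      exact Real.log_le_log (mul_pos h3 hj) (hlc j)
    push_cast
    have h6 := mul_le_mul_of_nonneg_left h5 (show (0 : ℝ) ≤ (j : ℝ) + 1 by positivity)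
    linarith

lemma log_convex_chord (hpos : ∀ j, 0 < F (j + 1) → 0 < F j)
    (hlc : ∀ j, F j * F (j + 2) ≤ F (j + 1) ^ 2) {j k : ℕ} (hjk : j ≤ k) (hk : 0 < F k) :
    (k : ℝ) * (Real.log (F 0) - Real.log (F j)) ≤ j * (Real.log (F 0) - Real.log (F k)) := by
  induction k, hjk using Nat.le_induction with
  | base => exact le_rfl
  | succ k hjk ih =>
    have h1 := ih (hpos _ hk)
    have h2 := log_convex_step hpos hlc k hk
    rcases Nat.eq_zero_or_pos k with rfl | hk0
    · obtain rfl : j = 0 := by omega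
      simp
    · have hk' : (0 : ℝ) < k := by exact_mod_cast hk0
      refine le_of_mul_le_mul_left ?_ hk'
      have h3 := mul_le_mul_of_nonneg_left h1 (show (0 : ℝ) ≤ (k : ℝ) + 1 by positivity)
      have h4 := mul_le_mul_of_nonneg_left h2 (show (0 : ℝ) ≤ (j : ℝ) by positivity)
      push_cast
      linarith

/-- The sum is `(1 - exp (-s)) / (1 - exp (-s/k))`; the denominator is at most `s/k`, and `exp (-s)
≤ 1 / (1 + s)`. -/
lemma le_mul_geom_sum {s : ℝ} (hs : 0 ≤ s) {k : ℕ} (hk : 0 < k) :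
    (k : ℝ) ≤ (1 + s) * ∑ j ∈ Finset.range k, Real.exp (-(s / k)) ^ j := by
  have hk' : (0 : ℝ) < k := by exact_mod_cast hk
  rcases hs.eq_or_lt with rfl | hs0
  · simp
  · set r := Real.exp (-(s / k)) with hr
    have h1 : (∑ j ∈ Finset.range k, r ^ j) * (1 - r) = 1 - r ^ k := geom_sum_mul_neg r k
    have h2 : r ^ k = Real.exp (-s) := by
      rw [hr, ← Real.exp_nat_mul]; congr 1; field_simp
    have h3 : 1 - r ≤ s / k := by
      have := Real.add_one_le_exp (-(s / k)); linarith
    have h4 : (1 + s) * Real.exp (-s) ≤ 1 := by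
      rw [Real.exp_neg, ← div_eq_mul_inv, div_le_one (Real.exp_pos s)]
      have := Real.add_one_le_exp s; linarith
    have h0 : 0 ≤ ∑ j ∈ Finset.range k, r ^ j :=
      Finset.sum_nonneg fun j _ => pow_nonneg (Real.exp_pos _).le _
    have h5 : 1 - r ^ k ≤ (∑ j ∈ Finset.range k, r ^ j) * (s / k) := by
      rw [← h1]; gcongr
    have h6 : s ≤ (1 + s) * ((∑ j ∈ Finset.range k, r ^ j) * (s / k)) := by
      have := mul_le_mul_of_nonneg_left h5 (show 0 ≤ 1 + s by linarith)
      rw [h2] at this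
      linarith
    refine le_of_mul_le_mul_right ?_ (div_pos hs0 hk')
    calc (k : ℝ) * (s / k) = s := by field_simp
      _ ≤ _ := h6
      _ = _ := by ring

/-- Devroye's bound for log-concave probabilities. -/
theorem logConcave_le (h0 : 0 < F 0) (h1 : F 1 ≤ F 0)
    (hpos : ∀ j, 0 < F (j + 1) → 0 < F j) (hlc : ∀ j, F j * F (j + 2) ≤ F (j + 1) ^ 2)
    (hsum : ∀ k, ∑ j ∈ Finset.range k, F j ≤ 1) {k : ℕ} (hk : 0 < F k) :
    F k ≤ F 0 ∧ F k ≤ F 0 * Real.exp (1 - F 0 * k) := by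
  have hle : ∀ j, 0 < F j → F j ≤ F 0 := by
    intro j
    induction j with
    | zero => exact fun _ => le_rfl
    | succ j ih => exact fun hj => (le_of_logConcave h1 hpos hlc j hj).trans (ih (hpos _ hj))
  refine ⟨hle k hk, ?_⟩
  rcases Nat.eq_zero_or_pos k with rfl | hk0
  · have := Real.add_one_le_exp (1 : ℝ)
    simp only [Nat.cast_zero, mul_zero, sub_zero]
    exact le_mul_of_one_le_right h0.le (by linarith)
  have hk' : (0 : ℝ) < k := by exact_mod_cast hk0
  set s := Real.log (F 0) - Real.log (F k) with hs
  have hs0 : 0 ≤ s := sub_nonneg.2 (Real.log_le_log hk (hle k hk))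
  have hdown : ∀ j ≤ k, 0 < F j := fun j hj => by
    induction k, hj using Nat.le_induction with
    | base => exact hk
    | succ i hji ih => 
      rcases Nat.eq_zero_or_pos i with rfl | hi
      · obtain rfl : j = 0 := by omega
        exact h0
      · exact ih (hpos _ hk) hi (by exact_mod_cast hi) rfl (sub_nonneg.2
          (Real.log_le_log (hpos _ hk) (hle i (hpos _ hk))))
  -- By convexity `F` lies above the geometric sequence through `(0, F 0)` and `(k, F k)`. As the
  -- total mass is at most 1, `F 0` times the geometric sum is at most 1, which forces `F 0 * k ≤ 1
  -- + s`.
  have hterm : ∀ j ∈ Finset.range k, F 0 * Real.exp (-(s / k)) ^ j ≤ F j := by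
    intro j hj
    have hj' : j ≤ k := (Finset.mem_range.1 hj).le
    have h2 := log_convex_chord hpos hlc hj' hk
    have h3 : Real.log (F 0) - Real.log (F j) ≤ j * (s / k) := by
      rw [mul_div_assoc', le_div_iff₀ hk', mul_comm]
      exact h2
    calc F 0 * Real.exp (-(s / k)) ^ j = Real.exp (Real.log (F 0) - j * (s / k)) := by
          rw [← Real.exp_nat_mul, Real.exp_sub, Real.exp_log h0, mul_neg, Real.exp_neg]
          rfl
      _ ≤ Real.exp (Real.log (F j)) := Real.exp_le_exp.2 (by linarith)
      _ = _ := Real.exp_log (hdown j hj')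
  have hsum' : F 0 * ∑ j ∈ Finset.range k, Real.exp (-(s / k)) ^ j ≤ 1 := by
    rw [Finset.mul_sum]
    exact (Finset.sum_le_sum hterm).trans (hsum k)
  have hmain : F 0 * k ≤ 1 + s := by
    have h2 := mul_le_mul_of_nonneg_left (le_mul_geom_sum hs0 hk0) h0.le
    have h3 := mul_le_mul_of_nonneg_left hsum' (show 0 ≤ 1 + s by linarith)
    linarith
  calc F k = Real.exp (Real.log (F k)) := (Real.exp_log hk).symm
    _ ≤ Real.exp (Real.log (F 0) + (1 - F 0 * k)) := Real.exp_le_exp.2 (by linarith)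
    _ = _ := by rw [Real.exp_add, Real.exp_log h0]

end LogConcave

/-! ## The mode of the hypergeometric distribution -/

section Mode

variable {n l N : ℕ}

lemma hyperPMF_pos_iff (hn : n ≤ N) (hl : l ≤ N) (x : ℕ) :
    0 < hyperPMF n l N x ↔ x ≤ n ∧ x ≤ l ∧ n + l ≤ N + x := by
  have hc : (0 : ℝ) < (N.choose n : ℝ) := by exact_mod_cast Nat.choose_pos hn
  constructor
  · intro h
    have h1 : hyperLaw n l N x ≠ 0 := (ENNReal.ofReal_pos.2 h).ne'
    obtain ⟨h2, h3, h4⟩ := hyperLaw_ne_zero h1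
    exact ⟨h2, h3, by omega⟩
  · rintro ⟨h1, h2, h3⟩
    have h4 : (0 : ℝ) < (l.choose x : ℝ) := by exact_mod_cast Nat.choose_pos h2
    have h5 : (0 : ℝ) < ((N - l).choose (n - x) : ℝ) := by
      exact_mod_cast Nat.choose_pos (by omega)
    rw [hyperPMF, if_pos h1]
    positivity

/-- The ratio of consecutive probabilities, free of division; it yields both log-concavity and the
mode. -/
lemma hyperPMF_succ {x : ℕ} (hn : x + 1 ≤ n) (hl : x + 1 ≤ l) (hN : n + l ≤ N + x + 1) (hlN : l ≤ N) :
    hyperPMF n l N (x + 1) * (((x : ℝ) + 1) * ((N : ℝ) - l - n + x + 1)) =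
      hyperPMF n l N x * (((l : ℝ) - x) * ((n : ℝ) - x)) := by
  have h1 : (l.choose (x + 1) : ℝ) * ((x : ℝ) + 1) = (l.choose x : ℝ) * ((l : ℝ) - x) := by
    have := Nat.choose_succ_right_eq l x
    rw [← Nat.cast_sub (by omega)]
    exact_mod_cast this
  have h2 : ((N - l).choose (n - x) : ℝ) * ((n : ℝ) - x) =
      ((N - l).choose (n - (x + 1)) : ℝ) * ((N : ℝ) - l - n + x + 1) := by
    have := Nat.choose_succ_right_eq (N - l) (n - (x + 1))
    rw [show n - (x + 1) + 1 = n - x by omega] at this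
    have e : ((N : ℝ) - l - n + x + 1) = ((N - l - (n - (x + 1)) : ℕ) : ℝ) := by
      rw [Nat.cast_sub (by omega), Nat.cast_sub hlN, Nat.cast_sub hn]
      push_cast; ring
    rw [e, ← Nat.cast_sub (by omega : x ≤ n)]
    exact_mod_cast this
  rw [hyperPMF, hyperPMF, if_pos hn, if_pos (by omega)]
  calc _ = ((l.choose (x + 1) : ℝ) * ((x : ℝ) + 1)) *
        (((N - l).choose (n - (x + 1)) : ℝ) * ((N : ℝ) - l - n + x + 1)) / (N.choose n : ℝ) := by ring
    _ = _ := by rw [h1, ← h2]; ring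

/-- The ratio `(l - x)(n - x) / ((x + 1)(N - l - n + x + 1))` decreases in `x`, as both numerator
factors fall and both denominator factors grow. -/
lemma hyperPMF_logConcave (hn : n ≤ N) (hl : l ≤ N) (x : ℕ) :
    hyperPMF n l N x * hyperPMF n l N (x + 2) ≤ hyperPMF n l N (x + 1) ^ 2 := by
  rcases (hyperPMF_nonneg n l N x).eq_or_lt with h0 | h0
  · rw [← h0, zero_mul]; positivity
  rcases (hyperPMF_nonneg n l N (x + 2)).eq_or_lt with h2 | h2
  · rw [← h2, mul_zero]; positivity
  obtain ⟨a1, a2, a3⟩ := (hyperPMF_pos_iff hn hl _).1 h0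
  obtain ⟨b1, b2, b3⟩ := (hyperPMF_pos_iff hn hl _).1 h2
  have e1 := hyperPMF_succ (N := N) (show x + 1 ≤ n by omega) (show x + 1 ≤ l by omega) (by omega) hl
  have e2 := hyperPMF_succ (N := N) (x := x + 1) (n := n) (l := l) b1 b2 (by omega) hl
  push_cast at e2
  have c1 : (x : ℝ) + 2 ≤ n := by exact_mod_cast b1
  have c2 : (x : ℝ) + 2 ≤ l := by exact_mod_cast b2
  have c3 : (n : ℝ) + l ≤ N + x := by exact_mod_cast a3
  have c4 : (0 : ℝ) ≤ x := by positivity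
  set f0 := hyperPMF n l N x
  set f1 := hyperPMF n l N (x + 1)
  rw [show x + 1 + 1 = x + 2 by ring] at e2
  set f2 := hyperPMF n l N (x + 2)
  set A := ((x : ℝ) + 1) * ((N : ℝ) - l - n + x + 1)
  set B := ((l : ℝ) - x) * ((n : ℝ) - x) with hB
  set A' := ((x : ℝ) + 1 + 1) * ((N : ℝ) - l - n + (x + 1) + 1) with hA'
  set B' := ((l : ℝ) - (x + 1)) * ((n : ℝ) - (x + 1))
  have hA : A ≤ A' := mul_le_mul (by linarith) (by linarith) (by linarith) (by linarith)
  have hBB : B' ≤ B := mul_le_mul (by linarith) (by linarith) (by linarith) (by linarith)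
  have hA0 : 0 < A' := mul_pos (by linarith) (by linarith)
  have hB0 : 0 < B := mul_pos (by linarith) (by linarith)
  have hB0' : 0 < B' := mul_pos (by linarith) (by linarith)
  refine le_of_mul_le_mul_right ?_ (mul_pos hB0 hA0)
  calc f0 * f2 * (B * A') = (f0 * B) * (f2 * A') := by ring
    _ = f1 ^ 2 * (A * B') := by rw [← e1, e2]; ring
    _ ≤ f1 ^ 2 * (A' * B) := by gcongr
    _ = _ := by ring

lemma mode_mem (hn : n ≤ N) (hl : l ≤ N) :
    (n + 1) * (l + 1) / (N + 2) ≤ n ∧ (n + 1) * (l + 1) / (N + 2) ≤ l ∧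
      n + l ≤ N + (n + 1) * (l + 1) / (N + 2) := by
  refine ⟨?_, ?_, ?_⟩
  · rw [← Nat.lt_succ_iff, Nat.div_lt_iff_lt_mul (by omega)]
    exact Nat.mul_lt_mul_of_pos_left (by omega) (by omega)
  · rw [← Nat.lt_succ_iff, Nat.div_lt_iff_lt_mul (by omega), mul_comm]
    exact Nat.mul_lt_mul_of_pos_left (by omega) (by omega)
  · obtain ⟨a, rfl⟩ := Nat.exists_eq_add_of_le hn
    obtain ⟨b, hb⟩ := Nat.exists_eq_add_of_le hl
    have : l - a ≤ (n + 1) * (l + 1) / (n + a + 2) := by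
      rw [Nat.le_div_iff_mul_le (by omega)]
      rcases Nat.lt_or_ge l a with h | h
      · rw [Nat.sub_eq_zero_of_le h.le]; omega
      · obtain ⟨e, rfl⟩ := Nat.exists_eq_add_of_le h
        obtain rfl : n = e + b := by omega
        rw [Nat.add_sub_cancel_left]
        nlinarith
    omega

/-- The ratio at `x` is at most 1 exactly when `(n + 1)(l + 1) ≤ (x + 1)(N + 2)`; the rounded
quotient is the first such `x`. -/
lemma hyperPMF_mode_succ (hn : n ≤ N) (hl : l ≤ N) :
    hyperPMF n l N ((n + 1) * (l + 1) / (N + 2) + 1) ≤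
      hyperPMF n l N ((n + 1) * (l + 1) / (N + 2)) := by
  set m := (n + 1) * (l + 1) / (N + 2) with hm
  rcases (hyperPMF_nonneg n l N (m + 1)).eq_or_lt with h0 | h0
  · rw [← h0]; exact hyperPMF_nonneg _ _ _ _
  obtain ⟨a1, a2, a3⟩ := (hyperPMF_pos_iff hn hl _).1 h0
  obtain ⟨b1, b2, b3⟩ := mode_mem hn hl
  rw [← hm] at b1 b2 b3
  have e := hyperPMF_succ a1 a2 (by omega) hl
  have h1 : (n + 1) * (l + 1) ≤ (m + 1) * (N + 2) := by
    have := Nat.lt_div_mul_add (a := (n + 1) * (l + 1)) (b := N + 2) (by omega)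
    rw [← hm] at this
    linarith
  have h1' : ((n : ℝ) + 1) * (l + 1) ≤ (m + 1) * (N + 2) := by exact_mod_cast h1
  have c3 : (n : ℝ) + l ≤ N + m := by exact_mod_cast b3
  have hA : 0 < ((m : ℝ) + 1) * ((N : ℝ) - l - n + m + 1) := mul_pos (by positivity) (by linarith)
  refine le_of_mul_le_mul_right ?_ hA
  rw [e]
  exact mul_le_mul_of_nonneg_left (by nlinarith) (hyperPMF_nonneg _ _ _ _)

lemma hyperPMF_mode_pred (hn : n ≤ N) (hl : l ≤ N) {x : ℕ}
    (hx : x + 1 = (n + 1) * (l + 1) / (N + 2)) :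
    hyperPMF n l N x ≤ hyperPMF n l N ((n + 1) * (l + 1) / (N + 2)) := by
  rcases (hyperPMF_nonneg n l N x).eq_or_lt with h0 | h0
  · rw [← h0]; exact hyperPMF_nonneg _ _ _ _
  obtain ⟨a1, a2, a3⟩ := (hyperPMF_pos_iff hn hl _).1 h0
  obtain ⟨b1, b2, b3⟩ := mode_mem hn hl
  rw [← hx] at b1 b2 b3 ⊢
  have e := hyperPMF_succ b1 b2 (by omega) hl
  have h1 : (x + 1) * (N + 2) ≤ (n + 1) * (l + 1) := by
    rw [hx]; exact Nat.div_mul_le_self _ _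
  have h1' : ((x : ℝ) + 1) * (N + 2) ≤ (n + 1) * (l + 1) := by exact_mod_cast h1
  have c1 : (x : ℝ) + 1 ≤ n := by exact_mod_cast b1
  have c2 : (x : ℝ) + 1 ≤ l := by exact_mod_cast b2
  have hB : 0 < ((l : ℝ) - x) * ((n : ℝ) - x) := mul_pos (by linarith) (by linarith)
  refine le_of_mul_le_mul_right ?_ hB
  rw [← e]
  exact mul_le_mul_of_nonneg_left (by nlinarith) (hyperPMF_nonneg _ _ _ _)

lemma tsum_hyperLaw (hn : n ≤ N) (hl : l ≤ N) : ∑' x, hyperLaw n l N x = 1 := by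
  have h := tsum_hyperLaw_mul (l := l) hn (f := fun _ => 1) fun _ => zero_le_one
  simp only [ENNReal.ofReal_one, mul_one] at h
  rw [h]
  have h2 := Nat.add_choose_eq l (N - l) n
  rw [Nat.add_sub_of_le hl] at h2
  have hc : (0 : ℝ) < (N.choose n : ℝ) := by exact_mod_cast Nat.choose_pos hn
  rw [ENNReal.ofReal_eq_one, div_eq_one_iff_eq hc.ne', h2]
  push_cast
  rfl

lemma sum_hyperPMF_le_one (hn : n ≤ N) (hl : l ≤ N) (s : Finset ℕ) :
    ∑ x ∈ s, hyperPMF n l N x ≤ 1 := by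
  rw [← ENNReal.ofReal_le_one, ENNReal.ofReal_sum_of_nonneg fun x _ => hyperPMF_nonneg _ _ _ _]
  exact (ENNReal.sum_le_tsum s).trans (tsum_hyperLaw hn hl).le

/-- `logConcave_le` is one-sided; it is applied to each half of the distribution, read outwards from
the mode. -/
lemma hyperPMF_le_mode (hn : n ≤ N) (hl : l ≤ N) {x : ℕ} (hx : 0 < hyperPMF n l N x) {m : ℕ}
    (hm : m = (n + 1) * (l + 1) / (N + 2)) {k : ℕ} (hk : x = m + k ∨ x + k = m) :
    hyperPMF n l N x ≤ hyperPMF n l N m ∧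
      hyperPMF n l N x ≤ hyperPMF n l N m * Real.exp (1 - hyperPMF n l N m * k) := by
  have hm0 : 0 < hyperPMF n l N m := (hyperPMF_pos_iff hn hl m).2 (hm ▸ mode_mem hn hl)
  rcases hk with rfl | rfl
  · refine logConcave_le (F := fun j => hyperPMF n l N (m + j)) hm0 ?_ (fun j hj => ?_)
      (fun j => hyperPMF_logConcave hn hl (m + j)) (fun k => ?_) hx
    · have := hyperPMF_mode_succ hn hl
      rw [← hm] at this
      exact this
    · rw [hyperPMF_pos_iff hn hl] at hj hm0 ⊢
      omega
    · rw [← Finset.sum_image (f := hyperPMF n l N) (g := fun j => m + j)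
        fun a _ b _ h => Nat.add_left_cancel h]
      exact sum_hyperPMF_le_one hn hl _
  -- The left half is reversed and continued by zero, since truncated subtraction would repeat the
  -- value at 0.
  · have := logConcave_le (F := fun j => if j ≤ x + k then hyperPMF n l N (x + k - j) else 0) (k := k)
      (by simpa using hm0) ?_ (fun j hj => ?_) (fun j => ?_) (fun k' => ?_) (by simpa using hx)
    · simpa using this
    · by_cases h : 1 ≤ x + k
      · have := hyperPMF_mode_pred hn hl (x := x + k - 1) (by omega)
        rw [← hm] at this
        simpa [h] using this
      · simpa [h] using hm0.le
    · by_cases h : j + 1 ≤ x + k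
      · simp only [if_pos h] at hj
        rw [if_pos (by omega)]
        rw [hyperPMF_pos_iff hn hl] at hj hm0 ⊢
        omega
      · simp [h] at hj
    · by_cases h : j + 2 ≤ x + k
      · have := hyperPMF_logConcave hn hl (x + k - (j + 2))
        rw [show x + k - (j + 2) + 2 = x + k - j by omega,
          show x + k - (j + 2) + 1 = x + k - (j + 1) by omega, mul_comm] at this
        simpa only [if_pos h, if_pos (show j + 1 ≤ x + k by omega),
          if_pos (show j ≤ x + k by omega)] using this
      · simp only [if_neg h, mul_zero]
        exact sq_nonneg _
    · rw [← Finset.sum_filter, ← Finset.sum_image (f := hyperPMF n l N) (g := fun j => x + k - j)]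
      · exact sum_hyperPMF_le_one hn hl _
      · intro a ha b hb h
        have := (Finset.mem_filter.1 ha).2
        have := (Finset.mem_filter.1 hb).2
        simp only at h
        omega

end Mode

/-! ## Devroye's generator -/

lemma volume_fin_four {A B : Set I} {R : Set (I × I)} (hA : MeasurableSet A) (hB : MeasurableSet B)
    (hR : MeasurableSet R) :
    volume {u : Fin 4 → I | u 0 ∈ A ∧ u 2 ∈ B ∧ (u 1, u 3) ∈ R} = volume A * volume B * volume R := by
  have h1 := volume_preserving_piFinSuccAbove (fun _ : Fin 4 => I) 2
  have h2 := volume_preserving_piFinSuccAbove (fun _ : Fin 3 => I) 0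
  have h3 := volume_preserving_finTwoArrow I
  have h4 := (MeasurePreserving.id (volume : Measure I)).prod
    (((MeasurePreserving.id (volume : Measure I)).prod h3).comp h2)
  have h5 := (h4.comp h1).measure_preimage (s := B ×ˢ (A ×ˢ R))
    (hB.prod (hA.prod hR)).nullMeasurableSet
  rw [Measure.prod_prod] at h5
  have e : {u : Fin 4 → I | u 0 ∈ A ∧ u 2 ∈ B ∧ (u 1, u 3) ∈ R} =
      (Prod.map id (Prod.map id (MeasurableEquiv.finTwoArrow (α := I)) ∘
        (MeasurableEquiv.piFinSuccAbove (fun _ : Fin 3 => I) 0)) ∘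
        (MeasurableEquiv.piFinSuccAbove (fun _ : Fin 4 => I) 2)) ⁻¹' (B ×ˢ (A ×ˢ R)) := by
    ext u
    change _ ↔ u 2 ∈ B ∧ u 0 ∈ A ∧ (u 1, u 3) ∈ R
    exact and_left_comm
  have h6 : volume (A ×ˢ R) = volume A * volume R := Measure.prod_prod A R
  rw [e]
  refine h5.trans ?_
  change volume B * volume (A ×ˢ R) = _
  rw [h6]
  ring

lemma ae_coe_ne (c : ℝ) : ∀ᵐ v : I, (v : ℝ) ≠ c := by
  have h := volume_coe_mem (measurableSet_singleton c)
  rw [measure_mono_null Set.inter_subset_left (Real.volume_singleton)] at h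
  exact measure_eq_zero_iff_ae_notMem.1 h

lemma measurableSet_region {Y H : I → ℝ} (hY : Measurable Y) (hH : Measurable H) (κ β g : ℝ) :
    MeasurableSet {z : I × I | (κ ≤ Y z.1 ∧ Y z.1 < β) ∧ (z.2 : ℝ) * H z.1 < g} := by
  have h1 : Measurable fun z : I × I => Y z.1 := hY.comp measurable_fst
  have h2 : Measurable fun z : I × I => (z.2 : ℝ) * H z.1 :=
    (measurable_subtype_coe.comp measurable_snd).mul (hH.comp measurable_fst)
  exact ((measurableSet_le measurable_const h1).inter (measurableSet_lt h1 measurable_const)).inter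
    (measurableSet_lt h2 measurable_const)

/-! ### Areas of the acceptance regions in Devroye's method -/

section Regions

variable {p w g κ β : ℝ}

/-- The proposals on the flat part of the majorant. -/
lemma volume_flat_region (hp : 0 < p) (hw : 0 < w) (hg : 0 ≤ g) (hgp : g ≤ p)
    (hαβ : max 0 κ ≤ β) :
    volume {z : I × I | (κ ≤ (z.1 : ℝ) * w / p ∧ (z.1 : ℝ) * w / p < β) ∧
      (z.2 : ℝ) * min 1 (Real.exp (w - p * ((z.1 : ℝ) * w / p))) < g / p} =
      ENNReal.ofReal (g / w * (min β (w / p) - min (max 0 κ) (w / p))) := by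
  set α := max 0 κ with hα
  set T := w / p with hT
  have hT0 : 0 < T := div_pos hw hp
  have hα0 : 0 ≤ α := le_max_left _ _
  have hwT : ∀ v : ℝ, v * w / p = v * T := fun v => by rw [hT]; ring
  simp only [hwT]
  have hA := measurableSet_region (Y := fun v => (v : ℝ) * T)
    (H := fun v => min 1 (Real.exp (w - p * ((v : ℝ) * T)))) (by fun_prop) (by fun_prop) κ β (g / p)
  have hle : min α T ≤ min β T := min_le_min_right T hαβ
  have h1 : min β T / T ≤ 1 := (div_le_one hT0).2 (min_le_right _ _)
  rw [volume_prod_region hA (div_nonneg (le_min hα0 hT0.le) hT0.le)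
    (div_le_div_of_nonneg_right hle hT0.le) h1 (φ := fun _ => g / p) (by simp) (by fun_prop)
    (fun _ _ => by positivity)]
  · rw [intervalIntegral.integral_const, smul_eq_mul]
    congr 1
    rw [hT]
    field_simp
  -- The null sets removed here hide the difference between `[κ, β)` and the left-open intervals of
  -- `volume_prod_region`.
  · filter_upwards [ae_coe_ne (α / T), ae_coe_ne (β / T), ae_coe_ne 1] with v ha hb hc
    have hv0 : (0 : ℝ) ≤ v := v.2.1
    have hv1 : (v : ℝ) < 1 := lt_of_le_of_ne v.2.2 hc
    have ha' : (v : ℝ) * T ≠ α := fun h => ha (by rw [← h]; field_simp)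
    have hb' : (v : ℝ) * T ≠ β := fun h => hb (by rw [← h]; field_simp)
    have hvT : (v : ℝ) * T < T := by nlinarith
    have hvT0 : 0 ≤ (v : ℝ) * T := by positivity
    have hiff : (κ ≤ (v : ℝ) * T ∧ (v : ℝ) * T < β) ↔ (v : ℝ) ∈ Set.Ioc (min α T / T) (min β T / T) := by
      rw [Set.mem_Ioc, div_lt_iff₀ hT0, le_div_iff₀ hT0, min_lt_iff, le_min_iff]
      constructor
      · rintro ⟨h2, h3⟩
        exact ⟨Or.inl (lt_of_le_of_ne (max_le hvT0 h2) (Ne.symm ha')), h3.le, hvT.le⟩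
      · rintro ⟨h2, h3, _⟩
        have h4 : α < v * T := by
          rcases h2 with h2 | h2
          · exact h2
          · exact absurd h2 (not_lt.2 hvT.le)
        exact ⟨(le_max_right _ _).trans h4.le, lt_of_le_of_ne h3 hb'⟩
    have hmin : min 1 (Real.exp (w - p * ((v : ℝ) * T))) = 1 := by
      refine min_eq_left (Real.one_le_exp ?_)
      have : p * T = w := by rw [hT]; field_simp
      nlinarith
    by_cases h : (v : ℝ) ∈ Set.Ioc (min α T / T) (min β T / T)
    · rw [Set.indicator_of_mem h, ← volume_coe_lt ((div_le_one hp).2 hgp)]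
      congr 1
      ext u
      simp only [Set.mem_ofPred_eq, hmin, mul_one, hiff, h, true_and]
    · rw [Set.indicator_of_notMem h]
      refine measure_mono_null (t := ∅) (fun u hu => ?_) measure_empty
      exact h (hiff.1 hu.1)

/-- The proposals on the exponential part of the majorant. -/
lemma volume_tail_region (hp : 0 < p) (hw : 0 < w) (hg : 0 ≤ g) (hαβ : max 0 κ ≤ β)
    (hgβ : g / p ≤ Real.exp (w - p * β)) :
    volume {z : I × I | (κ ≤ (w - Real.log (z.1 : ℝ)) / p ∧ (w - Real.log (z.1 : ℝ)) / p < β) ∧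
      (z.2 : ℝ) * min 1 (Real.exp (w - p * ((w - Real.log (z.1 : ℝ)) / p))) < g / p} =
      ENNReal.ofReal (g * (max β (w / p) - max (max 0 κ) (w / p))) := by
  set α := max 0 κ with hα
  set T := w / p with hT
  have hT0 : 0 < T := div_pos hw hp
  have hα0 : 0 ≤ α := le_max_left _ _
  have hpT : p * T = w := by rw [hT]; field_simp
  have hA := measurableSet_region (Y := fun v => (w - Real.log (v : ℝ)) / p)
    (H := fun v => min 1 (Real.exp (w - p * ((w - Real.log (v : ℝ)) / p)))) (by fun_prop)
    (by fun_prop) κ β (g / p)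
  set a := Real.exp (w - p * max β T) with ha
  set b := Real.exp (w - p * max α T) with hb
  have ha0 : 0 < a := Real.exp_pos _
  have hb0 : 0 < b := Real.exp_pos _
  have hle : max α T ≤ max β T := max_le_max_right T hαβ
  have hab : a ≤ b := Real.exp_le_exp.2 (by nlinarith)
  have hb1 : b ≤ 1 := by
    rw [hb, ← Real.exp_zero]
    refine Real.exp_le_exp.2 ?_
    have := le_max_right α T
    nlinarith
  have hint : IntervalIntegrable (fun x : ℝ => g / p * x⁻¹) volume a b := by
    refine (intervalIntegral.intervalIntegrable_inv (fun x hx => ?_) continuousOn_id).const_mul _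
    rw [Set.uIcc_of_le hab] at hx
    exact (ha0.trans_le hx.1).ne'
  rw [volume_prod_region hA ha0.le hab hb1 (φ := fun x => g / p * x⁻¹) hint (by fun_prop)
    (fun x hx => mul_nonneg (by positivity) (inv_nonneg.2 (ha0.trans hx.1).le))]
  · rw [intervalIntegral.integral_const_mul, integral_inv_of_pos ha0 hb0,
      Real.log_div hb0.ne' ha0.ne', ha, hb, Real.log_exp, Real.log_exp]
    congr 1
    field_simp
    ring
  · filter_upwards [ae_coe_ne 0] with v hv
    have hv0 : (0 : ℝ) < v := lt_of_le_of_ne v.2.1 (Ne.symm hv)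
    have hv1 : (v : ℝ) ≤ 1 := v.2.2
    set y := (w - Real.log (v : ℝ)) / p with hy
    have hyl : w - p * y = Real.log v := by rw [hy]; field_simp; ring
    have hTy : T ≤ y := div_le_div_of_nonneg_right
      (by linarith [Real.log_nonpos hv0.le hv1]) hp.le
    -- At the proposal generated from `v` the majorant is `v` itself. So the section has length `g /
    -- (p v)`, and the area is an integral of `1 / v`, that is, of constant density in `y`.
    have hexp : min 1 (Real.exp (w - p * y)) = v := by
      rw [hyl, Real.exp_log hv0, min_eq_right hv1]
    have hIoc : ∀ t : ℝ, Real.exp (w - p * t) < v ↔ y < t := fun t => by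
      rw [← Real.lt_log_iff_exp_lt hv0, ← hyl, sub_lt_sub_iff_left, mul_lt_mul_iff_right₀ hp]
    have hiff : (κ ≤ y ∧ y < β) ↔ (v : ℝ) ∈ Set.Ioc a b := by
      rw [Set.mem_Ioc, ← not_lt (a := b), ha, hb, hIoc, hIoc, not_lt, max_le_iff, lt_max_iff, hα,
        max_le_iff]
      constructor
      · rintro ⟨h2, h3⟩
        exact ⟨Or.inl h3, ⟨hT0.le.trans hTy, h2⟩, hTy⟩
      · rintro ⟨h2, ⟨_, h3⟩, _⟩
        exact ⟨h3, h2.resolve_right (not_lt.2 hTy)⟩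
    by_cases h : (v : ℝ) ∈ Set.Ioc a b
    · have hyβ := (hiff.2 h).2
      have hgv : g / p ≤ v := hgβ.trans ((hIoc β).2 hyβ).le
      rw [Set.indicator_of_mem h, ← div_eq_mul_inv, ← volume_coe_lt ((div_le_one hv0).2 hgv)]
      congr 1
      ext u
      simp only [Set.mem_ofPred_eq, hexp, hiff, h, true_and]
      exact (lt_div_iff₀ hv0).symm
    · rw [Set.indicator_of_notMem h]
      refine measure_mono_null (t := ∅) (fun u hu => ?_) measure_empty
      exact h (hiff.1 hu.1)

/-- The probability of a proposal in `[κ, β)` with sign in `s` that is accepted. -/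
lemma volume_trial_region {s : Set I} (hs : MeasurableSet s) (hp : 0 < p) (hw : 0 < w) (hg : 0 ≤ g)
    (hgp : g ≤ p) (hαβ : max 0 κ ≤ β) (hgβ : g / p ≤ Real.exp (w - p * β)) {Y : (Fin 4 → I) → ℝ}
    (hY : ∀ u, Y u = if (u 0 : ℝ) ≤ w / (1 + w) then (u 1 : ℝ) * w / p
      else (w - Real.log (u 1 : ℝ)) / p) :
    MeasurableSet {u : Fin 4 → I | u 2 ∈ s ∧ (κ ≤ Y u ∧ Y u < β) ∧
        (u 3 : ℝ) * min 1 (Real.exp (w - p * Y u)) < g / p} ∧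
      volume {u : Fin 4 → I | u 2 ∈ s ∧ (κ ≤ Y u ∧ Y u < β) ∧
        (u 3 : ℝ) * min 1 (Real.exp (w - p * Y u)) < g / p} =
      volume s * ENNReal.ofReal (g / (1 + w) * (β - max 0 κ)) := by
  set A : Set I := {v : I | (v : ℝ) ≤ w / (1 + w)} with hA
  have hAm : MeasurableSet A := measurableSet_le measurable_subtype_coe measurable_const
  have hw1 : 0 < 1 + w := by linarith
  have hA1 : volume A = ENNReal.ofReal (w / (1 + w)) := by
    have h := volume_coe_mem (measurableSet_Iic (a := w / (1 + w)))
    have hlt : w / (1 + w) ≤ 1 := (div_le_one hw1).2 (by linarith)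
    have e : Set.Iic (w / (1 + w)) ∩ Set.Icc (0 : ℝ) 1 = Set.Icc 0 (w / (1 + w)) := by
      ext x
      simp only [Set.mem_inter_iff, Set.mem_Iic, Set.mem_Icc]
      exact ⟨fun h => ⟨h.2.1, h.1⟩, fun h => ⟨h.2, h.1, h.2.trans hlt⟩⟩
    rw [e, Real.volume_Icc, sub_zero] at h
    exact h
  have hA2 : volume Aᶜ = ENNReal.ofReal (1 / (1 + w)) := by
    rw [prob_compl_eq_one_sub hAm, hA1, ← ENNReal.ofReal_one, ← ENNReal.ofReal_sub _ (by positivity)]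
    congr 1
    field_simp
    ring
  set R₁ : Set (I × I) := {z | (κ ≤ (z.1 : ℝ) * w / p ∧ (z.1 : ℝ) * w / p < β) ∧
      (z.2 : ℝ) * min 1 (Real.exp (w - p * ((z.1 : ℝ) * w / p))) < g / p} with hR₁
  set R₂ : Set (I × I) := {z | (κ ≤ (w - Real.log (z.1 : ℝ)) / p ∧
      (w - Real.log (z.1 : ℝ)) / p < β) ∧
      (z.2 : ℝ) * min 1 (Real.exp (w - p * ((w - Real.log (z.1 : ℝ)) / p))) < g / p} with hR₂
  have hR₁m : MeasurableSet R₁ := measurableSet_region (Y := fun v => (v : ℝ) * w / p)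
    (H := fun v => min 1 (Real.exp (w - p * ((v : ℝ) * w / p)))) (by fun_prop) (by fun_prop) κ β _
  have hR₂m : MeasurableSet R₂ := measurableSet_region (Y := fun v => (w - Real.log (v : ℝ)) / p)
    (H := fun v => min 1 (Real.exp (w - p * ((w - Real.log (v : ℝ)) / p)))) (by fun_prop)
    (by fun_prop) κ β _
  have e : {u : Fin 4 → I | u 2 ∈ s ∧ (κ ≤ Y u ∧ Y u < β) ∧
        (u 3 : ℝ) * min 1 (Real.exp (w - p * Y u)) < g / p} =
      {u | u 0 ∈ A ∧ u 2 ∈ s ∧ (u 1, u 3) ∈ R₁} ∪ {u | u 0 ∈ Aᶜ ∧ u 2 ∈ s ∧ (u 1, u 3) ∈ R₂} := by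
    ext u
    simp only [Set.mem_ofPred_eq, Set.mem_union, Set.mem_compl_iff, hA, hR₁, hR₂, hY]
    by_cases h : (u 0 : ℝ) ≤ w / (1 + w) <;> simp [h]
  have hm : ∀ {A : Set I} {R : Set (I × I)}, MeasurableSet A → MeasurableSet R →
      MeasurableSet {u : Fin 4 → I | u 0 ∈ A ∧ u 2 ∈ s ∧ (u 1, u 3) ∈ R} := fun hA hR =>
    (measurable_pi_apply 0 hA).inter ((measurable_pi_apply 2 hs).inter
      (((measurable_pi_apply 1).prodMk (measurable_pi_apply 3)) hR))
  rw [e]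
  refine ⟨(hm hAm hR₁m).union (hm hAm.compl hR₂m), ?_⟩
  rw [measure_union (Set.disjoint_left.2 fun u h h' => h'.1 h.1) (hm hAm.compl hR₂m),
    volume_fin_four hAm hs hR₁m, volume_fin_four hAm.compl hs hR₂m, hA1, hA2,
    volume_flat_region hp hw hg hgp hαβ, volume_tail_region hp hw hg hαβ hgβ]
  have h1 : 0 ≤ g / w * (min β (w / p) - min (max 0 κ) (w / p)) :=
    mul_nonneg (by positivity) (sub_nonneg.2 (min_le_min_right _ hαβ))
  have h2 : 0 ≤ g * (max β (w / p) - max (max 0 κ) (w / p)) :=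
    mul_nonneg hg (sub_nonneg.2 (max_le_max_right _ hαβ))
  rw [mul_comm _ (volume s), mul_comm _ (volume s), mul_assoc, mul_assoc, ← mul_add,
    ← ENNReal.ofReal_mul (by positivity), ← ENNReal.ofReal_mul (by positivity),
    ← ENNReal.ofReal_add (mul_nonneg (by positivity) h1) (mul_nonneg (by positivity) h2)]
  congr 2
  -- Both parts accept with density `g / (1 + w)` in `y`; since `min + max` is the sum, their two
  -- lengths add up to that of `[max 0 κ, β)`.
  have e1 := min_add_max β (w / p)
  have e2 := min_add_max (max 0 κ) (w / p)
  have e3 : min β (w / p) = β + w / p - max β (w / p) := by linarith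
  have e4 : min (max 0 κ) (w / p) = max 0 κ + w / p - max (max 0 κ) (w / p) := by linarith
  rw [e3, e4]
  field_simp
  ring

end Regions

/-! ### The law of one trial of Devroye's method -/

section Devroye

variable {n l N : ℕ}

lemma exp_lnHyper (hn : n ≤ N) (hl : l ≤ N) {x : ℕ} (h : x ≤ n ∧ x ≤ l ∧ n + l ≤ N + x) :
    Real.exp (lnHyper n l N x).val = hyperPMF n l N x := by
  have hval : (lnHyper n l N x).val = (lnChoose l x).val + (lnChoose (N - l) (n - x)).val -
    (lnChoose N n).val := rfl
  rw [hval, Real.exp_sub, Real.exp_add, exp_lnChoose h.2.1, exp_lnChoose (by omega),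
    exp_lnChoose hn, hyperPMF, if_pos h.1, mul_one]

/-- The absolute value of the proposal of Devroye's method, relative to the mode. -/
noncomputable def devroyeY (p : ℝ) (u : Fin 4 → I) : ℝ :=
  if (u 0 : ℝ) ≤ (1 + p / 2) / (1 + (1 + p / 2)) then (u 1 : ℝ) * (1 + p / 2) / p
  else (1 + p / 2 - Real.log (u 1 : ℝ)) / p

lemma devroyeY_nonneg {p : ℝ} (hp : 0 < p) (u : Fin 4 → I) : 0 ≤ devroyeY p u := by
  have h1 : (0 : ℝ) ≤ u 1 := (u 1).2.1
  have h2 := Real.log_nonpos (u 1).2.1 (u 1).2.2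
  unfold devroyeY
  split_ifs
  · positivity
  · exact div_nonneg (by linarith) hp.le

/-- The acceptance test of Devroye's method for the proposal `x`, where `b` is the test whether `x`
belongs to the support. -/
noncomputable def devroyeTest (n l N : ℕ) (lp p y v : ℝ) (x : ℤ) (b : Bool) : Run (Option ℕ) :=
  if b = true then do
    let lf ← lnHyper n l N x.toNat
    let accept ← ops 9 (decide (v * min 1 (Real.exp (1 + p / 2 - p * y)) < Real.exp (lf - lp)))
    ops 1 (if accept then some x.toNat else none)
  else ops 1 none

lemma devroyeTest_time (n l N : ℕ) (lp p y v : ℝ) (x : ℤ) (b : Bool) :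
    (devroyeTest n l N lp p y v x b).time ≤ 32 := by
  cases b
  · change ((1 : ℕ) : ℕ∞) ≤ 32
    norm_num
  · change ((22 : ℕ) : ℕ∞) + ((9 : ℕ) + (1 : ℕ)) ≤ 32
    norm_num

lemma devroyeTest_val_iff (hn : n ≤ N) (hl : l ≤ N) {lp p y v : ℝ} (hp : Real.exp lp = p)
    (z : ℤ) (x : ℕ) :
    (devroyeTest n l N lp p y v z
      (decide (max 0 ((n : ℤ) + l - N) ≤ z ∧ z ≤ min (n : ℤ) l))).val = some x ↔
      z = x ∧ (x ≤ n ∧ x ≤ l ∧ n + l ≤ N + x) ∧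
        v * min 1 (Real.exp (1 + p / 2 - p * y)) < hyperPMF n l N x / p := by
  by_cases hz : max 0 ((n : ℤ) + l - N) ≤ z ∧ z ≤ min (n : ℤ) l
  · rw [decide_eq_true hz]
    obtain ⟨t, rfl⟩ := Int.eq_ofNat_of_zero_le ((le_max_left _ _).trans hz.1)
    have hsupp : t ≤ n ∧ t ≤ l ∧ n + l ≤ N + t := by omega
    change (if decide (_ < Real.exp ((lnHyper n l N t).val - lp)) = true then some t else none) =
      _ ↔ _
    rw [Real.exp_sub _ lp, exp_lnHyper hn hl hsupp, hp]
    simp only [decide_eq_true_eq]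
    split_ifs with hacc
    · simp only [Option.some.injEq, Nat.cast_inj]
      constructor
      · rintro rfl
        exact ⟨rfl, hsupp, hacc⟩
      · exact fun h => h.1
    · simp only [Nat.cast_inj, false_iff]
      rintro ⟨rfl, _, h⟩
      exact hacc h
  · rw [decide_eq_false hz]
    change none = some x ↔ _
    simp only [reduceCtorEq, false_iff]
    rintro ⟨rfl, h2, _⟩
    omega

lemma devroyeTrial_time (u : Fin 4 → I) : (devroyeTrial n l N u).time ≤ 84 := by
  have e : ∃ lp p y v x b, (devroyeTrial n l N u).time =
      ((6 : ℕ) : ℕ∞) + ((22 : ℕ) + ((1 : ℕ) + ((2 : ℕ) + ((8 : ℕ) + ((2 : ℕ) + ((3 : ℕ) + ((8 : ℕ) +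
        (devroyeTest n l N lp p y v x b).time))))))) := ⟨_, _, _, _, _, _, rfl⟩
  obtain ⟨lp, p, y, v, x, b, e⟩ := e
  rw [e]
  calc _ ≤ ((6 : ℕ) : ℕ∞) + ((22 : ℕ) + ((1 : ℕ) + ((2 : ℕ) + ((8 : ℕ) + ((2 : ℕ) + ((3 : ℕ) +
        ((8 : ℕ) + 32))))))) := by gcongr; exact devroyeTest_time _ _ _ _ _ _ _ _ _
    _ ≤ 84 := by norm_num

lemma devroyeTrial_val_iff (hn : n ≤ N) (hl : l ≤ N) (u : Fin 4 → I) (x : ℕ) {m : ℕ}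
    (hm : m = (n + 1) * (l + 1) / (N + 2)) {p : ℝ} (hp : p = hyperPMF n l N m) :
    (devroyeTrial n l N u).val = some x ↔
      ((if (u 2 : ℝ) < 1 / 2 then (m : ℤ) - ⌊devroyeY p u + 1 / 2⌋
        else (m : ℤ) + ⌊devroyeY p u + 1 / 2⌋) = x) ∧ (x ≤ n ∧ x ≤ l ∧ n + l ≤ N + x) ∧
      (u 3 : ℝ) * min 1 (Real.exp (1 + p / 2 - p * devroyeY p u)) < hyperPMF n l N x / p := by
  subst hm
  have hpe : Real.exp (lnHyper n l N ((n + 1) * (l + 1) / (N + 2))).val = p := by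
    rw [hp, exp_lnHyper hn hl (mode_mem hn hl)]
  rw [← devroyeTest_val_iff hn hl hpe]
  subst hpe
  rfl

/-- Returning `x` constrains the sign and the rounded distance separately; at `x = m` the sign is
irrelevant. -/
lemma devroye_sign_iff {m x : ℕ} {y : ℝ} (hy : 0 ≤ y) (u : ℝ) :
    (if u < 1 / 2 then (m : ℤ) - ⌊y + 1 / 2⌋ else (m : ℤ) + ⌊y + 1 / 2⌋) = x ↔
      ((x < m → u < 1 / 2) ∧ (m < x → ¬ u < 1 / 2)) ∧
      (((((x : ℤ) - m).natAbs : ℕ) : ℝ) - 1 / 2 ≤ y ∧ y < ((((x : ℤ) - m).natAbs : ℕ) : ℝ) + 1 / 2) := by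
  set k := ((x : ℤ) - m).natAbs with hk
  have hfl : ((k : ℝ) - 1 / 2 ≤ y ∧ y < (k : ℝ) + 1 / 2) ↔ ⌊y + 1 / 2⌋ = (k : ℤ) := by
    rw [Int.floor_eq_iff]
    push_cast
    constructor
    · rintro ⟨h1, h2⟩; constructor <;> linarith
    · rintro ⟨h1, h2⟩; constructor <;> linarith
  have h0 : 0 ≤ ⌊y + 1 / 2⌋ := Int.floor_nonneg.2 (by linarith)
  rw [hfl]
  by_cases hu : u < 1 / 2
  · simp only [hu, if_true, not_true, implies_true, true_and, imp_false, not_lt]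
    omega
  · simp only [hu, if_false, not_false_iff, implies_true, and_true, imp_false, not_lt]
    omega

lemma volume_sign {m x : ℕ} :
    MeasurableSet {v : I | (x < m → (v : ℝ) < 1 / 2) ∧ (m < x → ¬ (v : ℝ) < 1 / 2)} ∧
    volume {v : I | (x < m → (v : ℝ) < 1 / 2) ∧ (m < x → ¬ (v : ℝ) < 1 / 2)} =
      if x = m then 1 else ENNReal.ofReal (1 / 2) := by
  have h1 : MeasurableSet {v : I | (v : ℝ) < 1 / 2} :=
    measurableSet_lt measurable_subtype_coe measurable_const
  have h2 : volume {v : I | (v : ℝ) < 1 / 2} = ENNReal.ofReal (1 / 2) :=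
    volume_coe_lt (by norm_num)
  rcases lt_trichotomy x m with h | h | h
  · have e : {v : I | (x < m → (v : ℝ) < 1 / 2) ∧ (m < x → ¬ (v : ℝ) < 1 / 2)} =
        {v : I | (v : ℝ) < 1 / 2} := by
      ext v; simp [h, h.not_gt]
    rw [e, if_neg h.ne]
    exact ⟨h1, h2⟩
  · have e : {v : I | (x < m → (v : ℝ) < 1 / 2) ∧ (m < x → ¬ (v : ℝ) < 1 / 2)} = Set.univ := by
      ext v; simp [h]
    rw [e, if_pos h]
    exact ⟨MeasurableSet.univ, measure_univ⟩
  · have e : {v : I | (x < m → (v : ℝ) < 1 / 2) ∧ (m < x → ¬ (v : ℝ) < 1 / 2)} =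
        {v : I | (v : ℝ) < 1 / 2}ᶜ := by
      ext v; simp [h, h.not_gt]
    rw [e, if_neg h.ne']
    refine ⟨h1.compl, ?_⟩
    rw [prob_compl_eq_one_sub h1, h2, ← ENNReal.ofReal_one, ← ENNReal.ofReal_sub _ (by norm_num)]
    norm_num

/-- Off the mode, one sign (probability 1/2) and a proposal interval of length 1 lead to `x`. At the
mode both signs do, but the interval is cut to `[0, 1/2)`. Both cases give the same factor `1 / (2
(1 + w))`. -/
lemma devroyeTrial_law (hn : n ≤ N) (hl : l ≤ N) {p : ℝ}
    (hp : p = hyperPMF n l N ((n + 1) * (l + 1) / (N + 2))) (x : ℕ) :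
    MeasurableSet {u | (devroyeTrial n l N u).val = some x} ∧
      volume {u | (devroyeTrial n l N u).val = some x} =
        hyperLaw n l N x * ENNReal.ofReal (1 / (2 * (1 + (1 + p / 2)))) := by
  obtain ⟨m, hm⟩ : ∃ m, m = (n + 1) * (l + 1) / (N + 2) := ⟨_, rfl⟩
  rw [← hm] at hp
  simp only [devroyeTrial_val_iff hn hl _ x hm hp]
  have hp0 : 0 < p := by
    rw [hp, hyperPMF_pos_iff hn hl, hm]
    exact mode_mem hn hl
  simp only [devroye_sign_iff (devroyeY_nonneg hp0 _)]
  by_cases hx : x ≤ n ∧ x ≤ l ∧ n + l ≤ N + x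
  · simp only [hx, true_and, and_assoc]
    simp only [← and_assoc]
    set k := ((x : ℤ) - m).natAbs with hk
    have hfx := (hyperPMF_pos_iff hn hl x).2 hx
    obtain ⟨b1, b2⟩ := hyperPMF_le_mode hn hl hfx hm (k := k) (by omega)
    rw [← hp] at b1 b2
    have hk0 : (0 : ℝ) ≤ k := Nat.cast_nonneg k
    obtain ⟨c1, c2⟩ := volume_trial_region (κ := (k : ℝ) - 1 / 2) (β := (k : ℝ) + 1 / 2)
      (volume_sign (m := m) (x := x)).1 hp0
      (w := 1 + p / 2) (by positivity) hfx.le b1 (max_le (by linarith) (by linarith))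
      -- This is the purpose of the summand `p / 2` in `w`: it makes up for the distance from `k` to
      -- the far end `k + 1/2` of the interval.
      (by rw [div_le_iff₀ hp0, mul_comm, show 1 + p / 2 - p * ((k : ℝ) + 1 / 2) = 1 - p * k by ring]
          exact b2) (Y := devroyeY p) fun u => rfl
    simp only [← and_assoc] at c1 c2
    refine ⟨c1, c2.trans ?_⟩
    rw [volume_sign.2, hyperLaw, ← ENNReal.ofReal_mul (hyperPMF_nonneg _ _ _ _)]
    by_cases hxm : x = m
    · have : k = 0 := by omega
      rw [if_pos hxm, one_mul, this]
      congr 1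
      norm_num
      field_simp
    · have : (1 : ℝ) ≤ k := by exact_mod_cast (by omega : 1 ≤ k)
      rw [if_neg hxm, ← ENNReal.ofReal_mul (by norm_num), max_eq_right (by linarith)]
      congr 1
      field_simp
      ring
  · have h0 : hyperLaw n l N x = 0 := by
      by_contra h
      obtain ⟨h1, h2, h3⟩ := hyperLaw_ne_zero h
      exact hx (by omega)
    simp [hx, h0]

theorem devroye_isHypergeometric : devroye.IsHypergeometric := by
  -- The success probability is `1 / (4 + p)` with `p ≤ 1`.
  refine ⟨84, 1 / 5, by norm_num, fun n l N hn hl => ?_⟩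
  set p := hyperPMF n l N ((n + 1) * (l + 1) / (N + 2)) with hp
  have hp0 : 0 ≤ p := hyperPMF_nonneg _ _ _ _
  have hp1 : p ≤ 1 := by
    simpa using sum_hyperPMF_le_one hn hl {(n + 1) * (l + 1) / (N + 2)}
  have H : TrialLaw (devroye.trial n l N) (hyperLaw n l N) 84
      (ENNReal.ofReal (1 / (2 * (1 + (1 + p / 2))))) :=
    TrialLaw.of_tsum devroyeTrial_time (fun x => (devroyeTrial_law hn hl hp x).1)
      (fun x => (devroyeTrial_law hn hl hp x).2) (tsum_hyperLaw hn hl)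
  have hs : volume.real {u | (devroye.trial n l N u).val.isSome = true} =
      1 / (2 * (1 + (1 + p / 2))) := by
    rw [measureReal_def, H.accept, ENNReal.toReal_ofReal (by positivity)]
  refine ⟨H.time_le, H.meas, ?_, fun x => ?_⟩
  · rw [hs, div_le_div_iff₀ (by norm_num) (by positivity)]
    linarith
  · rw [hs, measureReal_def, H.law, ENNReal.toReal_mul, hyperLaw,
      ENNReal.toReal_ofReal (hyperPMF_nonneg _ _ _ _), ENNReal.toReal_ofReal (by positivity)]

end Devroye

end Sampling

/-! ### The main theorem -/

theorem theorem1 :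
    Sampling.devroye.IsHypergeometric ∧
    ∀ G : Sampling.Generator, G.IsHypergeometric →
    ∀ L : Sampling.LocalSampler, L.Proper →
    ∀ C c : ℝ, 0 < c →
    ∃ A : ℝ, 0 < A ∧
      ∀ (p n N : ℕ) (B : ℕ → ℕ), 1 ≤ p → n ≤ N → B 0 = 0 → B p = N →
        (∀ i < p, B i ≤ B (i + 1)) →
        (∀ i < p, (B (i + 1) : ℝ) - (B i : ℝ) ≤ C * ((N : ℝ) / (p : ℝ))) →
        Sampling.hashLaw
            {h | ENNReal.ofReal (A * ((n : ℝ) / (p : ℝ) + Real.logb 2 (p : ℝ))) <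
              ((Sampling.parallelTime G L B n p h : ℕ∞) : ℝ≥0∞)}
          ≤ ENNReal.ofReal ((p : ℝ) ^ (-c)) ∧
        (∀ᵐ h ∂Sampling.hashLaw, Sampling.parallelTime G L B n p h < ⊤ ∧
          ∀ i ∈ Finset.Icc 1 p, (Sampling.processor G L B n p h i).val.Nodup ∧
            ∀ x ∈ (Sampling.processor G L B n p h i).val, B (i - 1) < x ∧ x ≤ B i) ∧
        ∀ S ∈ (Finset.Icc 1 N).powersetCard n,
          Sampling.hashLaw {h | Sampling.sample G L B n p h = S} =
            ((N.choose n : ℝ≥0∞))⁻¹ := by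
  refine ⟨Sampling.devroye_isHypergeometric, fun G hG L hL C c hc => Sampling.algorithmP hG hL C hc⟩
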